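/- Let $0<q<1$, let $k_1,k_2>0$, let $\varepsilon\in\frac12\mathbb Z$, and let $\mathbb N=\{0,1,2,\dots\}$. **The algebra.** $\mathcal U_q$ is the unital associative complex algebra generated by $K,K^{-1},E,F$ with relations $KK^{-1}=1=K^{-1}K$, $KE=qEK$, $KF=q^{-1}FK$, $EF-FE=\frac{K^2-K^{-2}}{q-q^{-1}}$. Its Casimir element is $\Omega=\frac{q^{-1}K^2+qK^{-2}-2}{(q^{-1}-q)^2}+EF$, and its comultiplication $\Delta:\mathcal U_q\to\mathcal U_q\otimes\mathcal U_q$ is the algebra homomorphism with $\Delta(K^{\pm1})=K^{\pm1}\otimes K^{\pm1}$, $\Delta(E)=K\otimes E+E\otimes K^{-1}$, $\Delta(F)=K\otimes F+F\otimes K^{-1}$. **The representations.** The following representations act on the finite linear combinations of the standard orthonormal basis vectors $e_n$ of $\ell^2(\mathbb N)$ (for $\pi_k^\pm$, $k>0$, with $e_{-1}=0$) or of $\ell^2(\mathbb Z)$ (for $\pi^{\mathrm S}_{\sigma,\epsilon}$, $\sigma,\epsilon\in\mathbb R$); $K^{-1}$ acts by the inverse of $K$. - $\pi_k^+$: $Ke_n=q^{k+n}e_n$,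 $(q^{-1}-q)Ee_n=q^{-\frac12-k-n}\sqrt{(1-q^{2n+2})(1-q^{4k+2n})}\,e_{n+1}$, $(q^{-1}-q)Fe_n=-q^{\frac12-k-n}\sqrt{(1-q^{2n})(1-q^{4k+2n-2})}\,e_{n-1}$. - $\pi_k^-$: $Ke_n=q^{-(k+n)}e_n$, $(q^{-1}-q)Ee_n=-q^{\frac12-k-n}\sqrt{(1-q^{2n})(1-q^{4k+2n-2})}\,e_{n-1}$, $(q^{-1}-q)Fe_n=q^{-\frac12-k-n}\sqrt{(1-q^{2n+2})(1-q^{4k+2n})}\,e_{n+1}$. - $\pi^{\mathrm S}_{\sigma,\epsilon}$: $Ke_n=q^{n+\epsilon}e_n$, $(q^{-1}-q)Ee_n=q^{-\frac12-n-\epsilon}\sqrt{(1+q^{2n+2\epsilon+2\sigma+1})(1+q^{2n+2\epsilon-2\sigma+1})}\,e_{n+1}$, $(q^{-1}-q)Fe_n=-q^{\frac12-n-\epsilon}\sqrt{(1+q^{2n+2\epsilon+2\sigma-1})(1+q^{2n+2\epsilon-2\sigma-1})}\,e_{n-1}$. Define $$\mathcal T'=\Big(\big(\pi^-_{k_1}\otimes\pi^{\mathrm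 S}_{k_2-\frac12,\varepsilon+k_2}\big)\oplus\big(\pi^{\mathrm S}_{k_1-\frac12,-\varepsilon-k_1}\otimes\pi^+_{k_2}\big)\Big)\Delta ,$$ acting on the finite linear combinations of the vectors $e_i\otimes e_j$ in $\ell^2(\mathbb N)\otimes\ell^2(\mathbb Z)\oplus\ell^2(\mathbb Z)\otimes\ell^2(\mathbb N)$. For $p\in\mathbb Z$ and $n\in\mathbb N$ let $f^-_{p,n}=e_n\otimes e_{n+p}$ (in the first summand), $f^+_{p,n}=e_{2\varepsilon-n+p}\otimes e_n$ (in the second summand), and $\mathcal A_p=\mathrm{span}\{f^-_{p,n}\mid n\in\mathbb N\}\oplus\mathrm{span}\{f^+_{p,n}\mid n\in\mathbb N\}$. **The functions $r_x$.** For a base $q\in(0,1)$ write $(x;q)_n=\prod_{k=0}^{n-1}(1-xq^k)$ for $n\in\mathbb N\cup\{\infty\}$, $(x_1,\dots,x_j;q)_n=\prod_i(x_i;q)_n$, $\theta(x;q)=(x,q/x;q)_\infty$, and let $$P_m(x;a,b,c;q)=\sum_{k=0}^{\infty}\frac{(q^{-m},abq^{m+1},x;q)_k}{(q,aq,cq;q)_k}\,q^k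 ,\qquad u(x;a,b,c;q)=\frac{(x/a,x/c;q)_\infty}{(x,bx/c;q)_\infty},$$ $$v(m;a,b,c;q)=\frac{1-abq^{2m+1}}{aq(1-abq)}\,\frac{(aq,bq,cq,abq/c;q)_\infty}{(q,abq^2;q)_\infty\,\theta(c/a;q)}\,\frac{(aq,abq,cq;q)_m}{(q,bq,abq/c;q)_m}\,(-acq^2)^{-m}q^{-\frac12m(m-1)},$$ where the common factor $1-abq$ of $(1-abq^{2m+1})(abq;q)_m$ and $1-abq$ is cancelled, so that $v$ is also defined when $abq=1$. Put $$r_x(m;a,b,c;q)=\sqrt{|x|\,u(x;a,b,c;q)\,v(m;a,b,c;q)}\;P_m(x;a,b,c;q).$$ **Proposition.** Let $p\in\mathbb Z$ and define the linear map $\Theta$ on $\mathcal A_p$ by $$f^-_{p,n}\mapsto\Big(m\mapsto r_{q^{2n+4k_1}}\big(m;q^{4k_1-2},q^{4k_2-2},-q^{4k_1-2p-2\varepsilon-2};q^2\big)\Big),$$ $$f^+_{p,n}\mapsto\Big(m\mapsto(-1)^n\,r_{-q^{2n+4k_1-2p-2\varepsilon}}\big(m;q^{4k_1-2},q^{4k_2-2},-q^{4k_1-2p-2\varepsilon-2};q^2\big)\Big).$$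 Then $\Theta$ maps $\mathcal A_p$ into $\ell^2(\mathbb N)$ and extends to a unitary operator from the closure $\overline{\mathcal A_p}$ onto $\ell^2(\mathbb N)$. Furthermore, $\mathcal A_p$ is invariant under $\mathcal T'(\Omega)$, and for all $f\in\mathcal A_p$ and $m\in\mathbb N$ $$\big(\Theta\,\mathcal T'(\Omega)f\big)(m)=-(q^{-1}-q)^{-2}\Big(q^{2k_1+2k_2-1+2m}+q^{-(2k_1+2k_2-1+2m)}+2\Big)\,(\Theta f)(m).$$ -/

import Mathlib

open scoped TensorProduct

noncomputable section

namespace QSU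

/-! ### The quantum algebra `U_q(su(1,1))` -/

/-- The generators `K`, `K⁻¹`, `E`, `F`. -/
inductive Gen
  | K
  | Kinv
  | E
  | F

/-- The defining relations for four elements `k, k', e, f` of a complex algebra
(standing for `K, K⁻¹, E, F`). -/
structure Relations (q : ℝ) {A : Type*} [Ring A] [Algebra ℂ A] (k k' e f : A) : Prop where
  k_mul_k' : k * k' = 1
  k'_mul_k : k' * k = 1
  k_mul_e : k * e = (q : ℂ) • (e * k)
  k_mul_f : k * f = ((q⁻¹ : ℝ) : ℂ) • (f * k)
  e_mul_f : e * f - f * e = (((q - q⁻¹)⁻¹ : ℝ) : ℂ) • (k * k - k' * k')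

/-- The relations imposed on the free algebra. -/
inductive Rel (q : ℝ) : FreeAlgebra ℂ Gen → FreeAlgebra ℂ Gen → Prop
  | k_mul_k' : Rel q (FreeAlgebra.ι ℂ Gen.K * FreeAlgebra.ι ℂ Gen.Kinv) 1
  | k'_mul_k : Rel q (FreeAlgebra.ι ℂ Gen.Kinv * FreeAlgebra.ι ℂ Gen.K) 1
  | k_mul_e : Rel q (FreeAlgebra.ι ℂ Gen.K * FreeAlgebra.ι ℂ Gen.E)
      ((q : ℂ) • (FreeAlgebra.ι ℂ Gen.E * FreeAlgebra.ι ℂ Gen.K))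
  | k_mul_f : Rel q (FreeAlgebra.ι ℂ Gen.K * FreeAlgebra.ι ℂ Gen.F)
      (((q⁻¹ : ℝ) : ℂ) • (FreeAlgebra.ι ℂ Gen.F * FreeAlgebra.ι ℂ Gen.K))
  | e_mul_f : Rel q
      (FreeAlgebra.ι ℂ Gen.E * FreeAlgebra.ι ℂ Gen.F -
        FreeAlgebra.ι ℂ Gen.F * FreeAlgebra.ι ℂ Gen.E)
      ((((q - q⁻¹)⁻¹ : ℝ) : ℂ) • (FreeAlgebra.ι ℂ Gen.K * FreeAlgebra.ι ℂ Gen.K -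
        FreeAlgebra.ι ℂ Gen.Kinv * FreeAlgebra.ι ℂ Gen.Kinv))

/-- The unital associative complex algebra `U_q` given by generators and relations. -/
abbrev Uq (q : ℝ) : Type := RingQuot (Rel q)

/-- The class of a generator in `U_q`. -/
def gen (q : ℝ) (g : Gen) : Uq q := RingQuot.mkAlgHom ℂ (Rel q) (FreeAlgebra.ι ℂ g)

theorem gen_relations (q : ℝ) :
    Relations q (gen q .K) (gen q .Kinv) (gen q .E) (gen q .F) where
  k_mul_k' := by simpa [gen] using RingQuot.mkAlgHom_rel ℂ (Rel.k_mul_k' (q := q))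
  k'_mul_k := by simpa [gen] using RingQuot.mkAlgHom_rel ℂ (Rel.k'_mul_k (q := q))
  k_mul_e := by
    have h := RingQuot.mkAlgHom_rel ℂ (Rel.k_mul_e (q := q))
    simp only [map_mul, map_smul] at h
    exact h
  k_mul_f := by
    have h := RingQuot.mkAlgHom_rel ℂ (Rel.k_mul_f (q := q))
    simp only [map_mul, map_smul] at h
    exact h
  e_mul_f := by
    have h := RingQuot.mkAlgHom_rel ℂ (Rel.e_mul_f (q := q))
    simp only [map_mul, map_smul, map_sub] at h
    exact h

/-- Images of the generators. -/
def genImage {A : Type*} (k k' e f : A) : Gen → A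
  | .K => k
  | .Kinv => k'
  | .E => e
  | .F => f

/-- The algebra homomorphism out of `U_q` determined by elements satisfying the relations. -/
def Uq.lift {q : ℝ} {A : Type*} [Ring A] [Algebra ℂ A] {k k' e f : A}
    (h : Relations q k k' e f) : Uq q →ₐ[ℂ] A :=
  RingQuot.liftAlgHom ℂ ⟨FreeAlgebra.lift ℂ (genImage k k' e f), by
    intro x y hxy
    cases hxy
    · simpa [genImage] using h.k_mul_k'
    · simpa [genImage] using h.k'_mul_k
    · simpa only [map_mul, map_smul, FreeAlgebra.lift_ι_apply, genImage] using h.k_mul_e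
    · simpa only [map_mul, map_smul, FreeAlgebra.lift_ι_apply, genImage] using h.k_mul_f
    · simpa only [map_mul, map_smul, map_sub, FreeAlgebra.lift_ι_apply, genImage]
        using h.e_mul_f⟩

theorem Uq.lift_gen {q : ℝ} {A : Type*} [Ring A] [Algebra ℂ A] {k k' e f : A}
    (h : Relations q k k' e f) (g : Gen) : Uq.lift h (gen q g) = genImage k k' e f g := by
  simp [Uq.lift, gen]

/-- The Casimir element `Ω = (q⁻¹K² + qK⁻² - 2)/(q⁻¹ - q)² + EF`. -/
def casimir (q : ℝ) : Uq q :=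
  ((((q⁻¹ - q) ^ 2)⁻¹ : ℝ) : ℂ) •
      (((q⁻¹ : ℝ) : ℂ) • gen q .K ^ 2 + (q : ℂ) • gen q .Kinv ^ 2 - 2) +
    gen q .E * gen q .F

theorem comul_relations {q : ℝ} (hq : q ≠ 0) :
    Relations q (A := Uq q ⊗[ℂ] Uq q)
      (gen q .K ⊗ₜ gen q .K) (gen q .Kinv ⊗ₜ gen q .Kinv)
      (gen q .K ⊗ₜ gen q .E + gen q .E ⊗ₜ gen q .Kinv)
      (gen q .K ⊗ₜ gen q .F + gen q .F ⊗ₜ gen q .Kinv) := by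
  have h := gen_relations q
  generalize gen q .K = k at h ⊢
  generalize gen q .Kinv = k' at h ⊢
  generalize gen q .E = e at h ⊢
  generalize gen q .F = f at h ⊢
  obtain ⟨h1, h2, h3, h4, h5⟩ := h
  have hqc : (q : ℂ) ≠ 0 := by exact_mod_cast hq
  have h3' : e * k' = (q : ℂ) • (k' * e) := by
    calc e * k' = k' * (k * e) * k' := by rw [← mul_assoc, h2, one_mul]
      _ = (q : ℂ) • (k' * e) := by
        rw [h3, mul_smul_comm, smul_mul_assoc, mul_assoc k', mul_assoc e, h1, mul_one]
  have h4' : f * k' = ((q⁻¹ : ℝ) : ℂ) • (k' * f) := by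
    calc f * k' = k' * (k * f) * k' := by rw [← mul_assoc, h2, one_mul]
      _ = ((q⁻¹ : ℝ) : ℂ) • (k' * f) := by
        rw [h4, mul_smul_comm, smul_mul_assoc, mul_assoc k', mul_assoc f, h1, mul_one]
  refine ⟨?_, ?_, ?_, ?_, ?_⟩
  · rw [Algebra.TensorProduct.tmul_mul_tmul, h1, Algebra.TensorProduct.one_def]
  · rw [Algebra.TensorProduct.tmul_mul_tmul, h2, Algebra.TensorProduct.one_def]
  · simp only [mul_add, add_mul, Algebra.TensorProduct.tmul_mul_tmul, h3, h1, h2,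
      TensorProduct.tmul_smul, TensorProduct.smul_tmul', smul_add]
  · simp only [mul_add, add_mul, Algebra.TensorProduct.tmul_mul_tmul, h4, h1, h2,
      TensorProduct.tmul_smul, TensorProduct.smul_tmul', smul_add]
  · have h5' : e * f = f * e + (((q - q⁻¹)⁻¹ : ℝ) : ℂ) • (k * k - k' * k') := by
      rw [← h5]; abel
    simp only [mul_add, add_mul, Algebra.TensorProduct.tmul_mul_tmul, h4, h3, h3', h4', h5',
      TensorProduct.tmul_smul, ← TensorProduct.smul_tmul', TensorProduct.tmul_add,
      TensorProduct.add_tmul, TensorProduct.tmul_sub, TensorProduct.sub_tmul, smul_smul]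
    have e1 : (q : ℂ) * ((q⁻¹ : ℝ) : ℂ) = 1 := by push_cast; exact mul_inv_cancel₀ hqc
    have e2 : ((q⁻¹ : ℝ) : ℂ) * (q : ℂ) = 1 := by rw [mul_comm]; exact e1
    simp only [e1, e2, one_smul, smul_sub]
    abel

/-- The comultiplication `Δ : U_q → U_q ⊗ U_q`, with `Δ(K^{±1}) = K^{±1} ⊗ K^{±1}`,
`Δ(E) = K ⊗ E + E ⊗ K⁻¹` and `Δ(F) = K ⊗ F + F ⊗ K⁻¹`. -/
def comul {q : ℝ} (hq : q ≠ 0) : Uq q →ₐ[ℂ] Uq q ⊗[ℂ] Uq q := Uq.lift (comul_relations hq)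

/-! ### Representations on finite linear combinations of basis vectors -/

/-- The linear map with `e_n ↦ c n • e_{s n}` on finite linear combinations of the basis `e`. -/
def wmap {ι : Type*} (s : ι → ι) (c : ι → ℝ) : Module.End ℂ (ι →₀ ℂ) :=
  Finsupp.linearCombination ℂ fun n => Finsupp.single (s n) (c n : ℂ)

theorem wmap_single {ι : Type*} (s : ι → ι) (c : ι → ℝ) (n : ι) :
    wmap s c (Finsupp.single n 1) = Finsupp.single (s n) (c n : ℂ) := by
  simp [wmap]

theorem wmap_ext {ι : Type*} {s t : ι → ι} {c d : ι → ℝ} (h : ∀ n, c n = d n)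
    (h' : ∀ n, c n ≠ 0 → s n = t n) : wmap s c = wmap t d := by
  refine Finsupp.lhom_ext' fun n => LinearMap.ext_ring ?_
  simp only [LinearMap.comp_apply, Finsupp.lsingle_apply, wmap_single, h n]
  by_cases hc : c n = 0
  · rw [h n] at hc; simp [hc]
  · rw [h' n hc]

theorem wmap_mul {ι : Type*} (s t : ι → ι) (c d : ι → ℝ) :
    wmap s c * wmap t d = wmap (fun n => s (t n)) (fun n => d n * c (t n)) := by
  refine Finsupp.lhom_ext' fun n => LinearMap.ext_ring ?_
  simp [wmap]

theorem wmap_smul {ι : Type*} (s : ι → ι) (a : ℝ) (c : ι → ℝ) :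
    (a : ℂ) • wmap s c = wmap s (fun n => a * c n) := by
  refine Finsupp.lhom_ext' fun n => LinearMap.ext_ring ?_
  simp [wmap_single]

theorem wmap_sub {ι : Type*} (s : ι → ι) (c d : ι → ℝ) :
    wmap s c - wmap s d = wmap s (fun n => c n - d n) := by
  refine Finsupp.lhom_ext' fun n => LinearMap.ext_ring ?_
  simp [wmap_single]

theorem wmap_id {ι : Type*} : wmap (fun n : ι => n) (fun _ => 1) = 1 := by
  refine Finsupp.lhom_ext' fun n => LinearMap.ext_ring ?_
  simp [wmap_single]

theorem neg_eq_smul {A : Type*} [Ring A] [Algebra ℂ A] {x y z : A} {c : ℂ}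
    (h : x = c • (y - z)) : -x = c • (z - y) := by
  rw [h, ← smul_neg, neg_sub]

theorem ladder_relations {ι : Type*} {q ω : ℝ} (hq : 0 < q) (hq1 : q < 1) {s t : ι → ι}
    {w u d : ι → ℝ} (hw : ∀ n, w n ≠ 0) (hs : ∀ n, w (s n) = q * w n)
    (ht : ∀ n, d n ≠ 0 → s (t n) = n) (hts : ∀ n, t (s n) = n)
    (hdu : ∀ n, d n * u (t n) =
      -((q⁻¹ - q) ^ 2)⁻¹ * (q⁻¹ * w n ^ 2 + q * (w n ^ 2)⁻¹ - ω))
    (hud : ∀ n, u n * d (s n) =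
      -((q⁻¹ - q) ^ 2)⁻¹ * (q * w n ^ 2 + q⁻¹ * (w n ^ 2)⁻¹ - ω)) :
    Relations q (wmap (fun n => n) w) (wmap (fun n => n) fun n => (w n)⁻¹)
        (wmap s u) (wmap t d) ∧
      Relations q (wmap (fun n => n) fun n => (w n)⁻¹) (wmap (fun n => n) w)
        (wmap t d) (wmap s u) := by
  have hq0 : q ≠ 0 := hq.ne'
  have htw : ∀ n, d n ≠ 0 → w (t n) = q⁻¹ * w n := by
    intro n hn
    have := hs (t n)
    rw [ht n hn] at this
    rw [this]; field_simp
  have hne : q⁻¹ - q ≠ 0 := by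
    have : 1 < q⁻¹ := (one_lt_inv₀ hq).2 hq1
    linarith
  have hne' : q - q⁻¹ ≠ 0 := by intro h; apply hne; linarith
  have hef : wmap s u * wmap t d - wmap t d * wmap s u =
      (((q - q⁻¹)⁻¹ : ℝ) : ℂ) • (wmap (fun n => n) w * wmap (fun n => n) w -
        wmap (fun n => n) (fun n => (w n)⁻¹) * wmap (fun n => n) (fun n => (w n)⁻¹)) := by
    have e1 : wmap s u * wmap t d = wmap (fun n => n) (fun n => d n * u (t n)) := by
      rw [wmap_mul]
      exact wmap_ext (fun _ => rfl) fun n hn => ht n (left_ne_zero_of_mul hn)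
    have e2 : wmap t d * wmap s u = wmap (fun n => n) (fun n => u n * d (s n)) := by
      rw [wmap_mul]
      exact wmap_ext (fun _ => rfl) fun n _ => hts n
    rw [e1, e2, wmap_mul, wmap_mul, wmap_sub, wmap_sub, wmap_smul]
    refine wmap_ext (fun n => ?_) fun _ _ => rfl
    rw [hdu, hud]
    have e3 : (q - q⁻¹)⁻¹ = ((q⁻¹ - q) ^ 2)⁻¹ * (q - q⁻¹) := by
      rw [show (q⁻¹ - q) ^ 2 = (q - q⁻¹) ^ 2 by ring]; field_simp
    rw [e3]
    ring
  have hkk : wmap (fun n : ι => n) w * wmap (fun n => n) (fun n => (w n)⁻¹) = 1 := by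
    rw [wmap_mul, ← wmap_id]
    exact wmap_ext (fun n => by simp [hw n]) fun _ _ => rfl
  have hkk' : wmap (fun n : ι => n) (fun n => (w n)⁻¹) * wmap (fun n => n) w = 1 := by
    rw [wmap_mul, ← wmap_id]
    exact wmap_ext (fun n => by simp [hw n]) fun _ _ => rfl
  refine ⟨⟨hkk, hkk', ?_, ?_, hef⟩, ⟨hkk', hkk, ?_, ?_, ?_⟩⟩
  · rw [wmap_mul, wmap_mul, wmap_smul]
    exact wmap_ext (fun n => by rw [hs]; ring) fun _ _ => rfl
  · rw [wmap_mul, wmap_mul, wmap_smul]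
    refine wmap_ext (fun n => ?_) fun _ _ => rfl
    by_cases hn : d n = 0
    · simp [hn]
    · rw [htw n hn]; ring
  · rw [wmap_mul, wmap_mul, wmap_smul]
    refine wmap_ext (fun n => ?_) fun _ _ => rfl
    by_cases hn : d n = 0
    · simp [hn]
    · rw [htw n hn, mul_inv, inv_inv]; ring
  · rw [wmap_mul, wmap_mul, wmap_smul]
    exact wmap_ext (fun n => by rw [hs, mul_inv]; ring) fun _ _ => rfl
  · rw [← neg_sub (wmap s u * wmap t d)]
    exact neg_eq_smul (A := Module.End ℂ (ι →₀ ℂ)) hef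

/-! #### Discrete series -/

/-- `q^{k+n}`. -/
def discWeight (q k : ℝ) (n : ℕ) : ℝ := q ^ (k + n)

/-- `(q⁻¹ - q)⁻¹ q^{-1/2-k-n} √((1 - q^{2n+2})(1 - q^{4k+2n}))`. -/
def discUp (q k : ℝ) (n : ℕ) : ℝ :=
  (q⁻¹ - q)⁻¹ * (q ^ (-(1 / 2) - k - n) *
    √((1 - q ^ (2 * n + 2 : ℝ)) * (1 - q ^ (4 * k + 2 * n))))

/-- `-(q⁻¹ - q)⁻¹ q^{1/2-k-n} √((1 - q^{2n})(1 - q^{4k+2n-2}))`; this vanishes for `n = 0`. -/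
def discDown (q k : ℝ) (n : ℕ) : ℝ :=
  -((q⁻¹ - q)⁻¹ * (q ^ (1 / 2 - k - n) *
    √((1 - q ^ (2 * n : ℝ)) * (1 - q ^ (4 * k + 2 * n - 2)))))

theorem disc_up_down {q k : ℝ} (hq : 0 < q) (hq1 : q < 1) (hk : 0 < k) (n : ℕ) :
    discUp q k n * discDown q k (n + 1) = -((q⁻¹ - q) ^ 2)⁻¹ *
      (q * discWeight q k n ^ 2 + q⁻¹ * (discWeight q k n ^ 2)⁻¹ -
        (q ^ (2 * k - 1) + q ^ (1 - 2 * k))) := by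
  have hx : 0 < q ^ k := Real.rpow_pos_of_pos hq k
  have hy : 0 < q ^ (n : ℝ) := Real.rpow_pos_of_pos hq _
  have hr : 0 ≤ (1 - q ^ (2 * n + 2 : ℝ)) * (1 - q ^ (4 * k + 2 * n)) := by
    refine mul_nonneg ?_ ?_ <;>
    · rw [sub_nonneg]
      exact Real.rpow_le_one hq.le hq1.le (by positivity)
  have hw : discWeight q k n = q ^ k * q ^ (n : ℝ) := Real.rpow_add hq _ _
  have e1 : q ^ (-(1 / 2) - k - n) * q ^ (1 / 2 - k - ((n + 1 : ℕ) : ℝ)) =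
      (q * (q ^ k) ^ 2 * (q ^ (n : ℝ)) ^ 2)⁻¹ := by
    rw [← Real.rpow_add hq, ← Real.rpow_two, ← Real.rpow_two, ← Real.rpow_mul hq.le,
      ← Real.rpow_mul hq.le]
    nth_rewrite 2 [← Real.rpow_one q]
    rw [← Real.rpow_add hq, ← Real.rpow_add hq, ← Real.rpow_neg hq.le]
    congr 1; push_cast; ring
  have e2 : q ^ (2 * n + 2 : ℝ) = (q ^ (n : ℝ)) ^ 2 * q ^ 2 := by
    rw [Real.rpow_add hq, mul_comm 2 (n : ℝ), Real.rpow_mul hq.le, Real.rpow_two, Real.rpow_two]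
  have e3 : q ^ (4 * k + 2 * n) = (q ^ k) ^ 4 * (q ^ (n : ℝ)) ^ 2 := by
    rw [Real.rpow_add hq, mul_comm 2 (n : ℝ), Real.rpow_mul hq.le (n : ℝ), Real.rpow_two,
      mul_comm 4 k, Real.rpow_mul hq.le k]
    norm_cast
  have e4 : q ^ (2 * k - 1) = (q ^ k) ^ 2 * q⁻¹ := by
    rw [Real.rpow_sub hq, mul_comm 2 k, Real.rpow_mul hq.le, Real.rpow_two, Real.rpow_one]; rfl
  have e5 : q ^ (1 - 2 * k) = q * ((q ^ k) ^ 2)⁻¹ := by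
    rw [Real.rpow_sub hq, mul_comm 2 k, Real.rpow_mul hq.le, Real.rpow_two, Real.rpow_one]; rfl
  have e6 : discDown q k (n + 1) = -((q⁻¹ - q)⁻¹ * (q ^ (1 / 2 - k - ((n + 1 : ℕ) : ℝ)) *
      √((1 - q ^ (2 * n + 2 : ℝ)) * (1 - q ^ (4 * k + 2 * n))))) := by
    unfold discDown
    congr 6 <;> push_cast <;> ring_nf
  rw [e6, discUp]
  calc _ = -((q⁻¹ - q) ^ 2)⁻¹ *
        ((q ^ (-(1 / 2) - k - n) * q ^ (1 / 2 - k - ((n + 1 : ℕ) : ℝ))) *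
        (√((1 - q ^ (2 * n + 2 : ℝ)) * (1 - q ^ (4 * k + 2 * n))) *
        √((1 - q ^ (2 * n + 2 : ℝ)) * (1 - q ^ (4 * k + 2 * n))))) := by
        rw [← inv_pow]; ring
    _ = _ := by
      rw [Real.mul_self_sqrt hr, e1, e2, e3, e4, e5, hw]
      congr 1
      field_simp
      ring

theorem disc_relations {q k : ℝ} (hq : 0 < q) (hq1 : q < 1) (hk : 0 < k) :
    Relations q (wmap (fun n => n) (discWeight q k))
        (wmap (fun n => n) fun n => (discWeight q k n)⁻¹)
        (wmap (fun n => n + 1) (discUp q k)) (wmap (fun n => n - 1) (discDown q k)) ∧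
      Relations q (wmap (fun n => n) fun n => (discWeight q k n)⁻¹)
        (wmap (fun n => n) (discWeight q k))
        (wmap (fun n => n - 1) (discDown q k)) (wmap (fun n => n + 1) (discUp q k)) := by
  have hd0 : discDown q k 0 = 0 := by simp [discDown]
  have hw : ∀ n, discWeight q k n ≠ 0 := fun n => (Real.rpow_pos_of_pos hq _).ne'
  have hs : ∀ n, discWeight q k (n + 1) = q * discWeight q k n := by
    intro n
    rw [discWeight, discWeight, mul_comm, ← Real.rpow_add_one hq.ne']
    congr 1; push_cast; ring
  refine ladder_relations hq hq1 (ω := q ^ (2 * k - 1) + q ^ (1 - 2 * k)) hw hs ?_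
    (fun n => by simp) ?_ (disc_up_down hq hq1 hk)
  · rintro (_ | n) hn
    · exact absurd hd0 hn
    · simp
  · rintro (_ | n)
    · have e4 : q ^ (2 * k - 1) = (q ^ k) ^ 2 * q⁻¹ := by
        rw [Real.rpow_sub hq, mul_comm 2 k, Real.rpow_mul hq.le, Real.rpow_two,
          Real.rpow_one]; rfl
      have e5 : q ^ (1 - 2 * k) = q * ((q ^ k) ^ 2)⁻¹ := by
        rw [Real.rpow_sub hq, mul_comm 2 k, Real.rpow_mul hq.le, Real.rpow_two,
          Real.rpow_one]; rfl
      have e6 : discWeight q k 0 = q ^ k := by simp [discWeight]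
      rw [hd0, e4, e5, e6]; ring
    · have hq0 := hq.ne'
      have := hw n
      rw [mul_comm, Nat.add_sub_cancel, disc_up_down hq hq1 hk n, hs]
      congr 1
      field_simp

/-- The positive discrete series `π⁺_k`, `k > 0`. -/
def posRep {q k : ℝ} (hq : 0 < q) (hq1 : q < 1) (hk : 0 < k) :
    Uq q →ₐ[ℂ] Module.End ℂ (ℕ →₀ ℂ) :=
  Uq.lift (disc_relations hq hq1 hk).1

/-- The negative discrete series `π⁻_k`, `k > 0`: `K` acts by `q^{-(k+n)}`, `E` lowers and
`F` raises the index. -/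
def negRep {q k : ℝ} (hq : 0 < q) (hq1 : q < 1) (hk : 0 < k) :
    Uq q →ₐ[ℂ] Module.End ℂ (ℕ →₀ ℂ) :=
  Uq.lift (disc_relations hq hq1 hk).2

/-! #### Strange series -/

/-- `q^{n+ε}`. -/
def strangeWeight (q ε : ℝ) (n : ℤ) : ℝ := q ^ (n + ε)

/-- `(q⁻¹ - q)⁻¹ q^{-1/2-n-ε} √((1 + q^{2n+2ε+2σ+1})(1 + q^{2n+2ε-2σ+1}))`. -/
def strangeUp (q σ ε : ℝ) (n : ℤ) : ℝ :=
  (q⁻¹ - q)⁻¹ * (q ^ (-(1 / 2) - n - ε) *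
    √((1 + q ^ (2 * n + 2 * ε + 2 * σ + 1)) * (1 + q ^ (2 * n + 2 * ε - 2 * σ + 1))))

/-- `-(q⁻¹ - q)⁻¹ q^{1/2-n-ε} √((1 + q^{2n+2ε+2σ-1})(1 + q^{2n+2ε-2σ-1}))`. -/
def strangeDown (q σ ε : ℝ) (n : ℤ) : ℝ :=
  -((q⁻¹ - q)⁻¹ * (q ^ (1 / 2 - n - ε) *
    √((1 + q ^ (2 * n + 2 * ε + 2 * σ - 1)) * (1 + q ^ (2 * n + 2 * ε - 2 * σ - 1)))))

theorem strange_up_down {q : ℝ} (hq : 0 < q) (σ ε : ℝ) (n : ℤ) :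
    strangeUp q σ ε n * strangeDown q σ ε (n + 1) = -((q⁻¹ - q) ^ 2)⁻¹ *
      (q * strangeWeight q ε n ^ 2 + q⁻¹ * (strangeWeight q ε n ^ 2)⁻¹ -
        -(q ^ (2 * σ) + q ^ (-(2 * σ)))) := by
  have hw : 0 < strangeWeight q ε n := Real.rpow_pos_of_pos hq _
  have hx : 0 < q ^ (2 * σ) := Real.rpow_pos_of_pos hq _
  have hr : 0 ≤ (1 + q ^ (2 * n + 2 * ε + 2 * σ + 1)) *
      (1 + q ^ (2 * n + 2 * ε - 2 * σ + 1)) := by positivity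
  have hw2 : strangeWeight q ε n ^ 2 = q ^ (2 * n + 2 * ε) := by
    rw [strangeWeight, ← Real.rpow_two, ← Real.rpow_mul hq.le]; congr 1; ring
  have e1 : q ^ (-(1 / 2) - n - ε) * q ^ (1 / 2 - ((n + 1 : ℤ) : ℝ) - ε) =
      (q * strangeWeight q ε n ^ 2)⁻¹ := by
    rw [hw2, ← Real.rpow_add hq]
    nth_rewrite 2 [← Real.rpow_one q]
    rw [← Real.rpow_add hq, ← Real.rpow_neg hq.le]
    congr 1; push_cast; ring
  have e2 : q ^ (2 * n + 2 * ε + 2 * σ + 1) = strangeWeight q ε n ^ 2 * q ^ (2 * σ) * q := by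
    rw [hw2, Real.rpow_add hq, Real.rpow_add hq, Real.rpow_one]
  have e3 : q ^ (2 * n + 2 * ε - 2 * σ + 1) =
      strangeWeight q ε n ^ 2 * (q ^ (2 * σ))⁻¹ * q := by
    rw [hw2, Real.rpow_add hq, Real.rpow_sub hq, Real.rpow_one]; rfl
  have e4 : q ^ (-(2 * σ)) = (q ^ (2 * σ))⁻¹ := Real.rpow_neg hq.le _
  have e6 : strangeDown q σ ε (n + 1) =
      -((q⁻¹ - q)⁻¹ * (q ^ (1 / 2 - ((n + 1 : ℤ) : ℝ) - ε) *
      √((1 + q ^ (2 * n + 2 * ε + 2 * σ + 1)) * (1 + q ^ (2 * n + 2 * ε - 2 * σ + 1))))) := by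
    unfold strangeDown
    congr 6 <;> push_cast <;> ring_nf
  rw [e6, strangeUp]
  calc _ = -((q⁻¹ - q) ^ 2)⁻¹ *
        ((q ^ (-(1 / 2) - n - ε) * q ^ (1 / 2 - ((n + 1 : ℤ) : ℝ) - ε)) *
        (√((1 + q ^ (2 * n + 2 * ε + 2 * σ + 1)) * (1 + q ^ (2 * n + 2 * ε - 2 * σ + 1))) *
        √((1 + q ^ (2 * n + 2 * ε + 2 * σ + 1)) *
          (1 + q ^ (2 * n + 2 * ε - 2 * σ + 1))))) := by
        rw [← inv_pow]; ring
    _ = _ := by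
      rw [Real.mul_self_sqrt hr, e1, e2, e3, e4]
      congr 1
      field_simp
      ring

theorem strange_relations {q : ℝ} (hq : 0 < q) (hq1 : q < 1) (σ ε : ℝ) :
    Relations q (wmap (fun n => n) (strangeWeight q ε))
      (wmap (fun n => n) fun n => (strangeWeight q ε n)⁻¹)
      (wmap (fun n => n + 1) (strangeUp q σ ε)) (wmap (fun n => n - 1) (strangeDown q σ ε)) := by
  have hw : ∀ n, strangeWeight q ε n ≠ 0 := fun n => (Real.rpow_pos_of_pos hq _).ne'
  have hs : ∀ n, strangeWeight q ε (n + 1) = q * strangeWeight q ε n := by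
    intro n
    rw [strangeWeight, strangeWeight, mul_comm, ← Real.rpow_add_one hq.ne']
    congr 1; push_cast; ring
  refine (ladder_relations hq hq1 (ω := -(q ^ (2 * σ) + q ^ (-(2 * σ)))) hw hs
    (fun n _ => by simp) (fun n => by simp) ?_ (strange_up_down hq σ ε)).1
  intro n
  obtain ⟨m, rfl⟩ : ∃ m, n = m + 1 := ⟨n - 1, by ring⟩
  have hq0 := hq.ne'
  have := hw m
  rw [mul_comm, show m + 1 - 1 = m by ring, strange_up_down hq σ ε m, hs]
  congr 1
  field_simp

/-- The strange series `π^S_{σ,ε}`; the formulas make sense for all real `σ` and `ε`. -/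
def strangeRep {q : ℝ} (hq : 0 < q) (hq1 : q < 1) (σ ε : ℝ) :
    Uq q →ₐ[ℂ] Module.End ℂ (ℤ →₀ ℂ) :=
  Uq.lift (strange_relations hq hq1 σ ε)

/-! #### The representation `T'` -/

/-- `(π₁ ⊗ π₂) Δ` on the algebraic tensor product. -/
def tensorRep {q : ℝ} (hq : q ≠ 0) {V W : Type} [AddCommGroup V] [Module ℂ V]
    [AddCommGroup W] [Module ℂ W] (π₁ : Uq q →ₐ[ℂ] Module.End ℂ V)
    (π₂ : Uq q →ₐ[ℂ] Module.End ℂ W) : Uq q →ₐ[ℂ] Module.End ℂ (V ⊗[ℂ] W) :=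
  ((Module.endTensorEndAlgHom (R := ℂ) (S := ℂ) (A := ℂ) (M := V) (N := W)).comp
    (Algebra.TensorProduct.map π₁ π₂)).comp (comul hq)

/-- The common domain of the operators `T'(X)`: the finite linear combinations of the vectors
`e_i ⊗ e_j` of `ℓ²(ℕ) ⊗ ℓ²(ℤ) ⊕ ℓ²(ℤ) ⊗ ℓ²(ℕ)`. -/
abbrev Dom : Type := ((ℕ →₀ ℂ) ⊗[ℂ] (ℤ →₀ ℂ)) × ((ℤ →₀ ℂ) ⊗[ℂ] (ℕ →₀ ℂ))

/-- `T'_{k₁,k₂,ε} =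
((π⁻_{k₁} ⊗ π^S_{k₂-1/2, ε+k₂}) ⊕ (π^S_{k₁-1/2, -ε-k₁} ⊗ π⁺_{k₂})) Δ`. -/
def repT' {q k₁ k₂ : ℝ} (hq : 0 < q) (hq1 : q < 1) (hk₁ : 0 < k₁) (hk₂ : 0 < k₂) (ε : ℝ) :
    Uq q →ₐ[ℂ] Module.End ℂ Dom :=
  (LinearMap.prodMapAlgHom ℂ ((ℕ →₀ ℂ) ⊗[ℂ] (ℤ →₀ ℂ)) ((ℤ →₀ ℂ) ⊗[ℂ] (ℕ →₀ ℂ))).comp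
    ((tensorRep hq.ne' (negRep hq hq1 hk₁) (strangeRep hq hq1 (k₂ - 1 / 2) (ε + k₂))).prod
      (tensorRep hq.ne' (strangeRep hq hq1 (k₁ - 1 / 2) (-ε - k₁)) (posRep hq hq1 hk₂)))

/-! ### The Hilbert space and the subspaces `A_p` -/

/-- The space `ℓ²(ℕ)`. -/
abbrev L2N : Type := lp (fun _ : ℕ => ℂ) 2

/-- The Hilbert space `ℓ²(ℕ) ⊗ ℓ²(ℤ) ⊕ ℓ²(ℤ) ⊗ ℓ²(ℕ)`, realised as the `ℓ²`-space on the disjoint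
union of `ℕ × ℤ` and `ℤ × ℕ`; `e_i ⊗ e_j` is the standard basis vector with index `(i, j)`. -/
abbrev Hilb : Type := lp (fun _ : (ℕ × ℤ) ⊕ (ℤ × ℕ) => ℂ) 2

/-- The inclusion of the domain in the Hilbert space. -/
def toHilb : Dom →ₗ[ℂ] Hilb :=
  LinearMap.coprod
    (Finsupp.linearCombination ℂ (fun i : ℕ × ℤ => (lp.single 2 (Sum.inl i) (1 : ℂ) : Hilb)) ∘ₗ
      (finsuppTensorFinsupp' ℂ ℕ ℤ).toLinearMap)
    (Finsupp.linearCombination ℂ (fun i : ℤ × ℕ => (lp.single 2 (Sum.inr i) (1 : ℂ) : Hilb)) ∘ₗ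
      (finsuppTensorFinsupp' ℂ ℤ ℕ).toLinearMap)

/-- `f⁻_{p,n} = e_n ⊗ e_{n+p}` in the first summand. -/
def vecMinus (p : ℤ) (n : ℕ) : Dom :=
  (Finsupp.single n 1 ⊗ₜ[ℂ] Finsupp.single ((n : ℤ) + p) 1, 0)

/-- `f⁺_{p,n} = e_{2ε-n+p} ⊗ e_n` in the second summand; `l` stands for the integer `2ε`. -/
def vecPlus (l p : ℤ) (n : ℕ) : Dom :=
  (0, Finsupp.single (l - (n : ℤ) + p) 1 ⊗ₜ[ℂ] Finsupp.single n 1)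

/-- The subspace `A_p = span {f⁻_{p,n}} ⊕ span {f⁺_{p,n}}`. -/
def subA (l p : ℤ) : Submodule ℂ Dom :=
  Submodule.span ℂ (Set.range (vecMinus p)) ⊔ Submodule.span ℂ (Set.range (vecPlus l p))

/-- `f⁻_{p,n}` as an element of `A_p`. -/
def fMinus (l p : ℤ) (n : ℕ) : subA l p :=
  ⟨vecMinus p n, Submodule.mem_sup_left (Submodule.subset_span ⟨n, rfl⟩)⟩

/-- `f⁺_{p,n}` as an element of `A_p`. -/
def fPlus (l p : ℤ) (n : ℕ) : subA l p :=
  ⟨vecPlus l p n, Submodule.mem_sup_right (Submodule.subset_span ⟨n, rfl⟩)⟩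

/-- The closure of `A_p` in the Hilbert space. -/
abbrev closureA (l p : ℤ) : Submodule ℂ Hilb := ((subA l p).map toHilb).topologicalClosure

/-- The inclusion of `A_p` in its closure. -/
def inclA (l p : ℤ) : subA l p →ₗ[ℂ] closureA l p :=
  (toHilb ∘ₗ (subA l p).subtype).codRestrict (closureA l p) fun x =>
    Submodule.le_topologicalClosure _ (Submodule.mem_map_of_mem x.2)

/-! ### `q`-series and big `q`-Jacobi polynomials -/

/-- `(x; q)_n`. -/
def qPoch (x q : ℝ) (n : ℕ) : ℝ := ∏ k ∈ Finset.range n, (1 - x * q ^ k)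

/-- `(x; q)_∞`. -/
def qPochInf (x q : ℝ) : ℝ := ∏' k : ℕ, (1 - x * q ^ k)

/-- The normalized Jacobi theta function `θ(x; q) = (x; q)_∞ (q/x; q)_∞`. -/
def qTheta (x q : ℝ) : ℝ := qPochInf x q * qPochInf (q / x) q

/-- The basic hypergeometric series `₃φ₂(a, b, c; d, e; q, z)`. -/
def phi32 (a b c d e q z : ℝ) : ℝ :=
  ∑' k : ℕ, qPoch a q k * qPoch b q k * qPoch c q k /
    (qPoch q q k * qPoch d q k * qPoch e q k) * z ^ k

/-- The big `q`-Jacobi polynomial `P_m(x; a, b, c; q)`. -/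
def bigJacobi (m : ℕ) (x a b c q : ℝ) : ℝ :=
  phi32 ((q ^ m)⁻¹) (a * b * q ^ (m + 1)) x (a * q) (c * q) q q

/-- The weight `u(x; a, b, c; q)`. -/
def uWeight (x a b c q : ℝ) : ℝ :=
  qPochInf (x / a) q * qPochInf (x / c) q / (qPochInf x q * qPochInf (b * x / c) q)

/-- The quotient `(1 - abq^{2m+1}) (abq; q)_m / (1 - abq)`, with the common factor `1 - abq`
cancelled (so that it also makes sense for `abq = 1`); `s` stands for `ab`. -/
def vFactor (m : ℕ) (s q : ℝ) : ℝ :=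
  if m = 0 then 1 else (1 - s * q ^ (2 * m + 1)) * qPoch (s * q ^ 2) q (m - 1)

theorem vFactor_eq (m : ℕ) (s q : ℝ) (h : 1 - s * q ≠ 0) :
    vFactor m s q = (1 - s * q ^ (2 * m + 1)) * qPoch (s * q) q m / (1 - s * q) := by
  rcases m with _ | m
  · simp [vFactor, qPoch, h]
  · have : qPoch (s * q) q (m + 1) = (1 - s * q) * qPoch (s * q ^ 2) q m := by
      rw [qPoch, Finset.prod_range_succ', mul_comm, qPoch]
      simp only [pow_zero, mul_one]
      congr 1
      exact Finset.prod_congr rfl fun k _ => by ring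
    rw [this, vFactor]
    simp only [Nat.add_sub_cancel, Nat.succ_ne_zero, if_false]
    field_simp

/-- The weight `v(m; a, b, c; q)`. -/
def vWeight (m : ℕ) (a b c q : ℝ) : ℝ :=
  vFactor m (a * b) q / (a * q) *
    (qPochInf (a * q) q * qPochInf (b * q) q * qPochInf (c * q) q * qPochInf (a * b * q / c) q /
      (qPochInf q q * qPochInf (a * b * q ^ 2) q * qTheta (c / a) q)) *
    (qPoch (a * q) q m * qPoch (c * q) q m /
      (qPoch q q m * qPoch (b * q) q m * qPoch (a * b * q / c) q m)) *
    ((-(a * c * q ^ 2)) ^ m)⁻¹ * q ^ (-(1 / 2 : ℝ) * m * (m - 1))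

/-- `r_x(m; a, b, c; q) = √(|x| u(x; a, b, c; q) v(m; a, b, c; q)) P_m(x; a, b, c; q)`. -/
def rFun (x : ℝ) (m : ℕ) (a b c q : ℝ) : ℝ :=
  √(|x| * uWeight x a b c q * vWeight m a b c q) * bigJacobi m x a b c q

end QSU

end

/-! The Casimir element acts on `A_p` by two Jacobi matrices, one on the `f⁻` and one on the `f⁺`,
and the functions `r_x(m)` diagonalise both at once. The index set of the `f^∓_{p,n}` is identified
with the lattice `{aq^{n+1}} ∪ {cq^{n+1}}`, `c < 0 < a` (base `q²` in the application), positive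
points for `f⁻` and negative points for `f⁺`.

Unitarity. The big `q`-Jacobi polynomials `P_m` are orthogonal for the masses `|x| u(x)` on the
lattice, and `v(m)` is the reciprocal of the squared norm of `P_m`. The Andrews–Askey integral
`jackson_askeyWeight` evaluates the integral of `(x;q)_k ((b/c)x;q)_j`; pairing `P_m` with
`((b/c)x;q)_j` then becomes a `q`-Chu–Vandermonde sum (`vandermondeSum_eq`), which vanishes for `j <
m` and gives the norm for `j = m` (`jacobiInt_self_mul_vWeight`). For completeness
(`eq_zero_of_inner_colVec`), a vector orthogonal to all columns yields summable masses on a bounded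
set with vanishing moments; by Weierstrass approximation they have no mass at isolated points, and
every lattice point is isolated. So the columns `x ↦ ± r_x(m)` form a Hilbert basis, the matrix is
unitary, and its rows are the prescribed images of the `f^∓_{p,n}`.

Eigenvalues. `P_m` solves a second-order `q`-difference equation in `x` (`jacobiPoly_difference`).
The masses satisfy detailed balance (`latticeWt_balance`), so multiplication by their square roots
makes this equation symmetric. Its coefficients agree, up to a scale and an additive constant, with
the matrix elements of the Casimir element (`minusOff_sq`, `minusDiag_eq`, `plusOff_sq`,
`plusDiag_eq`). The coefficient towards `x/q` vanishes at `aq` and `cq`, just as lowering kills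
`e_0` in the discrete series. The off-diagonal elements on the `f⁺` are negative, whence the sign
`(-1)^n`. -/

noncomputable section

open scoped Topology
open Filter Polynomial

namespace QSU

/-! ### Infinite `q`-shifted factorials -/

section QPoch

variable {q : ℝ}

theorem multipliable_qPoch (hq : 0 < q) (hq1 : q < 1) (x : ℝ) :
    Multipliable fun k : ℕ => 1 - x * q ^ k := by
  simp only [sub_eq_add_neg]
  refine multipliable_one_add_of_summable ?_
  simp only [norm_neg, norm_mul, norm_pow, Real.norm_of_nonneg hq.le]
  exact (summable_geometric_of_lt_one hq.le hq1).mul_left _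

theorem qPoch_zero (x q : ℝ) : qPoch x q 0 = 1 := by simp [qPoch]

theorem qPoch_succ (x q : ℝ) (n : ℕ) : qPoch x q (n + 1) = qPoch x q n * (1 - x * q ^ n) := by
  rw [qPoch, Finset.prod_range_succ, qPoch]

theorem qPoch_succ' (x q : ℝ) (n : ℕ) : qPoch x q (n + 1) = (1 - x) * qPoch (x * q) q n := by
  rw [qPoch, Finset.prod_range_succ', mul_comm, qPoch]
  simp only [pow_zero, mul_one]
  congr 1
  exact Finset.prod_congr rfl fun k _ => by ring

theorem one_sub_mul_pow_pos (hq : 0 < q) (hq1 : q < 1) {x : ℝ} (hx : x < 1) (k : ℕ) :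
    0 < 1 - x * q ^ k := by
  have h1 : q ^ k ≤ 1 := pow_le_one₀ hq.le hq1.le
  have h0 : 0 < q ^ k := pow_pos hq k
  nlinarith

theorem qPoch_pos (hq : 0 < q) (hq1 : q < 1) {x : ℝ} (hx : x < 1) (n : ℕ) : 0 < qPoch x q n :=
  Finset.prod_pos fun k _ => one_sub_mul_pow_pos hq hq1 hx k

theorem qPochInf_eq_mul (hq : 0 < q) (hq1 : q < 1) (x : ℝ) (n : ℕ) :
    qPochInf x q = qPoch x q n * qPochInf (x * q ^ n) q := by
  have h := multipliable_qPoch hq hq1 (x * q ^ n)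
  rw [qPochInf, qPoch, qPochInf]
  have h' : (fun k : ℕ => 1 - x * q ^ n * q ^ k) = fun k : ℕ => 1 - x * q ^ (k + n) := by
    ext k; ring
  rw [h'] at h ⊢
  exact (h.prod_mul_tprod_nat_mul' (f := fun k => 1 - x * q ^ k)).symm

theorem qPochInf_eq (hq : 0 < q) (hq1 : q < 1) (x : ℝ) :
    qPochInf x q = (1 - x) * qPochInf (x * q) q := by
  simpa [qPoch] using qPochInf_eq_mul hq hq1 x 1

theorem qPochInf_zero (q : ℝ) : qPochInf 0 q = 1 := by simp [qPochInf]

theorem qPochInf_ne_zero (hq : 0 < q) (hq1 : q < 1) {x : ℝ} (hx : x < 1) :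
    qPochInf x q ≠ 0 := by
  have h : ∏' k : ℕ, (1 + -(x * q ^ k)) ≠ 0 := by
    refine tprod_one_add_ne_zero_of_summable (fun k => ?_) ?_
    · rw [← sub_eq_add_neg]
      exact (one_sub_mul_pow_pos hq hq1 hx k).ne'
    · simp only [norm_neg, norm_mul, norm_pow, Real.norm_of_nonneg hq.le]
      exact (summable_geometric_of_lt_one hq.le hq1).mul_left _
  simpa only [← sub_eq_add_neg, qPochInf] using h

theorem tendsto_qPoch (hq : 0 < q) (hq1 : q < 1) (x : ℝ) :
    Tendsto (qPoch x q) atTop (𝓝 (qPochInf x q)) :=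
  (multipliable_qPoch hq hq1 x).tendsto_prod_tprod_nat

theorem qPochInf_pos (hq : 0 < q) (hq1 : q < 1) {x : ℝ} (hx : x < 1) : 0 < qPochInf x q :=
  lt_of_le_of_ne (ge_of_tendsto' (tendsto_qPoch hq hq1 x) fun n => (qPoch_pos hq hq1 hx n).le)
    (qPochInf_ne_zero hq hq1 hx).symm

/-- Used both to control Jackson sums at `0`, where the lattice accumulates, and to bound
reciprocals on compact intervals. The product converges uniformly near each point, the factors being
dominated by a geometric series. -/
theorem continuous_qPochInf (hq : 0 < q) (hq1 : q < 1) : Continuous fun x => qPochInf x q := by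
  rw [continuous_iff_continuousAt]
  intro x
  have h := tendsto_tprod_one_add_of_dominated_convergence (𝓕 := 𝓝 x)
    (f := fun y (k : ℕ) => -(y * q ^ k)) (g := fun k => -(x * q ^ k))
    (bound := fun k => (|x| + 1) * q ^ k)
    ((summable_geometric_of_lt_one hq.le hq1).mul_left _)
    (fun k => (Continuous.tendsto (by fun_prop) x)) ?_
  · simpa only [← sub_eq_add_neg, qPochInf, ContinuousAt] using h
  · have hev : ∀ᶠ y in 𝓝 x, |y| < |x| + 1 :=
      (continuous_abs.tendsto x).eventually_lt_const (by linarith)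
    filter_upwards [hev] with y hy k
    rw [norm_neg, norm_mul, norm_pow, Real.norm_of_nonneg hq.le, Real.norm_eq_abs]
    exact mul_le_mul_of_nonneg_right hy.le (pow_pos hq k).le

/-! ### The Jackson integral from `cq` to `aq` -/

/-- The Jackson integral `∫_{cq}^{aq} h(x) d_q x`, divided by `1 - q`. -/
def jackson (a c q : ℝ) (h : ℝ → ℝ) : ℝ :=
  ∑' n : ℕ, (a * q ^ (n + 1) * h (a * q ^ (n + 1)) - c * q ^ (n + 1) * h (c * q ^ (n + 1)))

theorem tendsto_mul_pow_succ (hq : 0 < q) (hq1 : q < 1) (s : ℝ) :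
    Tendsto (fun n : ℕ => s * q ^ (n + 1)) atTop (𝓝 0) := by
  have h := ((tendsto_pow_atTop_nhds_zero_of_lt_one hq.le hq1).comp (tendsto_add_atTop_nat 1)).const_mul s
  simpa using h

/-- Continuity at the single point `0` suffices: the lattice tends to `0`, so `h` is bounded along
its tail and the factor `q^(n+1)` gives a geometric majorant. -/
theorem summable_jackson_side (hq : 0 < q) (hq1 : q < 1) {h : ℝ → ℝ} (hh : ContinuousAt h 0)
    (s : ℝ) : Summable fun n : ℕ => s * q ^ (n + 1) * h (s * q ^ (n + 1)) := by
  have ht : Tendsto (fun n : ℕ => h (s * q ^ (n + 1))) atTop (𝓝 (h 0)) :=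
    hh.tendsto.comp (tendsto_mul_pow_succ hq hq1 s)
  have hs : Summable fun n : ℕ => s * q ^ (n + 1) := by
    have := ((summable_geometric_of_lt_one hq.le hq1).mul_left (s * q))
    exact this.congr fun n => by ring
  refine summable_of_isBigO_nat hs.norm ?_
  have h1 : (fun n : ℕ => h (s * q ^ (n + 1))) =O[atTop] fun _ => (1 : ℝ) := ht.isBigO_one ℝ
  simpa using ((Asymptotics.isBigO_refl (fun n : ℕ => s * q ^ (n + 1)) atTop).norm_right).mul h1

theorem summable_jackson (hq : 0 < q) (hq1 : q < 1) {h : ℝ → ℝ} (hh : ContinuousAt h 0)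
    (a c : ℝ) : Summable fun n : ℕ =>
      a * q ^ (n + 1) * h (a * q ^ (n + 1)) - c * q ^ (n + 1) * h (c * q ^ (n + 1)) :=
  (summable_jackson_side hq hq1 hh a).sub (summable_jackson_side hq hq1 hh c)

theorem jackson_congr {a c : ℝ} {h g : ℝ → ℝ}
    (hg : ∀ n : ℕ, h (a * q ^ (n + 1)) = g (a * q ^ (n + 1)) ∧
      h (c * q ^ (n + 1)) = g (c * q ^ (n + 1))) :
    jackson a c q h = jackson a c q g :=
  tsum_congr fun n => by rw [(hg n).1, (hg n).2]

theorem jackson_add_mul (hq : 0 < q) (hq1 : q < 1) {h g : ℝ → ℝ} (hh : ContinuousAt h 0)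
    (hg : ContinuousAt g 0) (a c r s : ℝ) :
    jackson a c q (fun x => r * h x + s * g x) =
      r * jackson a c q h + s * jackson a c q g := by
  rw [jackson, jackson, jackson, ← tsum_mul_left, ← tsum_mul_left,
    ← ((summable_jackson hq hq1 hh a c).mul_left r).tsum_add
      ((summable_jackson hq hq1 hg a c).mul_left s)]
  exact tsum_congr fun n => by ring

theorem jackson_const_mul (a c r : ℝ) (h : ℝ → ℝ) :
    jackson a c q (fun x => r * h x) = r * jackson a c q h := by
  rw [jackson, jackson, ← tsum_mul_left]
  exact tsum_congr fun n => by ring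

/-- A Jackson integral of a `q`-derivative telescopes. -/
theorem tsum_sub_shift (hq : 0 < q) (hq1 : q < 1) {G : ℝ → ℝ} (hG : ContinuousAt G 0) (s : ℝ)
    (hs : Summable fun n : ℕ => G (s * q ^ (n + 1)) - G (s * q ^ (n + 2))) :
    ∑' n : ℕ, (G (s * q ^ (n + 1)) - G (s * q ^ (n + 2))) = G (s * q) - G 0 := by
  refine tendsto_nhds_unique hs.hasSum.tendsto_sum_nat ?_
  have h : (fun n : ℕ => ∑ i ∈ Finset.range n, (G (s * q ^ (i + 1)) - G (s * q ^ (i + 2)))) =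
      fun n : ℕ => G (s * q) - G (s * q ^ (n + 1)) := by
    ext n
    simpa using Finset.sum_range_sub' (fun i => G (s * q ^ (i + 1))) n
  rw [h]
  exact (hG.tendsto.comp (tendsto_mul_pow_succ hq hq1 s)).const_sub _

/-! ### The Andrews–Askey integral -/

/-- The weight `(x/a, x/c; q)_∞ / (αx, βx; q)_∞`. -/
def askeyWeight (a c q α β x : ℝ) : ℝ :=
  qPochInf (x / a) q * qPochInf (x / c) q / (qPochInf (α * x) q * qPochInf (β * x) q)

theorem askeyWeight_comm (a c q α β x : ℝ) :
    askeyWeight a c q α β x = askeyWeight a c q β α x := by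
  rw [askeyWeight, askeyWeight, mul_comm (qPochInf (α * x) q)]

theorem continuousAt_qPochInf_mul (hq : 0 < q) (hq1 : q < 1) (s : ℝ) :
    ContinuousAt (fun x => qPochInf (s * x) q) 0 :=
  ((continuous_qPochInf hq hq1).comp (continuous_const.mul continuous_id)).continuousAt

theorem continuousAt_askeyWeight (hq : 0 < q) (hq1 : q < 1) (a c α β : ℝ) :
    ContinuousAt (askeyWeight a c q α β) 0 := by
  have h1 := continuousAt_qPochInf_mul hq hq1
  have h2 : ∀ s, ContinuousAt (fun x => qPochInf (x / s) q) 0 := by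
    intro s; simpa only [div_eq_mul_inv, mul_comm _ s⁻¹] using h1 s⁻¹
  refine ((h2 a).mul (h2 c)).div ((h1 α).mul (h1 β)) ?_
  simp [qPochInf_zero]

theorem mul_pow_lt_one (hq : 0 < q) (hq1 : q < 1) {s : ℝ} (h : s * q < 1) (n : ℕ) :
    s * q ^ (n + 1) < 1 := by
  have := one_sub_mul_pow_pos hq hq1 h n
  rw [pow_succ']; nlinarith

/-- At the points of the lattice the factor `1 - αx` raises `α` to `qα`. -/
theorem askeyWeight_shift (hq : 0 < q) (hq1 : q < 1) (a c β : ℝ) {α x : ℝ} (hx : α * x < 1) :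
    askeyWeight a c q (α * q) β x = (1 - α * x) * askeyWeight a c q α β x := by
  have h1 : 1 - α * x ≠ 0 := by linarith
  rw [askeyWeight, askeyWeight, qPochInf_eq hq hq1 (α * x),
    show α * q * x = α * x * q by ring]
  rw [mul_assoc (1 - α * x), ← mul_div_assoc, mul_div_mul_left _ _ h1]

/-- Both terms are quadratic multiples of the weight with parameters `a, c`: the factors are `(1 -
x/(aq))(1 - x/(cq))` and `(1 - αx)(1 - βx)`. Their constant terms cancel, which leaves the factor
`x` of a Jackson integrand. Replacing `a, c` by `aq, cq` makes the primitive vanish at the endpoints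
`aq` and `cq`. -/
theorem askeyWeight_diff (hq : 0 < q) (hq1 : q < 1) {a c α β x : ℝ} (ha : a ≠ 0) (hc : c ≠ 0)
    (hα : α * x < 1) (hβ : β * x < 1) :
    askeyWeight (a * q) (c * q) q α β x - askeyWeight (a * q) (c * q) q α β (q * x) =
      x * ((α + β - (a * q)⁻¹ - (c * q)⁻¹ + ((a * c * q ^ 2)⁻¹ - α * β) * x) *
        askeyWeight a c q α β x) := by
  have hq0 := hq.ne'
  have e1 : ∀ s : ℝ, s ≠ 0 → qPochInf (x / (s * q)) q =
      (1 - x / (s * q)) * qPochInf (x / s) q := by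
    intro s hs
    rw [qPochInf_eq hq hq1 (x / (s * q))]
    congr 2; field_simp
  have e2 : ∀ s : ℝ, s ≠ 0 → q * x / (s * q) = x / s := by
    intro s hs; field_simp
  have e3 : askeyWeight (a * q) (c * q) q α β (q * x) =
      (1 - α * x) * ((1 - β * x) * askeyWeight a c q α β x) := by
    rw [askeyWeight_comm a c q α β x, ← askeyWeight_shift hq hq1 a c α hβ,
      askeyWeight_comm a c q (β * q), ← askeyWeight_shift hq hq1 a c _ hα, askeyWeight,
      askeyWeight, e2 a ha, e2 c hc]
    simp only [mul_assoc]
  have e4 : askeyWeight (a * q) (c * q) q α β x =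
      (1 - x / (a * q)) * (1 - x / (c * q)) * askeyWeight a c q α β x := by
    rw [askeyWeight, askeyWeight, e1 a ha, e1 c hc]; ring
  rw [e3, e4]
  field_simp
  ring

/-- Let `I₀, I₁` be the integrals of the weight and of `x` times the weight. Raising `α` to `αq`
inserts `1 - αx` and gives `I₀ - αI₁`, while the telescoping integral gives a linear relation
between `I₀` and `I₁`. Eliminating `I₁` yields the recursion. -/
theorem jackson_askeyWeight_shift (hq : 0 < q) (hq1 : q < 1) {a c α β : ℝ} (ha : a ≠ 0)
    (hc : c ≠ 0) (hαa : α * a * q < 1) (hαc : α * c * q < 1) (hβa : β * a * q < 1)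
    (hβc : β * c * q < 1) :
    (1 - a * c * q ^ 2 * α * β) * jackson a c q (askeyWeight a c q (α * q) β) =
      (1 - a * q * α) * (1 - c * q * α) * jackson a c q (askeyWeight a c q α β) := by
  have hq0 := hq.ne'
  have hw := continuousAt_askeyWeight hq hq1 a c α β
  have hxw : ContinuousAt (fun x => x * askeyWeight a c q α β x) 0 := continuousAt_id.mul hw
  have hlt : ∀ γ s : ℝ, γ * s * q < 1 → ∀ n : ℕ, γ * (s * q ^ (n + 1)) < 1 := by
    intro γ s h n
    rw [← mul_assoc]; exact mul_pow_lt_one hq hq1 h n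
  have e1 : jackson a c q (askeyWeight a c q (α * q) β) = jackson a c q (askeyWeight a c q α β) -
      α * jackson a c q (fun x => x * askeyWeight a c q α β x) := by
    have : jackson a c q (askeyWeight a c q (α * q) β) = jackson a c q
        (fun x => 1 * askeyWeight a c q α β x + (-α) * (x * askeyWeight a c q α β x)) := by
      refine jackson_congr fun n => ⟨?_, ?_⟩
      · rw [askeyWeight_shift hq hq1 a c β (hlt α a hαa n)]; ring
      · rw [askeyWeight_shift hq hq1 a c β (hlt α c hαc n)]; ring
    rw [this, jackson_add_mul hq hq1 hw hxw]
    ring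
  set A := α + β - (a * q)⁻¹ - (c * q)⁻¹ with hA
  set B := (a * c * q ^ 2)⁻¹ - α * β with hB
  -- The integrand is the `q`-derivative of `G`. Each half of the lattice contributes `-G 0`,
  -- because `G` vanishes at `aq` and `cq`, and the two contributions cancel.
  have e2 : A * jackson a c q (askeyWeight a c q α β) +
      B * jackson a c q (fun x => x * askeyWeight a c q α β x) = 0 := by
    set G := askeyWeight (a * q) (c * q) q α β with hG
    have hGc : ContinuousAt G 0 := continuousAt_askeyWeight hq hq1 _ _ _ _
    have hside : ∀ s : ℝ, α * s * q < 1 → β * s * q < 1 → ∀ n : ℕ,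
        s * q ^ (n + 1) * ((A + B * (s * q ^ (n + 1))) * askeyWeight a c q α β (s * q ^ (n + 1))) =
          G (s * q ^ (n + 1)) - G (s * q ^ (n + 2)) := by
      intro s h1 h2 n
      rw [← askeyWeight_diff hq hq1 ha hc (hlt α s h1 n) (hlt β s h2 n)]
      congr 2; ring
    have hcont : ContinuousAt (fun x => (A + B * x) * askeyWeight a c q α β x) 0 :=
      ContinuousAt.mul (by fun_prop) hw
    have hva : ∀ s : ℝ, s ≠ 0 → qPochInf (s * q / (s * q)) q = 0 := by
      intro s hs
      rw [div_self (mul_ne_zero hs hq0), qPochInf_eq hq hq1]; ring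
    have ht : ∀ s : ℝ, α * s * q < 1 → β * s * q < 1 → G (s * q) = 0 →
        ∑' n : ℕ, s * q ^ (n + 1) *
          ((A + B * (s * q ^ (n + 1))) * askeyWeight a c q α β (s * q ^ (n + 1))) = - G 0 := by
      intro s h1 h2 h3
      have hsum := summable_jackson_side hq hq1 hcont s
      rw [tsum_congr (hside s h1 h2), tsum_sub_shift hq hq1 hGc s
        (hsum.congr fun n => (hside s h1 h2 n)), h3, zero_sub]
    have e3 : jackson a c q (fun x => (A + B * x) * askeyWeight a c q α β x) = 0 := by
      rw [jackson, (summable_jackson_side hq hq1 hcont a).tsum_sub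
        (summable_jackson_side hq hq1 hcont c), ht a hαa hβa (by simp [hG, askeyWeight, hva a ha]),
        ht c hαc hβc (by simp [hG, askeyWeight, hva c hc]), sub_self]
    rw [← e3, ← jackson_add_mul hq hq1 hw hxw]
    refine jackson_congr fun n => ⟨?_, ?_⟩ <;> ring
  rw [e1]
  have e4 : 1 - a * c * q ^ 2 * α * β = a * c * q ^ 2 * B := by rw [hB]; field_simp
  have e5 : (1 - a * q * α) * (1 - c * q * α) = a * c * q ^ 2 * (B + α * A) := by
    rw [hB, hA]; field_simp; ring
  rw [e4, e5]
  linear_combination (-(a * c * q ^ 2 * α)) * e2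

end QPoch

/-! ### Evaluation of the Andrews–Askey integral and the `q`-Chu–Vandermonde sum -/

section Askey

variable {q : ℝ}

theorem askeyWeight_eq_zero_mul (a c α β x : ℝ) :
    askeyWeight a c q α β x = askeyWeight a c q 0 β x * (qPochInf (α * x) q)⁻¹ := by
  rw [askeyWeight, askeyWeight, zero_mul, qPochInf_zero, one_mul, ← div_eq_mul_inv, div_div,
    mul_comm (qPochInf (α * x) q)]

/-- All the arguments lie in one compact interval to the left of `1`, where `(y;q)_∞` is continuous
without zeros. Uniformity in both `N` and `n` is what dominated convergence needs. -/
theorem exists_inv_qPochInf_bound (hq : 0 < q) (hq1 : q < 1) {t : ℝ} (ht : t * q < 1) :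
    ∃ C, 0 ≤ C ∧ ∀ N n : ℕ, |(qPochInf (t * q ^ (n + 1) * q ^ N) q)⁻¹| ≤ C := by
  have hδ : max (t * q) 0 < 1 := max_lt ht one_pos
  have hc : ContinuousOn (fun y => (qPochInf y q)⁻¹) (Set.Icc (-|t|) (max (t * q) 0)) :=
    (continuous_qPochInf hq hq1).continuousOn.inv₀ fun y hy =>
      qPochInf_ne_zero hq hq1 (hy.2.trans_lt hδ)
  obtain ⟨C, hC⟩ := isCompact_Icc.exists_bound_of_continuousOn hc
  refine ⟨max C 0, le_max_right _ _, fun N n => (hC _ ⟨?_, ?_⟩).trans (le_max_left _ _)⟩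
  · have h1 : |t * q ^ (n + 1) * q ^ N| ≤ |t| := by
      rw [mul_assoc, ← pow_add, abs_mul, abs_of_nonneg (pow_pos hq _).le]
      exact mul_le_of_le_one_right (abs_nonneg t) (pow_le_one₀ hq.le hq1.le)
    exact (abs_le.1 h1).1
  · have h1 : t * q ^ (n + 1) * q ^ N = t * q * q ^ (n + N) := by ring
    have h2 : q ^ (n + N) ≤ 1 := pow_le_one₀ hq.le hq1.le
    have h3 : 0 < q ^ (n + N) := pow_pos hq _
    rw [h1]
    rcases le_total 0 (t * q) with h | h
    · exact (mul_le_of_le_one_right h h2).trans (le_max_left _ _)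
    · exact (mul_nonpos_of_nonpos_of_nonneg h h3.le).trans (le_max_right _ _)

theorem tendsto_jackson_askeyWeight (hq : 0 < q) (hq1 : q < 1) {a c α : ℝ} (β : ℝ)
    (ha : α * a * q < 1) (hc : α * c * q < 1) :
    Tendsto (fun N : ℕ => jackson a c q (askeyWeight a c q (α * q ^ N) β)) atTop
      (𝓝 (jackson a c q (askeyWeight a c q 0 β))) := by
  have hside : ∀ s : ℝ, α * s * q < 1 → Tendsto (fun N : ℕ => ∑' n : ℕ,
      s * q ^ (n + 1) * askeyWeight a c q (α * q ^ N) β (s * q ^ (n + 1))) atTop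
      (𝓝 (∑' n : ℕ, s * q ^ (n + 1) * askeyWeight a c q 0 β (s * q ^ (n + 1)))) := by
    intro s hs
    obtain ⟨C, hC0, hC⟩ := exists_inv_qPochInf_bound hq hq1 hs
    have hsum := (summable_jackson_side hq hq1
      (continuousAt_askeyWeight hq hq1 a c 0 β) s).norm.mul_right C
    refine tendsto_tsum_of_dominated_convergence hsum (fun n => ?_) (.of_forall fun N n => ?_)
    · have h1 : Tendsto (fun N : ℕ => qPochInf (α * q ^ N * (s * q ^ (n + 1))) q) atTop
          (𝓝 (qPochInf 0 q)) := by
        refine (continuous_qPochInf hq hq1).continuousAt.tendsto.comp ?_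
        have := (tendsto_pow_atTop_nhds_zero_of_lt_one hq.le hq1).mul_const (α * (s * q ^ (n + 1)))
        rw [zero_mul] at this
        exact this.congr fun N => by ring
      rw [qPochInf_zero] at h1
      have h2 := ((h1.inv₀ one_ne_zero).const_mul
        (askeyWeight a c q 0 β (s * q ^ (n + 1)))).const_mul (s * q ^ (n + 1))
      simp only [inv_one, mul_one] at h2
      exact h2.congr fun N => by rw [askeyWeight_eq_zero_mul a c (α * q ^ N)]
    · rw [askeyWeight_eq_zero_mul a c (α * q ^ N), ← mul_assoc, norm_mul]
      refine mul_le_mul_of_nonneg_left ?_ (norm_nonneg _)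
      have := hC N n
      rwa [show α * s * q ^ (n + 1) * q ^ N = α * q ^ N * (s * q ^ (n + 1)) by ring] at this
  have hj : ∀ γ, jackson a c q (askeyWeight a c q γ β) =
      (∑' n : ℕ, a * q ^ (n + 1) * askeyWeight a c q γ β (a * q ^ (n + 1))) -
      ∑' n : ℕ, c * q ^ (n + 1) * askeyWeight a c q γ β (c * q ^ (n + 1)) := fun γ =>
    (summable_jackson_side hq hq1 (continuousAt_askeyWeight hq hq1 a c γ β) a).tsum_sub
      (summable_jackson_side hq hq1 (continuousAt_askeyWeight hq hq1 a c γ β) c)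
  simp only [hj]
  exact (hside a ha).sub (hside c hc)

theorem mul_pow_mul_lt_one (hq : 0 < q) (hq1 : q < 1) {α s : ℝ} (h : α * s * q < 1) (N : ℕ) :
    α * q ^ N * s * q < 1 := by
  have := one_sub_mul_pow_pos hq hq1 h N
  have e : α * q ^ N * s * q = α * s * q * q ^ N := by ring
  rw [e]; linarith

theorem jackson_askeyWeight_shift_pow (hq : 0 < q) (hq1 : q < 1) {a c α β : ℝ} (ha : a ≠ 0)
    (hc : c ≠ 0) (hαa : α * a * q < 1) (hαc : α * c * q < 1) (hβa : β * a * q < 1)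
    (hβc : β * c * q < 1) (N : ℕ) :
    qPoch (a * c * q ^ 2 * α * β) q N * jackson a c q (askeyWeight a c q (α * q ^ N) β) =
      qPoch (a * q * α) q N * qPoch (c * q * α) q N *
        jackson a c q (askeyWeight a c q α β) := by
  induction N with
  | zero => simp [qPoch]
  | succ N ih =>
    have h := jackson_askeyWeight_shift hq hq1 ha hc (mul_pow_mul_lt_one hq hq1 hαa N)
      (mul_pow_mul_lt_one hq hq1 hαc N) hβa hβc
    rw [qPoch_succ, qPoch_succ, qPoch_succ, pow_succ q N, ← mul_assoc α]
    linear_combination (1 - a * q * (α * q ^ N)) * (1 - c * q * (α * q ^ N)) * ih +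
      qPoch (a * c * q ^ 2 * α * β) q N * h

/-- The limit `N → ∞` of the iterated shift: `αq^N → 0` removes the parameter `α` from the integral.
-/
theorem jackson_askeyWeight_reduce (hq : 0 < q) (hq1 : q < 1) {a c α β : ℝ} (ha : a ≠ 0)
    (hc : c ≠ 0) (hαa : α * a * q < 1) (hαc : α * c * q < 1) (hβa : β * a * q < 1)
    (hβc : β * c * q < 1) :
    qPochInf (a * c * q ^ 2 * α * β) q * jackson a c q (askeyWeight a c q 0 β) =
      qPochInf (a * q * α) q * qPochInf (c * q * α) q *
        jackson a c q (askeyWeight a c q α β) := by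
  refine tendsto_nhds_unique
    ((tendsto_qPoch hq hq1 _).mul (tendsto_jackson_askeyWeight hq hq1 β hαa hαc))
    ((((tendsto_qPoch hq hq1 (a * q * α)).mul (tendsto_qPoch hq hq1 (c * q * α))).mul_const
      _).congr fun N => ?_)
  exact (jackson_askeyWeight_shift_pow hq hq1 ha hc hαa hαc hβa hβc N).symm

theorem jackson_askeyWeight_aux (hq : 0 < q) (hq1 : q < 1) {a c α β : ℝ} (ha : a ≠ 0)
    (hc : c ≠ 0) (hαa : α * a * q < 1) (hαc : α * c * q < 1) (hβa : β * a * q < 1)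
    (hβc : β * c * q < 1) :
    qPochInf (a * c * q ^ 2 * α * β) q * jackson a c q (askeyWeight a c q 0 0) =
      qPochInf (a * q * α) q * qPochInf (c * q * α) q *
        (qPochInf (a * q * β) q * qPochInf (c * q * β) q) *
        jackson a c q (askeyWeight a c q α β) := by
  have h1 := jackson_askeyWeight_reduce hq hq1 ha hc hαa hαc hβa hβc
  have h2 := jackson_askeyWeight_reduce hq hq1 (β := 0) ha hc hβa hβc (by simp) (by simp)
  rw [mul_zero, qPochInf_zero, one_mul] at h2
  have h3 : askeyWeight a c q β 0 = askeyWeight a c q 0 β :=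
    funext fun x => askeyWeight_comm a c q β 0 x
  rw [h3] at h2
  rw [h2]
  linear_combination (qPochInf (a * q * β) q * qPochInf (c * q * β) q) * h1

/-- The remaining constant is independent of `α` and `β`, so it can be read off from `α = 1/a`, `β =
1/c`. There the weight is identically `1` on the lattice and the integral is a geometric series. -/
theorem jackson_askeyWeight_zero (hq : 0 < q) (hq1 : q < 1) {a c : ℝ} (ha : 0 < a)
    (hc : c < 0) :
    jackson a c q (askeyWeight a c q 0 0) = a * q * (qPochInf q q * qTheta (c / a) q) := by
  have hq0 := hq.ne'
  have hca : c / a < 0 := div_neg_of_neg_of_pos hc ha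
  have hac : a / c < 0 := div_neg_of_pos_of_neg ha hc
  have h := jackson_askeyWeight_aux hq hq1 (α := a⁻¹) (β := c⁻¹) ha.ne' hc.ne
    (by rw [inv_mul_cancel₀ ha.ne', one_mul]; exact hq1)
    (by rw [inv_mul_eq_div]; nlinarith)
    (by rw [inv_mul_eq_div]; nlinarith)
    (by rw [inv_mul_cancel₀ hc.ne, one_mul]; exact hq1)
  have hI : jackson a c q (askeyWeight a c q a⁻¹ c⁻¹) = q * (a - c) / (1 - q) := by
    have h1 : jackson a c q (askeyWeight a c q a⁻¹ c⁻¹) = jackson a c q (fun _ => 1) := by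
      have hone : ∀ x : ℝ, x / a < 1 → x / c < 1 → askeyWeight a c q a⁻¹ c⁻¹ x = 1 := by
        intro x h1 h2
        rw [askeyWeight, inv_mul_eq_div, inv_mul_eq_div]
        exact div_self (mul_ne_zero (qPochInf_ne_zero hq hq1 h1) (qPochInf_ne_zero hq hq1 h2))
      refine jackson_congr fun n => ?_
      have hp : 0 < q ^ (n + 1) := pow_pos hq _
      have hp1 : q ^ (n + 1) < 1 := pow_lt_one₀ hq.le hq1 (by simp)
      constructor
      · refine hone _ ?_ ?_
        · rw [mul_div_right_comm, div_self ha.ne', one_mul]; exact hp1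
        · rw [mul_div_right_comm]; nlinarith
      · refine hone _ ?_ ?_
        · rw [mul_div_right_comm]; nlinarith
        · rw [mul_div_right_comm, div_self hc.ne, one_mul]; exact hp1
    rw [h1, jackson]
    have h2 : ∀ n : ℕ, a * q ^ (n + 1) * 1 - c * q ^ (n + 1) * 1 = q * (a - c) * q ^ n := by
      intro n; ring
    rw [tsum_congr h2, tsum_mul_left, tsum_geometric_of_lt_one hq.le hq1, div_eq_mul_inv]
  have e1 : a * c * q ^ 2 * a⁻¹ * c⁻¹ = q * q := by
    have := ha.ne'; have := hc.ne; field_simp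
  have e2 : a * q * a⁻¹ = q := by have := ha.ne'; field_simp
  have e3 : c * q * c⁻¹ = q := by have := hc.ne; field_simp
  have e4 : c * q * a⁻¹ = c / a * q := by ring
  have e5 : a * q * c⁻¹ = q / (c / a) := by rw [div_div_eq_mul_div]; ring
  rw [hI, e1, e2, e3, e4, e5] at h
  have hqq : qPochInf (q * q) q ≠ 0 := qPochInf_ne_zero hq hq1 (by nlinarith)
  have hq' : (1 : ℝ) - q ≠ 0 := by linarith
  rw [qTheta, qPochInf_eq hq hq1 (c / a)]
  rw [qPochInf_eq hq hq1 q] at h ⊢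
  apply mul_left_cancel₀ hqq
  rw [h]
  have := ha.ne'
  field_simp

/-- The Andrews–Askey evaluation. -/
theorem jackson_askeyWeight (hq : 0 < q) (hq1 : q < 1) {a c α β : ℝ} (ha : 0 < a)
    (hc : c < 0) (hαa : α * a * q < 1) (hαc : α * c * q < 1) (hβa : β * a * q < 1)
    (hβc : β * c * q < 1) :
    jackson a c q (askeyWeight a c q α β) =
      a * q * (qPochInf q q * qTheta (c / a) q) * qPochInf (a * c * q ^ 2 * α * β) q /
      (qPochInf (a * q * α) q * qPochInf (c * q * α) q *
        (qPochInf (a * q * β) q * qPochInf (c * q * β) q)) := by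
  have h := jackson_askeyWeight_aux hq hq1 ha.ne' hc.ne hαa hαc hβa hβc
  rw [jackson_askeyWeight_zero hq hq1 ha hc] at h
  have hne : ∀ s γ : ℝ, γ * s * q < 1 → qPochInf (s * q * γ) q ≠ 0 := by
    intro s γ h
    refine qPochInf_ne_zero hq hq1 ?_
    rwa [show s * q * γ = γ * s * q by ring]
  have h1 := hne a α hαa
  have h2 := hne c α hαc
  have h3 := hne a β hβa
  have h4 := hne c β hβc
  rw [eq_div_iff (by positivity), mul_comm, ← h]
  ring

/-! ### The `q`-Chu–Vandermonde sum -/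

theorem qPoch_eq_zero {q x : ℝ} {i n : ℕ} (hi : i < n) (h : x * q ^ i = 1) :
    qPoch x q n = 0 :=
  Finset.prod_eq_zero (Finset.mem_range.2 hi) (by rw [h, sub_self])

theorem qPoch_inv_pow_eq_zero (hq : q ≠ 0) {m k : ℕ} (h : m < k) :
    qPoch ((q ^ m)⁻¹) q k = 0 :=
  qPoch_eq_zero h (inv_mul_cancel₀ (pow_ne_zero m hq))

/-- A Pascal-type rule in `m`, which drives the induction for the `q`-Chu–Vandermonde sum. -/
theorem qPoch_inv_pow_succ (hq : q ≠ 0) (m k : ℕ) :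
    qPoch ((q ^ (m + 1))⁻¹) q (k + 1) = qPoch ((q ^ m)⁻¹) q (k + 1) -
      (q ^ (m + 1))⁻¹ * (1 - q ^ (k + 1)) * qPoch ((q ^ m)⁻¹) q k := by
  rw [qPoch_succ', qPoch_succ, show (q ^ (m + 1))⁻¹ * q = (q ^ m)⁻¹ by
    rw [pow_succ]; field_simp]
  rw [show (q ^ m)⁻¹ = (q ^ (m + 1))⁻¹ * q by rw [pow_succ]; field_simp]
  ring

/-- The terminating series `₂φ₁(q^{-m}, B; C; q, q)`. -/
def vandermondeSum (q : ℝ) (m : ℕ) (B C : ℝ) : ℝ :=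
  ∑ k ∈ Finset.range (m + 1),
    qPoch ((q ^ m)⁻¹) q k * qPoch B q k / (qPoch q q k * qPoch C q k) * q ^ k

theorem vandermondeSum_eq_of_le (hq : q ≠ 0) {m M : ℕ} (h : m ≤ M) (B C : ℝ) :
    vandermondeSum q m B C = ∑ k ∈ Finset.range (M + 1),
      qPoch ((q ^ m)⁻¹) q k * qPoch B q k / (qPoch q q k * qPoch C q k) * q ^ k := by
  refine Finset.sum_subset (Finset.range_mono (by omega)) fun k _ hk => ?_
  rw [Finset.mem_range, not_lt] at hk
  rw [qPoch_inv_pow_eq_zero hq (by omega)]; simp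

/-- The Pascal rule applied term by term. Its second part carries a factor `1 - q^(k+1)` that lowers
the denominator `(q;q)_{k+1}`, and extracting the first factors of `(B;q)_{k+1}` and `(C;q)_{k+1}`
shifts the parameters. -/
theorem vandermondeSum_succ (hq : 0 < q) (hq1 : q < 1) (m : ℕ) (B : ℝ) {C : ℝ} (hC : C < 1) :
    vandermondeSum q (m + 1) B C = vandermondeSum q m B C -
      (q ^ m)⁻¹ * ((1 - B) / (1 - C)) * vandermondeSum q m (B * q) (C * q) := by
  have hq0 := hq.ne'
  rw [vandermondeSum_eq_of_le hq0 (Nat.le_succ m) B C, vandermondeSum, vandermondeSum,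
    Finset.sum_range_succ', Finset.sum_range_succ' _ (m + 1)]
  simp only [qPoch_zero]
  rw [add_sub_right_comm]
  congr 1
  rw [Finset.mul_sum, ← Finset.sum_sub_distrib]
  refine Finset.sum_congr rfl fun k _ => ?_
  have hCq : C * q < 1 := by simpa using mul_pow_lt_one (s := C) hq hq1 (by nlinarith) 0
  have h1 := (qPoch_pos hq hq1 hCq k).ne'
  have h2 : (1 : ℝ) - C ≠ 0 := by linarith
  have h3 := (qPoch_pos hq hq1 hq1 k).ne'
  have h4 : 1 - q ^ (k + 1) ≠ 0 := by
    have := pow_lt_one₀ hq.le hq1 (Nat.succ_ne_zero k); simp at this; linarith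
  rw [qPoch_inv_pow_succ hq0, qPoch_succ' B, qPoch_succ' C, qPoch_succ q,
    show 1 - q * q ^ k = 1 - q ^ (k + 1) by ring]
  field_simp
  ring

/-- Induction on `m` for all `B, C` at once. The quotient `C/B` is unchanged by the shift to `Bq,
Cq`, so both sums in the recursion contain the same product `(C/B;q)_m`. -/
theorem vandermondeSum_eq (hq : 0 < q) (hq1 : q < 1) (m : ℕ) {B C : ℝ} (hB : B ≠ 0)
    (hC : C < 1) :
    vandermondeSum q m B C = qPoch (C / B) q m / qPoch C q m * B ^ m := by
  have hq0 := hq.ne'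
  induction m generalizing B C with
  | zero => simp [vandermondeSum, qPoch]
  | succ m ih =>
    have hCq : C * q < 1 := by
      rcases le_total C 0 with h | h <;> nlinarith
    rw [vandermondeSum_succ hq hq1 m B hC, ih hB hC, ih (mul_ne_zero hB hq0) hCq,
      mul_div_mul_right _ _ hq0, qPoch_succ (C / B)]
    have h1 := (qPoch_pos hq hq1 hCq m).ne'
    have h2 : (1 : ℝ) - C ≠ 0 := by linarith
    have h3 := (qPoch_pos hq hq1 hC m).ne'
    have h4 : qPoch C q m * (1 - C * q ^ m) = (1 - C) * qPoch (C * q) q m := by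
      rw [← qPoch_succ, qPoch_succ']
    have h5 : (1 : ℝ) - C * q ^ m ≠ 0 := (one_sub_mul_pow_pos hq hq1 hC m).ne'
    have h6 : qPoch C q m = (1 - C) * qPoch (C * q) q m / (1 - C * q ^ m) := by
      rw [← h4]; field_simp
    rw [qPoch_succ' C, h6]
    field_simp
    ring

end Askey

/-- The parameters for which the big `q`-Jacobi polynomials are orthogonal on the lattice
`{aq^{n+1}} ∪ {cq^{n+1}}` with `c < 0 < a`. -/
structure Admissible (a b c q : ℝ) : Prop where
  q_pos : 0 < q
  q_lt_one : q < 1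
  a_pos : 0 < a
  aq_lt_one : a * q < 1
  b_pos : 0 < b
  bq_lt_one : b * q < 1
  c_neg : c < 0

/-! ### Big `q`-Jacobi polynomials: degrees, orthogonality and norms -/

section Jacobi

variable {a b c q : ℝ}

/-- The polynomial `(sX; q)_k`. -/
def qPochPoly (s q : ℝ) (k : ℕ) : ℝ[X] := ∏ i ∈ Finset.range k, (1 - C (s * q ^ i) * X)

theorem eval_qPochPoly (s q x : ℝ) (k : ℕ) : (qPochPoly s q k).eval x = qPoch (s * x) q k := by
  rw [qPochPoly, eval_prod, qPoch]
  refine Finset.prod_congr rfl fun i _ => ?_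
  simp only [eval_sub, eval_one, eval_mul, eval_C, eval_X]
  ring

theorem degree_one_sub_C_mul_X {r : ℝ} (hr : r ≠ 0) : (1 - C r * X : ℝ[X]).degree = 1 := by
  rw [show (1 - C r * X : ℝ[X]) = C (-r) * X + C 1 by simp; ring]
  exact degree_linear (neg_ne_zero.2 hr)

theorem leadingCoeff_one_sub_C_mul_X {r : ℝ} (hr : r ≠ 0) :
    (1 - C r * X : ℝ[X]).leadingCoeff = -r := by
  rw [show (1 - C r * X : ℝ[X]) = C (-r) * X + C 1 by simp; ring]
  exact leadingCoeff_linear (neg_ne_zero.2 hr)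

theorem degree_qPochPoly {s : ℝ} (hs : s ≠ 0) (hq : q ≠ 0) (k : ℕ) :
    (qPochPoly s q k).degree = k := by
  rw [qPochPoly, degree_prod, Finset.sum_congr rfl fun i _ =>
    degree_one_sub_C_mul_X (mul_ne_zero hs (pow_ne_zero i hq))]
  simp

/-- Serves to pass from the basis `(x;q)_k`, in which `P_m` is defined, to `((b/c)x;q)_k`, in which
it is integrated; only leading terms have to be compared. -/
theorem leadingCoeff_qPochPoly {s : ℝ} (hs : s ≠ 0) (hq : q ≠ 0) (k : ℕ) :
    (qPochPoly s q k).leadingCoeff = s ^ k * (qPochPoly 1 q k).leadingCoeff := by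
  rw [qPochPoly, qPochPoly, leadingCoeff_prod, leadingCoeff_prod]
  have h := Finset.prod_const s (s := Finset.range k)
  rw [Finset.card_range] at h
  rw [← h, ← Finset.prod_mul_distrib]
  refine Finset.prod_congr rfl fun i _ => ?_
  rw [leadingCoeff_one_sub_C_mul_X (mul_ne_zero hs (pow_ne_zero i hq)),
    leadingCoeff_one_sub_C_mul_X (mul_ne_zero one_ne_zero (pow_ne_zero i hq))]
  ring

/-- The coefficient of `(x; q)_k` in `P_m(x; a, b, c; q)`. -/
def jacobiCoeff (a b c q : ℝ) (m k : ℕ) : ℝ :=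
  qPoch ((q ^ m)⁻¹) q k * qPoch (a * b * q ^ (m + 1)) q k /
    (qPoch q q k * qPoch (a * q) q k * qPoch (c * q) q k) * q ^ k

/-- `P_m(X; a, b, c; q)` as a polynomial. -/
def jacobiPoly (a b c q : ℝ) (m : ℕ) : ℝ[X] :=
  ∑ k ∈ Finset.range (m + 1), C (jacobiCoeff a b c q m k) * qPochPoly 1 q k

theorem eval_jacobiPoly_eq_sum (a b c q x : ℝ) (m : ℕ) :
    (jacobiPoly a b c q m).eval x =
      ∑ k ∈ Finset.range (m + 1), jacobiCoeff a b c q m k * qPoch x q k := by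
  simp [jacobiPoly, eval_finsetSum, eval_qPochPoly]

theorem eval_jacobiPoly (hq : q ≠ 0) (a b c x : ℝ) (m : ℕ) :
    (jacobiPoly a b c q m).eval x = bigJacobi m x a b c q := by
  rw [eval_jacobiPoly_eq_sum, bigJacobi, phi32, tsum_eq_sum (s := Finset.range (m + 1))]
  · refine Finset.sum_congr rfl fun k _ => ?_
    rw [jacobiCoeff]; ring
  · intro k hk
    rw [Finset.mem_range, not_lt] at hk
    rw [qPoch_inv_pow_eq_zero hq (by omega)]; simp

theorem qPoch_inv_pow_self (hq : q ≠ 0) (m : ℕ) :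
    qPoch ((q ^ m)⁻¹) q m = (-1) ^ m * (q ^ (m + 1).choose 2)⁻¹ * qPoch q q m := by
  induction m with
  | zero => simp [qPoch]
  | succ m ih =>
    rw [qPoch_succ', qPoch_succ, show (q ^ (m + 1))⁻¹ * q = (q ^ m)⁻¹ by
      rw [pow_succ]; field_simp, ih, Nat.choose_succ_succ (m + 1) 1, Nat.choose_one_right]
    have h0 := pow_ne_zero (m + 1) hq
    have h1 := pow_ne_zero ((m + 1).choose 2) hq
    rw [pow_add, show q * q ^ m = q ^ (m + 1) by ring]
    field_simp
    ring

namespace Admissible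

/-- Only `aq < 1` and `bq < 1` are available, so `abq` may be `1` or more. This is why exponents of
at least `2` are kept throughout and `1 - abq` is never divided by. -/
theorem ab_mul_pow_lt_one (h : Admissible a b c q) {j : ℕ} (hj : 2 ≤ j) :
    a * b * q ^ j < 1 := by
  obtain ⟨i, rfl⟩ := Nat.exists_eq_add_of_le hj
  have h1 : q ^ i ≤ 1 := pow_le_one₀ h.q_pos.le h.q_lt_one.le
  have h2 : 0 < q ^ i := pow_pos h.q_pos i
  have h3 : 0 < a * q := mul_pos h.a_pos h.q_pos
  have h4 : 0 < b * q := mul_pos h.b_pos h.q_pos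
  have h5 : (a * q) * (b * q) < 1 := by nlinarith [h.aq_lt_one, h.bq_lt_one]
  calc a * b * q ^ (2 + i) = (a * q) * (b * q) * q ^ i := by ring
    _ < 1 := by nlinarith

theorem ab_pos (h : Admissible a b c q) : 0 < a * b := mul_pos h.a_pos h.b_pos

theorem bc_neg (h : Admissible a b c q) : b / c < 0 := div_neg_of_pos_of_neg h.b_pos h.c_neg

theorem cq_lt_one (h : Admissible a b c q) : c * q < 1 := by nlinarith [h.c_neg, h.q_pos]

theorem jacobiCoeff_self_ne_zero (h : Admissible a b c q) (m : ℕ) :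
    jacobiCoeff a b c q m m ≠ 0 := by
  have hq0 := h.q_pos.ne'
  have h1 := (qPoch_pos h.q_pos h.q_lt_one h.q_lt_one m).ne'
  have h2 := (qPoch_pos h.q_pos h.q_lt_one h.aq_lt_one m).ne'
  have h3 := (qPoch_pos h.q_pos h.q_lt_one h.cq_lt_one m).ne'
  have h4 : qPoch (a * b * q ^ (m + 1)) q m ≠ 0 := by
    -- For `m = 0` the product is empty; the bound on `abq^(m+1)` holds only from `m = 1` on.
    rcases m with _ | m
    · simp [qPoch]
    · exact (qPoch_pos h.q_pos h.q_lt_one (h.ab_mul_pow_lt_one (by omega)) _).ne'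
  rw [jacobiCoeff, qPoch_inv_pow_self hq0]
  have h5 : ((-1 : ℝ)) ^ m ≠ 0 := pow_ne_zero _ (by norm_num)
  positivity

theorem jacobiPoly_eq (m : ℕ) : jacobiPoly a b c q m =
    ∑ k ∈ Finset.range m, C (jacobiCoeff a b c q m k) * qPochPoly 1 q k +
      C (jacobiCoeff a b c q m m) * qPochPoly 1 q m := by
  rw [jacobiPoly, Finset.sum_range_succ]

theorem degree_jacobiPoly_lower (h : Admissible a b c q) (m : ℕ) :
    (∑ k ∈ Finset.range m, C (jacobiCoeff a b c q m k) * qPochPoly 1 q k).degree < m := by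
  rw [← mem_degreeLT]
  refine Submodule.sum_mem _ fun k hk => ?_
  rw [mem_degreeLT]
  refine lt_of_le_of_lt (degree_mul_le_of_le degree_C_le le_rfl) ?_
  rw [degree_qPochPoly one_ne_zero h.q_pos.ne', zero_add]
  exact_mod_cast Finset.mem_range.1 hk

theorem degree_jacobiPoly (h : Admissible a b c q) (m : ℕ) :
    (jacobiPoly a b c q m).degree = m := by
  have h1 : (C (jacobiCoeff a b c q m m) * qPochPoly 1 q m).degree = m := by
    rw [degree_C_mul (h.jacobiCoeff_self_ne_zero m),
      degree_qPochPoly one_ne_zero h.q_pos.ne']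
  rw [jacobiPoly_eq, degree_add_eq_right_of_degree_lt, h1]
  rw [h1]; exact h.degree_jacobiPoly_lower m

/-- The big `q`-Jacobi polynomials as a polynomial sequence. -/
def jacobiSeq (h : Admissible a b c q) : Polynomial.Sequence ℝ :=
  ⟨jacobiPoly a b c q, h.degree_jacobiPoly⟩

theorem span_jacobiPoly (h : Admissible a b c q) :
    Submodule.span ℝ (Set.range (jacobiPoly a b c q)) = ⊤ :=
  h.jacobiSeq.span fun i => (leadingCoeff_ne_zero.2 (h.jacobiSeq.ne_zero i)).isUnit

/-- The polynomials `((b/c)X; q)_k` as a polynomial sequence. -/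
def companionSeq (h : Admissible a b c q) : Polynomial.Sequence ℝ :=
  ⟨qPochPoly (b / c) q, degree_qPochPoly h.bc_neg.ne h.q_pos.ne'⟩

/-- The leading term of `P_m` in the basis `((b/c)X; q)_k`. -/
theorem degree_jacobiPoly_sub (h : Admissible a b c q) (m : ℕ) :
    (jacobiPoly a b c q m - C (jacobiCoeff a b c q m m * (c / b) ^ m) *
      qPochPoly (b / c) q m).degree < m := by
  have hq0 := h.q_pos.ne'
  have hr : jacobiCoeff a b c q m m * (c / b) ^ m ≠ 0 :=
    mul_ne_zero (h.jacobiCoeff_self_ne_zero m)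
      (pow_ne_zero _ (div_ne_zero h.c_neg.ne h.b_pos.ne'))
  have h1 : (C (jacobiCoeff a b c q m m) * qPochPoly 1 q m).degree = m := by
    rw [degree_C_mul (h.jacobiCoeff_self_ne_zero m), degree_qPochPoly one_ne_zero hq0]
  have h2 : (C (jacobiCoeff a b c q m m * (c / b) ^ m) * qPochPoly (b / c) q m).degree = m := by
    rw [degree_C_mul hr, degree_qPochPoly h.bc_neg.ne hq0]
  have h3 : (C (jacobiCoeff a b c q m m) * qPochPoly 1 q m -
      C (jacobiCoeff a b c q m m * (c / b) ^ m) * qPochPoly (b / c) q m).degree < m := by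
    rw [← h1]
    refine degree_sub_lt_left (h1.trans h2.symm) ?_ ?_
    · intro h0; rw [h0, degree_zero] at h1; simp at h1
    · rw [leadingCoeff_mul, leadingCoeff_mul, leadingCoeff_C, leadingCoeff_C,
        leadingCoeff_qPochPoly h.bc_neg.ne hq0, mul_assoc, ← mul_assoc ((c / b) ^ m),
        ← mul_pow, div_mul_div_cancel₀ h.b_pos.ne', div_self h.c_neg.ne, one_pow, one_mul]
  rw [jacobiPoly_eq, add_sub_assoc]
  exact (degree_add_le _ _).trans_lt (max_lt (h.degree_jacobiPoly_lower m) h3)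

end Admissible

/-! ### Integration against the big `q`-Jacobi weight -/

/-- The integral of a polynomial against the weight `u`. -/
def jacobiInt (h : Admissible a b c q) : ℝ[X] →ₗ[ℝ] ℝ where
  toFun p := jackson a c q fun x => askeyWeight a c q 1 (b / c) x * p.eval x
  map_add' p r := by
    have hw := continuousAt_askeyWeight h.q_pos h.q_lt_one a c 1 (b / c)
    have := jackson_add_mul h.q_pos h.q_lt_one
      (h := fun x => askeyWeight a c q 1 (b / c) x * p.eval x)
      (g := fun x => askeyWeight a c q 1 (b / c) x * r.eval x)
      (hw.mul p.continuousAt) (hw.mul r.continuousAt) a c 1 1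
    simpa only [one_mul, ← mul_add, ← eval_add] using this
  map_smul' s p := by
    rw [RingHom.id_apply, smul_eq_mul, ← jackson_const_mul]
    simp only [eval_smul, smul_eq_mul]
    congr 1; ext x; ring

theorem jacobiInt_apply (h : Admissible a b c q) (p : ℝ[X]) : jacobiInt h p =
    jackson a c q fun x => askeyWeight a c q 1 (b / c) x * p.eval x := rfl

theorem askeyWeight_shift_pow (hq : 0 < q) (hq1 : q < 1) (a c β : ℝ) {α x : ℝ} (hx : α * x < 1)
    (k : ℕ) : askeyWeight a c q (α * q ^ k) β x = qPoch (α * x) q k * askeyWeight a c q α β x := by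
  induction k with
  | zero => simp [qPoch]
  | succ k ih =>
    have := one_sub_mul_pow_pos hq hq1 hx k
    rw [pow_succ q, ← mul_assoc, askeyWeight_shift hq hq1 a c β (by
      rw [mul_right_comm]; linarith), ih, qPoch_succ]
    ring

namespace Admissible

/-- Every lattice point satisfies `x < 1` and `(b/c) x < 1`. -/
theorem lattice_bounds (h : Admissible a b c q) (n : ℕ) :
    (1 * (a * q ^ (n + 1)) < 1 ∧ 1 * (c * q ^ (n + 1)) < 1) ∧
      b / c * (a * q ^ (n + 1)) < 1 ∧ b / c * (c * q ^ (n + 1)) < 1 := by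
  have hp := pow_pos h.q_pos (n + 1)
  have h1 := h.a_pos
  have h2 := h.c_neg
  refine ⟨⟨?_, ?_⟩, ?_, ?_⟩
  · rw [one_mul]; exact mul_pow_lt_one h.q_pos h.q_lt_one h.aq_lt_one n
  · nlinarith
  · nlinarith [mul_pos h1 hp, h.bc_neg]
  · rw [← mul_assoc, div_mul_cancel₀ _ h2.ne]
    exact mul_pow_lt_one h.q_pos h.q_lt_one h.bq_lt_one n

/-- On the lattice, multiplication by `(x;q)_k ((b/c)x;q)_j` turns the weight with parameters `1,
b/c` into the one with `q^k, (b/c)q^j`, so this is an Andrews–Askey integral again. -/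
theorem jacobiInt_qPochPoly_mul (h : Admissible a b c q) (k j : ℕ) :
    jacobiInt h (qPochPoly 1 q k * qPochPoly (b / c) q j) =
      a * q * (qPochInf q q * qTheta (c / a) q) * qPochInf (a * b * q ^ (j + 2) * q ^ k) q /
      (qPochInf (a * q * q ^ k) q * qPochInf (c * q * q ^ k) q *
        (qPochInf (a * b * q / c * q ^ j) q * qPochInf (b * q * q ^ j) q)) := by
  have hq := h.q_pos
  have hq1 := h.q_lt_one
  have hc := h.c_neg
  have e : jacobiInt h (qPochPoly 1 q k * qPochPoly (b / c) q j) =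
      jackson a c q (askeyWeight a c q (1 * q ^ k) (b / c * q ^ j)) := by
    have hp : ∀ x : ℝ, 1 * x < 1 → b / c * x < 1 →
        askeyWeight a c q 1 (b / c) x * (qPochPoly 1 q k * qPochPoly (b / c) q j).eval x =
        askeyWeight a c q (1 * q ^ k) (b / c * q ^ j) x := by
      intro x h1 h2
      rw [askeyWeight_shift_pow hq hq1 a c _ h1, askeyWeight_comm a c q 1 (b / c * q ^ j),
        askeyWeight_shift_pow hq hq1 a c _ h2, askeyWeight_comm a c q (b / c), eval_mul,
        eval_qPochPoly, eval_qPochPoly]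
      ring
    rw [jacobiInt_apply]
    refine jackson_congr fun n => ⟨?_, ?_⟩
    exacts [hp _ (h.lattice_bounds n).1.1 (h.lattice_bounds n).2.1,
      hp _ (h.lattice_bounds n).1.2 (h.lattice_bounds n).2.2]
  obtain ⟨⟨h1, h2⟩, h3, h4⟩ := h.lattice_bounds 0
  simp only [zero_add, pow_one, ← mul_assoc] at h1 h2 h3 h4
  rw [e, jackson_askeyWeight hq hq1 h.a_pos hc (mul_pow_mul_lt_one hq hq1 h1 k)
    (mul_pow_mul_lt_one hq hq1 h2 k) (mul_pow_mul_lt_one hq hq1 h3 j)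
    (mul_pow_mul_lt_one hq hq1 h4 j)]
  have e1 : a * c * q ^ 2 * (1 * q ^ k) * (b / c * q ^ j) = a * b * q ^ (j + 2) * q ^ k := by
    have := hc.ne; field_simp; ring
  have e2 : a * q * (b / c * q ^ j) = a * b * q / c * q ^ j := by ring
  have e3 : c * q * (b / c * q ^ j) = b * q * q ^ j := by have := hc.ne; field_simp
  rw [e1, e2, e3, one_mul]

/-- The factors `(aq;q)_k` and `(cq;q)_k` in the denominators of the coefficients of `P_m` are
absorbed by the evaluated integral. What remains of the `₃φ₂` is a `₂φ₁` at argument `q`. -/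
theorem jacobiInt_jacobiPoly_mul (h : Admissible a b c q) (m j : ℕ) :
    jacobiInt h (jacobiPoly a b c q m * qPochPoly (b / c) q j) =
      a * q * (qPochInf q q * qTheta (c / a) q) * qPochInf (a * b * q ^ (j + 2)) q /
      (qPochInf (a * q) q * qPochInf (c * q) q *
        (qPochInf (a * b * q / c * q ^ j) q * qPochInf (b * q * q ^ j) q)) *
      vandermondeSum q m (a * b * q ^ (m + 1)) (a * b * q ^ (j + 2)) := by
  have hq := h.q_pos
  have hq1 := h.q_lt_one
  rw [jacobiPoly, Finset.sum_mul, map_sum, vandermondeSum, Finset.mul_sum]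
  refine Finset.sum_congr rfl fun k _ => ?_
  rw [mul_assoc, C_mul', map_smul, smul_eq_mul, h.jacobiInt_qPochPoly_mul, jacobiCoeff,
    qPochInf_eq_mul hq hq1 (a * b * q ^ (j + 2)) k, qPochInf_eq_mul hq hq1 (a * q) k,
    qPochInf_eq_mul hq hq1 (c * q) k]
  have h1 := (qPoch_pos hq hq1 (h.ab_mul_pow_lt_one (j := j + 2) (by omega)) k).ne'
  have h2 := (qPoch_pos hq hq1 h.aq_lt_one k).ne'
  have h3 := (qPoch_pos hq hq1 h.cq_lt_one k).ne'
  generalize qPoch (a * b * q ^ (j + 2)) q k = y at h1 ⊢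
  generalize qPochInf (a * b * q / c * q ^ j) q * qPochInf (b * q * q ^ j) q = D
  generalize a * q * (qPochInf q q * qTheta (c / a) q) = Z
  simp only [div_eq_mul_inv, mul_inv]
  generalize qPochInf (a * b * q ^ (j + 2) * q ^ k) q = I
  -- One side contains `y * y⁻¹`, which `ring` does not cancel, so the same product is inserted on
  -- the other side.
  calc _ = _ * 1 := (mul_one _).symm
    _ = _ * (y * y⁻¹) := by rw [mul_inv_cancel₀ h1]
    _ = _ := by ring

/-- By Vandermonde the value contains `(q^(j+1-m);q)_m`, whose factor with index `m - 1 - j` is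
zero. -/
theorem jacobiInt_eq_zero_of_lt (h : Admissible a b c q) {m j : ℕ} (hj : j < m) :
    jacobiInt h (jacobiPoly a b c q m * qPochPoly (b / c) q j) = 0 := by
  have hab := h.ab_pos.ne'
  have hq0 := h.q_pos.ne'
  rw [h.jacobiInt_jacobiPoly_mul, vandermondeSum_eq h.q_pos h.q_lt_one _
    (mul_ne_zero hab (pow_ne_zero _ hq0)) (h.ab_mul_pow_lt_one (by omega)),
    qPoch_eq_zero (i := m - 1 - j) (by omega)]
  · simp
  · rw [mul_div_mul_left _ _ hab, div_mul_eq_mul_div, ← pow_add,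
      show j + 2 + (m - 1 - j) = m + 1 by omega, div_self (pow_ne_zero _ hq0)]

theorem jacobiInt_eq_zero_of_degree_lt (h : Admissible a b c q) {m : ℕ} {p : ℝ[X]}
    (hp : p.degree < m) : jacobiInt h (jacobiPoly a b c q m * p) = 0 := by
  have hspan := h.companionSeq.span_degreeLT (m := m)
    fun i _ => (leadingCoeff_ne_zero.2 (h.companionSeq.ne_zero i)).isUnit
  rw [← mem_degreeLT, ← hspan] at hp
  induction hp using Submodule.span_induction with
  | mem x hx =>
    obtain ⟨j, hj, rfl⟩ := hx
    exact h.jacobiInt_eq_zero_of_lt hj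
  | zero => simp
  | add x y _ _ hx hy => rw [mul_add, map_add, hx, hy, add_zero]
  | smul r x _ hx => rw [mul_smul_comm, map_smul, hx, smul_zero]

theorem jacobiInt_orthogonal (h : Admissible a b c q) {m n : ℕ} (hmn : m ≠ n) :
    jacobiInt h (jacobiPoly a b c q m * jacobiPoly a b c q n) = 0 := by
  rcases lt_or_gt_of_ne hmn with hlt | hlt
  · rw [mul_comm]
    exact h.jacobiInt_eq_zero_of_degree_lt (by rw [h.degree_jacobiPoly]; exact_mod_cast hlt)
  · exact h.jacobiInt_eq_zero_of_degree_lt (by rw [h.degree_jacobiPoly]; exact_mod_cast hlt)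

/-- One factor `P_m` may be replaced by its leading term in the basis `((b/c)x;q)_j`, since the rest
has smaller degree and is orthogonal to `P_m`. The Vandermonde sum then has `C/B = q`. -/
theorem jacobiInt_self (h : Admissible a b c q) (m : ℕ) :
    jacobiInt h (jacobiPoly a b c q m * jacobiPoly a b c q m) =
      jacobiCoeff a b c q m m * (c / b) ^ m *
        (a * q * (qPochInf q q * qTheta (c / a) q) * qPochInf (a * b * q ^ (m + 2)) q /
      (qPochInf (a * q) q * qPochInf (c * q) q *
        (qPochInf (a * b * q / c * q ^ m) q * qPochInf (b * q * q ^ m) q)) *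
      (qPoch q q m / qPoch (a * b * q ^ (m + 2)) q m * (a * b * q ^ (m + 1)) ^ m)) := by
  have hab := h.ab_pos.ne'
  have hq0 := h.q_pos.ne'
  have h1 := h.jacobiInt_eq_zero_of_degree_lt (h.degree_jacobiPoly_sub m)
  rw [mul_sub, map_sub, sub_eq_zero] at h1
  rw [h1, mul_left_comm, C_mul', map_smul, smul_eq_mul, h.jacobiInt_jacobiPoly_mul,
    vandermondeSum_eq h.q_pos h.q_lt_one _
    (mul_ne_zero hab (pow_ne_zero _ hq0)) (h.ab_mul_pow_lt_one (by omega))]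
  rw [show a * b * q ^ (m + 2) / (a * b * q ^ (m + 1)) = q by
    rw [mul_div_mul_left _ _ hab, pow_succ q (m + 1)]; field_simp]

/-- Both sides are the product of `1 - abq^i` over `2 ≤ i ≤ 2m + 1`. This brings the cancelled form
of `v` into the norm computation without assuming `abq ≠ 1`. -/
theorem vFactor_mul (h : Admissible a b c q) (m : ℕ) :
    vFactor m (a * b) q * qPoch (a * b * q ^ (m + 1)) q m =
      qPoch (a * b * q ^ 2) q m * qPoch (a * b * q ^ (m + 2)) q m := by
  rcases m with _ | m
  · simp [vFactor, qPoch]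
  · have h1 : 1 - a * b * q ^ (m + 2) ≠ 0 := by
      have := h.ab_mul_pow_lt_one (j := m + 2) (by omega)
      linarith
    simp only [vFactor, Nat.succ_ne_zero, if_false, Nat.add_sub_cancel]
    rw [qPoch_succ' (a * b * q ^ (m + 1 + 1)), qPoch_succ (a * b * q ^ 2),
      qPoch_succ (a * b * q ^ (m + 1 + 2))]
    rw [show a * b * q ^ (m + 1 + 1) * q = a * b * q ^ (m + 1 + 2) by ring]
    ring

end Admissible

end Jacobi

/-! ### The weight `v` as reciprocal squared norm -/

section Norm

variable {a b c q : ℝ}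

theorem rpow_neg_choose_two (hq : 0 < q) (m : ℕ) :
    q ^ (-(1 / 2 : ℝ) * m * (m - 1)) = (q ^ m.choose 2)⁻¹ := by
  rw [← Real.rpow_natCast q (m.choose 2), ← Real.rpow_neg hq.le, Nat.cast_choose_two]
  congr 1; ring

theorem succ_choose_two (m : ℕ) : (m + 1).choose 2 = m + m.choose 2 := by
  rw [Nat.choose_succ_succ m 1, Nat.choose_one_right]

theorem two_mul_choose_two (m : ℕ) : m * m = m + 2 * m.choose 2 := by
  induction m with
  | zero => simp
  | succ m ih => rw [succ_choose_two]; linarith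

namespace Admissible

theorem lt_one_of_neg_div (h : Admissible a b c q) : a * b * q / c < 1 :=
  (div_neg_of_pos_of_neg (mul_pos h.ab_pos h.q_pos) h.c_neg).trans one_pos

/-- Collects all signs and pure powers from the norm and from `v`; it rests on `m² = C(m+1,2) +
C(m,2)`. -/
theorem norm_power_identity (h : Admissible a b c q) (m : ℕ) :
    (-1) ^ m * (q ^ (m + 1).choose 2)⁻¹ * q ^ m * (c / b) ^ m * (a * b * q ^ (m + 1)) ^ m *
      ((-(a * c * q ^ 2)) ^ m)⁻¹ * (q ^ m.choose 2)⁻¹ = 1 := by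
  have hq0 := h.q_pos.ne'
  have ha := h.a_pos.ne'
  have hb := h.b_pos.ne'
  have hc := h.c_neg.ne
  have e1 : c / b * (a * b * q ^ (m + 1)) * (-(a * c * q ^ 2))⁻¹ * (-1) * q = q ^ m := by
    field_simp
    ring
  have e2 : (q ^ m) ^ m = q ^ (m + 1).choose 2 * q ^ m.choose 2 := by
    rw [← pow_mul, two_mul_choose_two, succ_choose_two, ← pow_add]
    congr 1; ring
  calc _ = (c / b * (a * b * q ^ (m + 1)) * (-(a * c * q ^ 2))⁻¹ * (-1) * q) ^ m *
        (q ^ (m + 1).choose 2 * q ^ m.choose 2)⁻¹ := by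
        simp only [mul_pow, inv_pow, mul_inv]; ring
    _ = 1 := by
      rw [e1, e2]
      exact mul_inv_cancel₀ (mul_ne_zero (pow_ne_zero _ hq0) (pow_ne_zero _ hq0))

theorem jacobiInt_self_mul_vWeight (h : Admissible a b c q) (m : ℕ) :
    jacobiInt h (jacobiPoly a b c q m * jacobiPoly a b c q m) * vWeight m a b c q = 1 := by
  have hq := h.q_pos
  have hq1 := h.q_lt_one
  have hca : c / a < 0 := div_neg_of_neg_of_pos h.c_neg h.a_pos
  have hlt : a * b * q ^ (m + 2) < 1 := h.ab_mul_pow_lt_one (by omega)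
  have hlt2 : a * b * q ^ 2 < 1 := h.ab_mul_pow_lt_one le_rfl
  have hθ : qTheta (c / a) q ≠ 0 :=
    mul_ne_zero (qPochInf_ne_zero hq hq1 (hca.trans one_pos))
      (qPochInf_ne_zero hq hq1 ((div_neg_of_pos_of_neg hq hca).trans one_pos))
  have h1 := (qPoch_pos hq hq1 hq1 m).ne'
  have h2 := (qPoch_pos hq hq1 h.aq_lt_one m).ne'
  have h3 := (qPoch_pos hq hq1 h.cq_lt_one m).ne'
  have h4 := (qPoch_pos hq hq1 hlt m).ne'
  have h5 := (qPoch_pos hq hq1 hlt2 m).ne'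
  have h6 := (qPoch_pos hq hq1 h.bq_lt_one m).ne'
  have h7 := (qPoch_pos hq hq1 h.lt_one_of_neg_div m).ne'
  have i1 := qPochInf_ne_zero hq hq1 hq1
  have i2 := qPochInf_ne_zero hq hq1 h.aq_lt_one
  have i3 := qPochInf_ne_zero hq hq1 h.cq_lt_one
  have i4 := qPochInf_ne_zero hq hq1 hlt
  have hmul : ∀ x, x < 1 → x * q ^ m < 1 := fun x hx => by
    have := one_sub_mul_pow_pos hq hq1 hx m; linarith
  have i5 := qPochInf_ne_zero hq hq1 (hmul _ h.bq_lt_one)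
  have i6 := qPochInf_ne_zero hq hq1 (hmul _ h.lt_one_of_neg_div)
  have haq : a * q ≠ 0 := (mul_pos h.a_pos hq).ne'
  have hv := h.vFactor_mul m
  have hp := h.norm_power_identity m
  rw [h.jacobiInt_self, vWeight, jacobiCoeff, qPoch_inv_pow_self hq.ne', rpow_neg_choose_two hq,
    qPochInf_eq_mul hq hq1 (b * q) m, qPochInf_eq_mul hq hq1 (a * b * q / c) m,
    qPochInf_eq_mul hq hq1 (a * b * q ^ 2) m,
    show a * b * q ^ 2 * q ^ m = a * b * q ^ (m + 2) by ring]
  -- With every factor replaced by an opaque symbol, each one meets its own inverse, apart from the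
  -- powers and the four products combined in `key`.
  generalize qPoch q q m = x1 at *
  generalize qPoch (a * q) q m = x2 at *
  generalize qPoch (c * q) q m = x3 at *
  generalize qPoch (a * b * q ^ (m + 2)) q m = x4 at *
  generalize qPoch (a * b * q ^ 2) q m = x5 at *
  generalize qPoch (b * q) q m = x6 at *
  generalize qPoch (a * b * q / c) q m = x7 at *
  generalize qPoch (a * b * q ^ (m + 1)) q m = x8 at *
  generalize qPochInf q q = y1 at *
  generalize qPochInf (a * q) q = y2 at *
  generalize qPochInf (c * q) q = y3 at *
  generalize qPochInf (a * b * q ^ (m + 2)) q = y4 at *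
  generalize qPochInf (b * q * q ^ m) q = y5 at *
  generalize qPochInf (a * b * q / c * q ^ m) q = y6 at *
  generalize qTheta (c / a) q = t at *
  generalize vFactor m (a * b) q = f at *
  generalize a * q = r at *
  generalize ((-1 : ℝ)) ^ m = p1 at *
  generalize (q ^ (m + 1).choose 2)⁻¹ = p2 at *
  generalize q ^ m = p3 at *
  generalize (c / b) ^ m = p4 at *
  generalize (a * b * q ^ (m + 1)) ^ m = p5 at *
  generalize ((-(a * c * q ^ 2)) ^ m)⁻¹ = p6 at *
  generalize (q ^ m.choose 2)⁻¹ = p7 at *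
  have key : (p1 * p2 * p3 * p4 * p5 * p6 * p7) * (f * x8 / (x5 * x4)) = 1 := by
    rw [hp, hv, one_mul]; exact div_self (mul_ne_zero h5 h4)
  have inv : ∀ z : ℝ, z ≠ 0 → z * z⁻¹ = 1 := fun z hz => mul_inv_cancel₀ hz
  simp only [div_eq_mul_inv, mul_inv] at key ⊢
  calc _ = p1 * p2 * p3 * p4 * p5 * p6 * p7 * (f * x8 * (x5⁻¹ * x4⁻¹)) *
        ((x1 * x1⁻¹) * (x1 * x1⁻¹) * (x2 * x2⁻¹) * (x3 * x3⁻¹) * (x6 * x6⁻¹) * (x7 * x7⁻¹)) *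
        ((y1 * y1⁻¹) * (y2 * y2⁻¹) * (y3 * y3⁻¹) * (y4 * y4⁻¹) * (y5 * y5⁻¹) * (y6 * y6⁻¹) *
          (t * t⁻¹) * (r * r⁻¹)) := by ring
    _ = 1 := by
      rw [key, inv x1 h1, inv x2 h2, inv x3 h3, inv x6 h6, inv x7 h7, inv y1 i1, inv y2 i2,
        inv y3 i3, inv y4 i4, inv y5 i5, inv y6 i6, inv t hθ, inv r haq]
      norm_num

end Admissible

end Norm

/-! ### Determinacy of point masses by their moments -/

section Moments

/-- A summable family of point masses on a bounded set, all of whose moments vanish, has no mass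
at isolated points. -/
theorem eq_zero_of_moments_eq_zero {ι : Type*} {pt : ι → ℝ} {α β : ℝ}
    (hpt : ∀ i, pt i ∈ Set.Icc α β) {h : ι → ℂ} (hh : Summable fun i => ‖h i‖)
    (hmom : ∀ p : ℝ[X], ∑' i, h i * ((p.eval (pt i) : ℝ) : ℂ) = 0) {i₀ : ι} {δ : ℝ}
    (hδ : 0 < δ) (hiso : ∀ j, j ≠ i₀ → δ ≤ |pt j - pt i₀|) : h i₀ = 0 := by
  -- A tent of half-width `δ` separates the isolated point from all others, so integrating it
  -- returns exactly `h i₀`; polynomials approximate it uniformly and integrate to `0`.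
  set f : ℝ → ℝ := fun x => max 0 (1 - |x - pt i₀| / δ) with hf
  have hfc : Continuous f := by fun_prop
  have hf0 : f (pt i₀) = 1 := by simp [hf]
  have hfj : ∀ j, j ≠ i₀ → f (pt j) = 0 := by
    intro j hj
    have : 1 ≤ |pt j - pt i₀| / δ := (one_le_div hδ).2 (hiso j hj)
    simp only [hf]
    exact max_eq_left (by linarith)
  have hsum : ∑' i, h i * ((f (pt i) : ℝ) : ℂ) = h i₀ := by
    rw [tsum_eq_single i₀ fun j hj => by rw [hfj j hj]; simp, hf0]; simp
  rw [← hsum, ← norm_le_zero_iff]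
  refine le_of_forall_pos_le_add fun ε hε => ?_
  set S := ∑' i, ‖h i‖ with hS
  have hS0 : 0 ≤ S := tsum_nonneg fun _ => norm_nonneg _
  obtain ⟨p, hp⟩ := exists_polynomial_near_of_continuousOn α β f hfc.continuousOn
    (ε / (S + 1)) (by positivity)
  have hbdd : ∀ g : ℝ → ℝ, Continuous g → Summable fun i => h i * ((g (pt i) : ℝ) : ℂ) := by
    intro g hg
    obtain ⟨C, hC⟩ := isCompact_Icc.exists_bound_of_continuousOn (hg.continuousOn (s := Set.Icc α β))
    refine Summable.of_norm_bounded (hh.mul_right C) fun i => ?_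
    rw [norm_mul, Complex.norm_real]
    exact mul_le_mul_of_nonneg_left (hC _ (hpt i)) (norm_nonneg _)
  have e1 : ∑' i, h i * ((f (pt i) : ℝ) : ℂ) =
      ∑' i, h i * ((f (pt i) - p.eval (pt i) : ℝ) : ℂ) := by
    rw [← sub_zero (∑' i, h i * ((f (pt i) : ℝ) : ℂ)), ← hmom p,
      ← (hbdd f hfc).tsum_sub (hbdd _ p.continuous)]
    exact tsum_congr fun i => by push_cast; ring
  have hle : ∀ i, ‖h i * ((f (pt i) - p.eval (pt i) : ℝ) : ℂ)‖ ≤ ‖h i‖ * (ε / (S + 1)) := by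
    intro i
    rw [norm_mul, Complex.norm_real, Real.norm_eq_abs, abs_sub_comm]
    exact mul_le_mul_of_nonneg_left (hp _ (hpt i)).le (norm_nonneg _)
  rw [e1, zero_add]
  refine (tsum_of_norm_bounded (hh.mul_right _).hasSum hle).trans ?_
  rw [tsum_mul_right, ← hS, ← mul_div_assoc, div_le_iff₀ (by positivity)]
  nlinarith

/-- The nearest neighbour of `sq^(n+1)` on its half of the lattice is `sq^(n+2)`. -/
theorem abs_sub_pow_succ_ge {q : ℝ} (hq : 0 < q) (hq1 : q < 1) (s : ℝ) {j n : ℕ} (hj : j ≠ n) :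
    |s| * q ^ (n + 1) * (1 - q) ≤ |s * q ^ (j + 1) - s * q ^ (n + 1)| := by
  rw [← mul_sub, abs_mul, mul_assoc]
  refine mul_le_mul_of_nonneg_left ?_ (abs_nonneg s)
  rcases lt_or_gt_of_ne hj with h | h
  · have h1 : q ^ n ≤ q ^ (j + 1) := pow_le_pow_of_le_one hq.le hq1.le h
    have h2 : q ^ (n + 1) ≤ q ^ n := pow_le_pow_of_le_one hq.le hq1.le (Nat.le_succ n)
    refine le_trans ?_ (le_abs_self _)
    have h3 : q ^ (n + 1) = q ^ n * q := pow_succ q n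
    nlinarith
  · have h1 : q ^ (j + 1) ≤ q ^ (n + 1) * q := by
      rw [← pow_succ]; exact pow_le_pow_of_le_one hq.le hq1.le (by omega)
    refine le_trans ?_ (neg_le_abs _)
    nlinarith

end Moments

/-! ### The functions `r_x(m)` as a Hilbert basis of `ℓ²` on the lattice -/

section Columns

variable {a b c q : ℝ}

/-- The lattice points `aq^{n+1}` and `cq^{n+1}`. -/
def latticePt (a c q : ℝ) : ℕ ⊕ ℕ → ℝ :=
  Sum.elim (fun n => a * q ^ (n + 1)) fun n => c * q ^ (n + 1)

/-- The masses of the orthogonality measure of the big `q`-Jacobi polynomials. -/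
def latticeWt (a b c q : ℝ) (i : ℕ ⊕ ℕ) : ℝ :=
  |latticePt a c q i| * uWeight (latticePt a c q i) a b c q

/-- The sign `1` on the first and `(-1)^n` on the second half of the lattice. -/
def latticeSign : ℕ ⊕ ℕ → ℝ := Sum.elim (fun _ => 1) fun n => (-1) ^ n

theorem latticeSign_mul_self (i : ℕ ⊕ ℕ) : latticeSign i * latticeSign i = 1 := by
  rcases i with n | n
  · simp [latticeSign]
  · simp [latticeSign, ← mul_pow]

/-- The signed functions `r_x(m)` on the lattice, for fixed `m`. -/
def jacobiCol (a b c q : ℝ) (m : ℕ) (i : ℕ ⊕ ℕ) : ℝ :=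
  latticeSign i * rFun (latticePt a c q i) m a b c q

theorem uWeight_eq (a b c q x : ℝ) : uWeight x a b c q = askeyWeight a c q 1 (b / c) x := by
  rw [uWeight, askeyWeight, one_mul, mul_div_right_comm b]

namespace Admissible

theorem uWeight_pos (h : Admissible a b c q) (i : ℕ ⊕ ℕ) :
    0 < uWeight (latticePt a c q i) a b c q := by
  have hq := h.q_pos
  have hq1 := h.q_lt_one
  have hpow : ∀ n : ℕ, 0 < q ^ (n + 1) ∧ q ^ (n + 1) < 1 := fun n =>
    ⟨pow_pos hq _, pow_lt_one₀ hq.le hq1 (by simp)⟩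
  have hca : c / a < 0 := div_neg_of_neg_of_pos h.c_neg h.a_pos
  have hac : a / c < 0 := div_neg_of_pos_of_neg h.a_pos h.c_neg
  have key : ∀ x : ℝ, x / a < 1 → x / c < 1 → 1 * x < 1 → b / c * x < 1 →
      0 < uWeight x a b c q := by
    intro x h1 h2 h3 h4
    rw [uWeight_eq, askeyWeight]
    have := qPochInf_pos hq hq1 h1
    have := qPochInf_pos hq hq1 h2
    have := qPochInf_pos hq hq1 h3
    have := qPochInf_pos hq hq1 h4
    positivity
  rcases i with n | n
  · refine key _ ?_ ?_ (h.lattice_bounds n).1.1 (h.lattice_bounds n).2.1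
    · simp only [latticePt, Sum.elim_inl]
      rw [mul_div_right_comm, div_self h.a_pos.ne', one_mul]; exact (hpow n).2
    · simp only [latticePt, Sum.elim_inl]
      rw [mul_div_right_comm]; nlinarith [hpow n]
  · refine key _ ?_ ?_ (h.lattice_bounds n).1.2 (h.lattice_bounds n).2.2
    · simp only [latticePt, Sum.elim_inr]
      rw [mul_div_right_comm]; nlinarith [hpow n]
    · simp only [latticePt, Sum.elim_inr]
      rw [mul_div_right_comm, div_self h.c_neg.ne, one_mul]; exact (hpow n).2

theorem latticePt_ne_zero (h : Admissible a b c q) (i : ℕ ⊕ ℕ) : latticePt a c q i ≠ 0 := by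
  rcases i with n | n
  · exact mul_ne_zero h.a_pos.ne' (pow_ne_zero _ h.q_pos.ne')
  · exact mul_ne_zero h.c_neg.ne (pow_ne_zero _ h.q_pos.ne')

theorem latticeWt_pos (h : Admissible a b c q) (i : ℕ ⊕ ℕ) : 0 < latticeWt a b c q i :=
  mul_pos (abs_pos.2 (h.latticePt_ne_zero i)) (h.uWeight_pos i)

/-- The minus sign in the Jackson integral turns the negative points `cq^(n+1)` into their absolute
values, so the integral is one against positive masses. -/
theorem hasSum_latticeWt_mul_eval (h : Admissible a b c q) (p : ℝ[X]) :
    HasSum (fun i => latticeWt a b c q i * p.eval (latticePt a c q i)) (jacobiInt h p) := by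
  have hq := h.q_pos
  have hq1 := h.q_lt_one
  have hcont : ContinuousAt (fun x => askeyWeight a c q 1 (b / c) x * p.eval x) 0 :=
    (continuousAt_askeyWeight hq hq1 a c 1 (b / c)).mul p.continuousAt
  have h1 := (summable_jackson_side hq hq1 hcont a)
  have h2 := (summable_jackson_side hq hq1 hcont c)
  rw [jacobiInt_apply, jackson, h1.tsum_sub h2, sub_eq_add_neg]
  refine HasSum.sum (h1.hasSum.congr_fun ?_) (h2.hasSum.neg.congr_fun ?_)
  · intro n
    have : 0 < a * q ^ (n + 1) := mul_pos h.a_pos (pow_pos hq _)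
    simp only [Function.comp_apply, latticeWt, latticePt, Sum.elim_inl, abs_of_pos this,
      uWeight_eq]
    ring
  · intro n
    have : c * q ^ (n + 1) < 0 := mul_neg_of_neg_of_pos h.c_neg (pow_pos hq _)
    simp only [Function.comp_apply, latticeWt, latticePt, Sum.elim_inr, abs_of_neg this,
      uWeight_eq]
    ring

/-- No sign analysis of the explicit formula is needed: the squared norm is nonnegative and its
product with `v` is `1`. -/
theorem vWeight_pos (h : Admissible a b c q) (m : ℕ) : 0 < vWeight m a b c q := by
  have h1 := h.jacobiInt_self_mul_vWeight m
  have h2 : 0 ≤ jacobiInt h (jacobiPoly a b c q m * jacobiPoly a b c q m) := by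
    refine (h.hasSum_latticeWt_mul_eval _).nonneg fun i => ?_
    rw [eval_mul]
    exact mul_nonneg (h.latticeWt_pos i).le (mul_self_nonneg _)
  by_contra hv
  nlinarith [mul_nonneg h2 (neg_nonneg.2 (not_lt.1 hv))]

theorem rFun_eq (h : Admissible a b c q) (m : ℕ) (i : ℕ ⊕ ℕ) :
    rFun (latticePt a c q i) m a b c q =
      √(latticeWt a b c q i) * √(vWeight m a b c q) *
        (jacobiPoly a b c q m).eval (latticePt a c q i) := by
  rw [rFun, eval_jacobiPoly h.q_pos.ne', ← Real.sqrt_mul (h.latticeWt_pos i).le, latticeWt]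

theorem hasSum_jacobiCol_mul (h : Admissible a b c q) (m n : ℕ) :
    HasSum (fun i => jacobiCol a b c q m i * jacobiCol a b c q n i) (if m = n then 1 else 0) := by
  have h1 := (h.hasSum_latticeWt_mul_eval (jacobiPoly a b c q m * jacobiPoly a b c q n)).mul_left
    (√(vWeight m a b c q) * √(vWeight n a b c q))
  have e : √(vWeight m a b c q) * √(vWeight n a b c q) *
      jacobiInt h (jacobiPoly a b c q m * jacobiPoly a b c q n) = if m = n then 1 else 0 := by
    split_ifs with hmn
    · subst hmn
      rw [Real.mul_self_sqrt (h.vWeight_pos m).le, mul_comm, h.jacobiInt_self_mul_vWeight]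
    · rw [h.jacobiInt_orthogonal hmn, mul_zero]
  rw [← e]
  refine h1.congr_fun fun i => ?_
  rw [jacobiCol, jacobiCol, h.rFun_eq, h.rFun_eq, eval_mul]
  have h2 := Real.mul_self_sqrt (h.latticeWt_pos i).le
  calc _ = (latticeSign i * latticeSign i) *
        (√(latticeWt a b c q i) * √(latticeWt a b c q i)) *
        (√(vWeight m a b c q) * √(vWeight n a b c q)) *
        ((jacobiPoly a b c q m).eval (latticePt a c q i) *
          (jacobiPoly a b c q n).eval (latticePt a c q i)) := by ring
    _ = _ := by rw [h2, latticeSign_mul_self]; ring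

theorem memℓp_jacobiCol (h : Admissible a b c q) (m : ℕ) :
    Memℓp (fun i : ℕ ⊕ ℕ => ((jacobiCol a b c q m i : ℝ) : ℂ)) 2 := by
  refine memℓp_gen ?_
  have := (h.hasSum_jacobiCol_mul m m).summable
  refine this.congr fun i => ?_
  rw [Complex.norm_real, ENNReal.toReal_ofNat, Real.rpow_two, Real.norm_eq_abs, sq_abs, sq]

/-- The columns as vectors of `ℓ²`. -/
def colVec (h : Admissible a b c q) (m : ℕ) : lp (fun _ : ℕ ⊕ ℕ => ℂ) 2 :=
  ⟨fun i => ((jacobiCol a b c q m i : ℝ) : ℂ), h.memℓp_jacobiCol m⟩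

theorem colVec_apply (h : Admissible a b c q) (m : ℕ) (i : ℕ ⊕ ℕ) :
    h.colVec m i = ((jacobiCol a b c q m i : ℝ) : ℂ) := rfl

theorem orthonormal_colVec (h : Admissible a b c q) : Orthonormal ℂ h.colVec := by
  classical
  rw [orthonormal_iff_ite]
  intro m n
  rw [lp.inner_eq_tsum]
  have h1 := Complex.hasSum_ofReal.2 (h.hasSum_jacobiCol_mul m n)
  have h2 : ((if m = n then 1 else 0 : ℝ) : ℂ) = if m = n then 1 else 0 := by
    split_ifs <;> simp
  rw [← h2, ← h1.tsum_eq]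
  refine tsum_congr fun i => ?_
  rw [colVec_apply, colVec_apply, RCLike.inner_apply, Complex.conj_ofReal, mul_comm]
  push_cast; rfl

theorem latticePt_mem_Icc (h : Admissible a b c q) (i : ℕ ⊕ ℕ) :
    latticePt a c q i ∈ Set.Icc c a := by
  have ha := h.a_pos
  have hc := h.c_neg
  rcases i with n | n
  all_goals
    have h1 : 0 < q ^ (n + 1) := pow_pos h.q_pos _
    have h2 : q ^ (n + 1) ≤ 1 := pow_le_one₀ h.q_pos.le h.q_lt_one.le
    simp only [latticePt, Sum.elim_inl, Sum.elim_inr, Set.mem_Icc]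
    constructor <;> nlinarith

/-- The gap `δ` depends on the point and shrinks towards `0`. Points on the opposite half are
farther than the distance to `0`, which exceeds the gap within the same half. -/
theorem latticePt_isolated (h : Admissible a b c q) (i : ℕ ⊕ ℕ) :
    ∃ δ > 0, ∀ j, j ≠ i → δ ≤ |latticePt a c q j - latticePt a c q i| := by
  have hq := h.q_pos
  have hq1 : 0 < 1 - q := sub_pos.2 h.q_lt_one
  have hsep : ∀ m n : ℕ, |a| * q ^ (m + 1) ≤ |a * q ^ (m + 1) - c * q ^ (n + 1)| ∧
      |c| * q ^ (n + 1) ≤ |a * q ^ (m + 1) - c * q ^ (n + 1)| := by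
    intro m n
    have h1 := mul_pos h.a_pos (pow_pos hq (m + 1))
    have h2 := mul_pos (neg_pos.2 h.c_neg) (pow_pos hq (n + 1))
    rw [abs_of_pos h.a_pos, abs_of_neg h.c_neg]
    constructor <;> exact le_trans (by linarith) (le_abs_self _)
  rcases i with n | n
  · have ha := abs_pos.2 h.a_pos.ne'
    refine ⟨|a| * q ^ (n + 1) * (1 - q), by positivity, ?_⟩
    rintro (j | j) hj
    · exact abs_sub_pow_succ_ge hq h.q_lt_one a fun e => hj (by rw [e])
    · simp only [latticePt, Sum.elim_inl, Sum.elim_inr]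
      rw [abs_sub_comm]
      refine le_trans ?_ (hsep n j).1
      exact mul_le_of_le_one_right (by positivity) (by linarith)
  · have hc := abs_pos.2 h.c_neg.ne
    refine ⟨|c| * q ^ (n + 1) * (1 - q), by positivity, ?_⟩
    rintro (j | j) hj
    · simp only [latticePt, Sum.elim_inl, Sum.elim_inr]
      refine le_trans ?_ (hsep j n).2
      exact mul_le_of_le_one_right (by positivity) (by linarith)
    · exact abs_sub_pow_succ_ge hq h.q_lt_one c fun e => hj (by rw [e])

/-- Completeness of the big `q`-Jacobi polynomials. -/
theorem eq_zero_of_inner_colVec (h : Admissible a b c q) (g : lp (fun _ : ℕ ⊕ ℕ => ℂ) 2)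
    (hg : ∀ m, inner ℂ (h.colVec m) g = 0) : g = 0 := by
  -- Every column is `s` times a polynomial, up to a constant. The orthogonality relations thus say
  -- that the masses `s i * g i`, summable by Hölder because the total mass is finite, have
  -- vanishing moments.
  set s : ℕ ⊕ ℕ → ℝ := fun i => latticeSign i * √(latticeWt a b c q i) with hs
  have hs0 : ∀ i, s i ≠ 0 := fun i =>
    mul_ne_zero (left_ne_zero_of_mul_eq_one (latticeSign_mul_self i))
      (Real.sqrt_pos.2 (h.latticeWt_pos i)).ne'
  have hsmem : Memℓp (fun i => (s i : ℂ)) 2 := by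
    refine memℓp_gen ?_
    refine (h.hasSum_latticeWt_mul_eval 1).summable.congr fun i => ?_
    rw [Complex.norm_real, ENNReal.toReal_ofNat, Real.rpow_two, Real.norm_eq_abs, sq_abs, sq,
      mul_mul_mul_comm, latticeSign_mul_self, Real.mul_self_sqrt (h.latticeWt_pos i).le, eval_one]
    ring
  have hsum : Summable fun i => ‖(s i : ℂ) * g i‖ := by
    have := lp.summable_mul (p := 2) (q := 2) (by rw [Real.holderConjugate_iff]; norm_num)
      (⟨fun i => (s i : ℂ), hsmem⟩ : lp (fun _ : ℕ ⊕ ℕ => ℂ) 2) g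
    exact this.congr fun i => (norm_mul _ _).symm
  have hbound : ∀ p : ℝ[X], Summable fun i =>
      (s i : ℂ) * g i * ((p.eval (latticePt a c q i) : ℝ) : ℂ) := by
    intro p
    obtain ⟨C, hC⟩ := isCompact_Icc.exists_bound_of_continuousOn
      (p.continuous.continuousOn (s := Set.Icc c a))
    refine Summable.of_norm_bounded (hsum.mul_right C) fun i => ?_
    rw [norm_mul, Complex.norm_real]
    exact mul_le_mul_of_nonneg_left (hC _ (h.latticePt_mem_Icc i)) (norm_nonneg _)
  have hmom : ∀ p : ℝ[X],
      ∑' i, (s i : ℂ) * g i * ((p.eval (latticePt a c q i) : ℝ) : ℂ) = 0 := by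
    intro p
    have hp : p ∈ Submodule.span ℝ (Set.range (jacobiPoly a b c q)) := by
      rw [h.span_jacobiPoly]; trivial
    induction hp using Submodule.span_induction with
    | mem x hx =>
      obtain ⟨m, rfl⟩ := hx
      have h1 := hg m
      have hv : ((√(vWeight m a b c q) : ℝ) : ℂ) ≠ 0 := by
        exact_mod_cast (Real.sqrt_pos.2 (h.vWeight_pos m)).ne'
      rw [lp.inner_eq_tsum] at h1
      apply mul_left_cancel₀ hv
      rw [mul_zero, ← h1, ← tsum_mul_left]
      refine tsum_congr fun i => ?_
      rw [colVec_apply, RCLike.inner_apply, Complex.conj_ofReal, jacobiCol, h.rFun_eq, hs]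
      push_cast; ring
    | zero => simp
    | add x y _ _ hx hy =>
      have := (hbound x).tsum_add (hbound y)
      rw [hx, hy, add_zero] at this
      rw [← this]
      exact tsum_congr fun i => by rw [eval_add]; push_cast; ring
    | smul r x _ hx =>
      have := tsum_mul_left (a := (r : ℂ)) (L := .unconditional _)
        (f := fun i => (s i : ℂ) * g i * ((x.eval (latticePt a c q i) : ℝ) : ℂ))
      rw [hx, mul_zero] at this
      rw [← this]
      exact tsum_congr fun i => by rw [eval_smul, smul_eq_mul]; push_cast; ring
  ext i
  obtain ⟨δ, hδ, hiso⟩ := h.latticePt_isolated i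
  have := eq_zero_of_moments_eq_zero h.latticePt_mem_Icc hsum hmom hδ hiso
  rcases mul_eq_zero.1 this with h1 | h1
  · exact absurd (by exact_mod_cast h1) (hs0 i)
  · rw [h1]; rfl

/-- The columns form a Hilbert basis. -/
def colBasis (h : Admissible a b c q) : HilbertBasis ℕ ℂ (lp (fun _ : ℕ ⊕ ℕ => ℂ) 2) :=
  HilbertBasis.mkOfOrthogonalEqBot h.orthonormal_colVec <| by
    rw [Submodule.eq_bot_iff]
    intro g hg
    exact h.eq_zero_of_inner_colVec g fun m =>
      (Submodule.mem_orthogonal _ g).1 hg _ (Submodule.subset_span ⟨m, rfl⟩)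

/-- The coordinates of a lattice point mass in the basis of columns form a row of the matrix. The
entries are real, so no conjugate appears, and orthonormal complete columns become a unitary map
prescribed on rows. -/
theorem colBasis_repr_single (h : Admissible a b c q) (i : ℕ ⊕ ℕ) (m : ℕ) :
    h.colBasis.repr (lp.single 2 i (1 : ℂ)) m = ((jacobiCol a b c q m i : ℝ) : ℂ) := by
  rw [HilbertBasis.repr_apply_apply, colBasis, HilbertBasis.coe_mkOfOrthogonalEqBot,
    lp.inner_single_right, colVec_apply, RCLike.inner_apply, Complex.conj_ofReal, one_mul]

end Admissible

end Columns

/-! ### The `q`-difference equation and its symmetric form -/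

section Difference

variable {a b c q : ℝ}

/-- The coefficient of `y(qx) - y(x)` in the `q`-difference equation. -/
def raiseCoeff (a b c q x : ℝ) : ℝ := a * q * (1 - x) * (b * x - c) / x ^ 2

/-- The coefficient of `y(x/q) - y(x)` in the `q`-difference equation. -/
def lowerCoeff (a c q x : ℝ) : ℝ := -((x - a * q) * (x - c * q)) / x ^ 2

/-- In the basis `(x;q)_k` the `q`-difference operator is two-term, so its eigenvalue equation is a
first-order recursion for coefficients. At `k = 0` the truncated index `k - 1` is harmless, as `1 -
q^k` vanishes. -/
theorem qPoch_difference (hq : q ≠ 0) (a b c : ℝ) {x : ℝ} (hx : x ≠ 0) (k : ℕ) :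
    raiseCoeff a b c q x * (qPoch (q * x) q k - qPoch x q k) +
      lowerCoeff a c q x * (qPoch (x / q) q k - qPoch x q k) =
    (q ^ k)⁻¹ * (1 - q ^ k) * ((1 - a * q ^ k) * (1 - c * q ^ k) * qPoch x q (k - 1) -
      (1 - a * b * q ^ (k + 1)) * qPoch x q k) := by
  rcases k with _ | k
  · simp [qPoch]
  · have hqk := pow_ne_zero k hq
    have e1 : qPoch (x / q) q (k + 1) = (1 - x / q) * qPoch x q k := by
      rw [qPoch_succ', div_mul_cancel₀ _ hq]
    have e2 : (1 - x) * qPoch (q * x) q k = qPoch x q k * (1 - x * q ^ k) := by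
      rw [mul_comm q x, ← qPoch_succ', qPoch_succ]
    have e3 : raiseCoeff a b c q x * (qPoch (q * x) q (k + 1) - qPoch x q (k + 1)) =
        a * q * (b * x - c) / x ^ 2 * (qPoch x q k * (1 - x * q ^ k)) *
          (x * (1 - q ^ (k + 1))) := by
      rw [qPoch_succ (q * x), qPoch_succ x, raiseCoeff, ← e2]
      ring
    rw [e3, e1, qPoch_succ x, Nat.add_sub_cancel, lowerCoeff, pow_succ q k]
    field_simp
    ring

theorem jacobiCoeff_succ (h : Admissible a b c q) (m k : ℕ) :
    jacobiCoeff a b c q m (k + 1) * ((q ^ (k + 1))⁻¹ * (1 - q ^ (k + 1)) *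
      ((1 - a * q ^ (k + 1)) * (1 - c * q ^ (k + 1)))) =
    jacobiCoeff a b c q m k *
      ((q ^ k)⁻¹ * (1 - q ^ k) * (1 - a * b * q ^ (k + 1)) -
        (q ^ m)⁻¹ * (1 - q ^ m) * (1 - a * b * q ^ (m + 1))) := by
  have hq := h.q_pos
  have hq1 := h.q_lt_one
  have h1 := (qPoch_pos hq hq1 hq1 k).ne'
  have h2 := (qPoch_pos hq hq1 h.aq_lt_one k).ne'
  have h3 := (qPoch_pos hq hq1 h.cq_lt_one k).ne'
  have i1 := (one_sub_mul_pow_pos hq hq1 hq1 k).ne'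
  have i2 := (one_sub_mul_pow_pos hq hq1 h.aq_lt_one k).ne'
  have i3 := (one_sub_mul_pow_pos hq hq1 h.cq_lt_one k).ne'
  have hk := pow_ne_zero k hq.ne'
  have hm := pow_ne_zero m hq.ne'
  have hq0 := hq.ne'
  rw [jacobiCoeff, jacobiCoeff, qPoch_succ, qPoch_succ, qPoch_succ, qPoch_succ, qPoch_succ]
  rw [show 1 - q ^ (k + 1) = 1 - q * q ^ k by ring,
    show 1 - a * q ^ (k + 1) = 1 - a * q * q ^ k by ring,
    show 1 - c * q ^ (k + 1) = 1 - c * q * q ^ k by ring]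
  generalize qPoch (a * q) q k = y2 at *
  generalize qPoch (c * q) q k = y3 at *
  generalize qPoch q q k = y1 at *
  generalize qPoch (q ^ m)⁻¹ q k = y4 at *
  generalize qPoch (a * b * q ^ (m + 1)) q k = y5 at *
  generalize hz1 : 1 - q * q ^ k = z1 at *
  generalize hz2 : 1 - a * q * q ^ k = z2 at *
  generalize hz3 : 1 - c * q * q ^ k = z3 at *
  rw [pow_succ q k, pow_succ q m]
  field_simp
  ring

/-- The `q`-difference equation of the big `q`-Jacobi polynomials. -/
theorem jacobiPoly_difference (h : Admissible a b c q) (m : ℕ) {x : ℝ} (hx : x ≠ 0) :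
    raiseCoeff a b c q x * ((jacobiPoly a b c q m).eval (q * x) -
        (jacobiPoly a b c q m).eval x) +
      lowerCoeff a c q x * ((jacobiPoly a b c q m).eval (x / q) -
        (jacobiPoly a b c q m).eval x) =
    -((q ^ m)⁻¹ * (1 - q ^ m) * (1 - a * b * q ^ (m + 1))) *
      (jacobiPoly a b c q m).eval x := by
  have hq0 := h.q_pos.ne'
  simp only [eval_jacobiPoly_eq_sum, ← Finset.sum_sub_distrib, Finset.mul_sum,
    ← Finset.sum_add_distrib]
  set D : ℕ → ℝ := fun k => (q ^ k)⁻¹ * (1 - q ^ k) * ((1 - a * q ^ k) * (1 - c * q ^ k)) with hD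
  set L : ℕ → ℝ := fun k => (q ^ k)⁻¹ * (1 - q ^ k) * (1 - a * b * q ^ (k + 1)) with hL
  set J := jacobiCoeff a b c q m with hJ
  have e1 : ∀ k, raiseCoeff a b c q x * (J k * qPoch (q * x) q k - J k * qPoch x q k) +
      lowerCoeff a c q x * (J k * qPoch (x / q) q k - J k * qPoch x q k) =
      J k * D k * qPoch x q (k - 1) - J k * L k * qPoch x q k := by
    intro k
    have := qPoch_difference hq0 a b c hx k
    simp only [hD, hL]
    linear_combination J k * this
  -- An index shift followed by the coefficient recursion; the boundary terms drop out because `D 0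
  -- = 0` on the left and `L m - L m = 0` on the right.
  have e2 : ∑ k ∈ Finset.range (m + 1), J k * D k * qPoch x q (k - 1) =
      ∑ k ∈ Finset.range (m + 1), J k * (L k - L m) * qPoch x q k := by
    have h0 : D 0 = 0 := by simp [hD]
    have hm : L m - L m = 0 := sub_self _
    rw [Finset.sum_range_succ', Finset.sum_range_succ, h0, hm]
    simp only [mul_zero, zero_mul, add_zero, Nat.add_sub_cancel]
    refine Finset.sum_congr rfl fun k _ => ?_
    rw [hJ, hD, hL, jacobiCoeff_succ h]
  rw [Finset.sum_congr rfl fun k _ => e1 k, Finset.sum_sub_distrib, e2,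
    ← Finset.sum_sub_distrib]
  exact Finset.sum_congr rfl fun k _ => by ring

namespace Admissible

/-- The Pearson equation of the weight: each of its four infinite products loses its first factor
under `x ↦ qx`. -/
theorem uWeight_mul (h : Admissible a b c q) {x : ℝ} (h1 : x < 1) (h2 : b / c * x < 1) :
    uWeight (q * x) a b c q * ((1 - x / a) * (1 - x / c)) =
      uWeight x a b c q * ((1 - x) * (1 - b / c * x)) := by
  have hq := h.q_pos
  have hq1 := h.q_lt_one
  have i1 : (1 : ℝ) - x ≠ 0 := by linarith
  have i2 : (1 : ℝ) - b / c * x ≠ 0 := by linarith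
  rw [uWeight, uWeight, show q * x / a = x / a * q by ring, show q * x / c = x / c * q by ring,
    show b * (q * x) / c = b / c * x * q by ring, show b * x / c = b / c * x by ring, mul_comm q x,
    qPochInf_eq hq hq1 (x / a), qPochInf_eq hq hq1 (x / c), qPochInf_eq hq hq1 x,
    qPochInf_eq hq hq1 (b / c * x)]
  have hd : ∀ r y z t s : ℝ, y ≠ 0 → z ≠ 0 →
      r / (y * t * (z * s)) * (y * z) = r / (t * s) := by
    intro r y z t s hy hz
    rw [show y * t * (z * s) = (y * z) * (t * s) by ring, ← div_div, div_mul_eq_mul_div,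
      div_mul_cancel₀ _ (mul_ne_zero hy hz)]
  rw [hd _ _ _ _ _ i1 i2]
  ring

theorem latticePt_lt (h : Admissible a b c q) (i : ℕ ⊕ ℕ) :
    latticePt a c q i < 1 ∧ b / c * latticePt a c q i < 1 := by
  rcases i with n | n
  · have := h.lattice_bounds n
    rw [one_mul, one_mul] at this
    exact ⟨this.1.1, this.2.1⟩
  · have := h.lattice_bounds n
    rw [one_mul, one_mul] at this
    exact ⟨this.1.2, this.2.2⟩

theorem raiseCoeff_nonneg (h : Admissible a b c q) (i : ℕ ⊕ ℕ) :
    0 ≤ raiseCoeff a b c q (latticePt a c q i) := by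
  obtain ⟨h1, h2⟩ := h.latticePt_lt i
  set x := latticePt a c q i
  have e : b * x - c = -c * (1 - b / c * x) := by have := h.c_neg.ne; field_simp; ring
  rw [raiseCoeff, e]
  have i1 := sub_pos.2 h1
  have i2 := sub_pos.2 h2
  have i3 := neg_pos.2 h.c_neg
  have := h.a_pos
  have := h.q_pos
  positivity

/-- The detailed balance relation between neighbouring lattice points. -/
theorem latticeWt_balance (h : Admissible a b c q) {i j : ℕ ⊕ ℕ}
    (hij : latticePt a c q j = q * latticePt a c q i) :
    latticeWt a b c q j * lowerCoeff a c q (latticePt a c q j) =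
      latticeWt a b c q i * raiseCoeff a b c q (latticePt a c q i) := by
  obtain ⟨h1, h2⟩ := h.latticePt_lt i
  have hx := h.latticePt_ne_zero i
  rw [latticeWt, latticeWt, hij]
  set x := latticePt a c q i
  have hu := h.uWeight_mul h1 h2
  have hq0 := h.q_pos.ne'
  have ha := h.a_pos.ne'
  have hc := h.c_neg.ne
  have e1 : lowerCoeff a c q (q * x) = -(a * c) / x ^ 2 * ((1 - x / a) * (1 - x / c)) := by
    rw [lowerCoeff]; field_simp; ring
  have e2 : raiseCoeff a b c q x = -(a * c) / x ^ 2 * q * ((1 - x) * (1 - b / c * x)) := by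
    rw [raiseCoeff]; field_simp; ring
  rw [e1, e2, abs_mul, abs_of_pos h.q_pos]
  linear_combination (q * |x| * (-(a * c) / x ^ 2)) * hu

theorem lowerCoeff_nonneg (h : Admissible a b c q) {i j : ℕ ⊕ ℕ}
    (hij : latticePt a c q j = q * latticePt a c q i) :
    0 ≤ lowerCoeff a c q (latticePt a c q j) := by
  have h1 := h.latticeWt_balance hij
  have h2 := mul_nonneg (h.latticeWt_pos i).le (h.raiseCoeff_nonneg i)
  rw [← h1] at h2
  exact nonneg_of_mul_nonneg_right h2 (h.latticeWt_pos j)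

/-- The geometric mean `A` of the two opposite coefficients is the off-diagonal element after
symmetrisation. All quantities are nonnegative, so each identity may be squared, where it reduces to
detailed balance. -/
theorem symm_coeff_mul_sqrt (h : Admissible a b c q) {i j : ℕ ⊕ ℕ}
    (hij : latticePt a c q j = q * latticePt a c q i) {κ A : ℝ} (hκ : 0 ≤ κ) (hA : 0 ≤ A)
    (hA2 : A ^ 2 = κ ^ 2 * (raiseCoeff a b c q (latticePt a c q i) *
      lowerCoeff a c q (latticePt a c q j))) :
    A * √(latticeWt a b c q j) =
        κ * raiseCoeff a b c q (latticePt a c q i) * √(latticeWt a b c q i) ∧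
      A * √(latticeWt a b c q i) =
        κ * lowerCoeff a c q (latticePt a c q j) * √(latticeWt a b c q j) := by
  have h1 := h.latticeWt_balance hij
  have hi := h.latticeWt_pos i
  have hj := h.latticeWt_pos j
  have hr := h.raiseCoeff_nonneg i
  have hl := h.lowerCoeff_nonneg hij
  have si := Real.sq_sqrt hi.le
  have sj := Real.sq_sqrt hj.le
  constructor
  · rw [← sq_eq_sq₀ (by positivity) (by positivity), mul_pow, mul_pow _ (√_), si, sj, hA2]
    linear_combination (κ ^ 2 * raiseCoeff a b c q (latticePt a c q i)) * h1
  · rw [← sq_eq_sq₀ (by positivity) (by positivity), mul_pow, mul_pow _ (√_), si, sj, hA2]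
    linear_combination -(κ ^ 2 * lowerCoeff a c q (latticePt a c q j)) * h1

/-- The symmetrised difference equation at an interior lattice point. -/
theorem rFun_recurrence (h : Admissible a b c q) {i j k : ℕ ⊕ ℕ}
    (hij : latticePt a c q j = q * latticePt a c q i)
    (hjk : latticePt a c q k = q * latticePt a c q j) {κ A B : ℝ} (hκ : 0 ≤ κ) (hA : 0 ≤ A)
    (hB : 0 ≤ B)
    (hA2 : A ^ 2 = κ ^ 2 * (raiseCoeff a b c q (latticePt a c q i) *
      lowerCoeff a c q (latticePt a c q j)))
    (hB2 : B ^ 2 = κ ^ 2 * (raiseCoeff a b c q (latticePt a c q j) *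
      lowerCoeff a c q (latticePt a c q k))) (m : ℕ) :
    A * rFun (latticePt a c q i) m a b c q + B * rFun (latticePt a c q k) m a b c q =
      κ * (raiseCoeff a b c q (latticePt a c q j) + lowerCoeff a c q (latticePt a c q j) -
        (q ^ m)⁻¹ * (1 - q ^ m) * (1 - a * b * q ^ (m + 1))) *
        rFun (latticePt a c q j) m a b c q := by
  have h1 := (h.symm_coeff_mul_sqrt hij hκ hA hA2).2
  have h2 := (h.symm_coeff_mul_sqrt hjk hκ hB hB2).1
  have h3 := jacobiPoly_difference h m (h.latticePt_ne_zero j)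
  rw [← hjk, show latticePt a c q j / q = latticePt a c q i by
    rw [hij, mul_div_cancel_left₀ _ h.q_pos.ne']] at h3
  rw [h.rFun_eq, h.rFun_eq, h.rFun_eq]
  linear_combination
    (√(vWeight m a b c q) * (jacobiPoly a b c q m).eval (latticePt a c q i)) * h1 +
    (√(vWeight m a b c q) * (jacobiPoly a b c q m).eval (latticePt a c q k)) * h2 +
    (κ * √(latticeWt a b c q j) * √(vWeight m a b c q)) * h3

/-- The symmetrised difference equation at an end of the lattice. -/
theorem rFun_recurrence_end (h : Admissible a b c q) {j k : ℕ ⊕ ℕ}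
    (hj : lowerCoeff a c q (latticePt a c q j) = 0)
    (hjk : latticePt a c q k = q * latticePt a c q j) {κ B : ℝ} (hκ : 0 ≤ κ)
    (hB : 0 ≤ B)
    (hB2 : B ^ 2 = κ ^ 2 * (raiseCoeff a b c q (latticePt a c q j) *
      lowerCoeff a c q (latticePt a c q k))) (m : ℕ) :
    B * rFun (latticePt a c q k) m a b c q =
      κ * (raiseCoeff a b c q (latticePt a c q j) -
        (q ^ m)⁻¹ * (1 - q ^ m) * (1 - a * b * q ^ (m + 1))) *
        rFun (latticePt a c q j) m a b c q := by
  have h2 := (h.symm_coeff_mul_sqrt hjk hκ hB hB2).1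
  have h3 := jacobiPoly_difference h m (h.latticePt_ne_zero j)
  rw [← hjk, hj, zero_mul, add_zero] at h3
  rw [h.rFun_eq, h.rFun_eq]
  linear_combination
    (√(vWeight m a b c q) * (jacobiPoly a b c q m).eval (latticePt a c q k)) * h2 +
    (κ * √(latticeWt a b c q j) * √(vWeight m a b c q)) * h3

end Admissible

end Difference

/-! ### The Casimir element in tensor products of weighted shifts -/

section Casimir

/-- Generators acting by weighted shifts. -/
structure ShiftRep {q : ℝ} {ι : Type} (π : Uq q →ₐ[ℂ] Module.End ℂ (ι →₀ ℂ)) (w w' : ι → ℝ)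
    (s t : ι → ι) (e f : ι → ℝ) : Prop where
  K_eq : π (gen q .K) = wmap (fun n => n) w
  Kinv_eq : π (gen q .Kinv) = wmap (fun n => n) w'
  E_eq : π (gen q .E) = wmap s e
  F_eq : π (gen q .F) = wmap t f

theorem wmap_single_smul {ι : Type*} (s : ι → ι) (c : ι → ℝ) (n : ι) :
    wmap s c (Finsupp.single n 1) = (c n : ℂ) • Finsupp.single (s n) (1 : ℂ) := by
  rw [wmap_single, Finsupp.smul_single, smul_eq_mul, mul_one]

theorem tensorRep_gen {q : ℝ} (hq : q ≠ 0) {V W : Type} [AddCommGroup V] [Module ℂ V]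
    [AddCommGroup W] [Module ℂ W] (π₁ : Uq q →ₐ[ℂ] Module.End ℂ V)
    (π₂ : Uq q →ₐ[ℂ] Module.End ℂ W) (v : V) (w : W) :
    tensorRep hq π₁ π₂ (gen q .K) (v ⊗ₜ w) = π₁ (gen q .K) v ⊗ₜ π₂ (gen q .K) w ∧
    tensorRep hq π₁ π₂ (gen q .Kinv) (v ⊗ₜ w) = π₁ (gen q .Kinv) v ⊗ₜ π₂ (gen q .Kinv) w ∧
    tensorRep hq π₁ π₂ (gen q .E) (v ⊗ₜ w) =
      π₁ (gen q .K) v ⊗ₜ π₂ (gen q .E) w + π₁ (gen q .E) v ⊗ₜ π₂ (gen q .Kinv) w ∧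
    tensorRep hq π₁ π₂ (gen q .F) (v ⊗ₜ w) =
      π₁ (gen q .K) v ⊗ₜ π₂ (gen q .F) w + π₁ (gen q .F) v ⊗ₜ π₂ (gen q .Kinv) w := by
  refine ⟨?_, ?_, ?_, ?_⟩ <;>
  simp [tensorRep, comul, Uq.lift_gen, genImage, Module.endTensorEndAlgHom_apply]

/-- The Casimir element in a tensor product of representations by weighted shifts. -/
theorem tensorRep_casimir_single {q : ℝ} (hq : q ≠ 0) {ι κ : Type}
    {π₁ : Uq q →ₐ[ℂ] Module.End ℂ (ι →₀ ℂ)} {π₂ : Uq q →ₐ[ℂ] Module.End ℂ (κ →₀ ℂ)}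
    {w₁ w₁' : ι → ℝ} {s₁ t₁ : ι → ι} {e₁ f₁ : ι → ℝ}
    {w₂ w₂' : κ → ℝ} {s₂ t₂ : κ → κ} {e₂ f₂ : κ → ℝ}
    (h₁ : ShiftRep π₁ w₁ w₁' s₁ t₁ e₁ f₁) (h₂ : ShiftRep π₂ w₂ w₂' s₂ t₂ e₂ f₂)
    (i : ι) (j : κ) :
    tensorRep hq π₁ π₂ (casimir q) (Finsupp.single i 1 ⊗ₜ Finsupp.single j 1) =
      ((((q⁻¹ - q) ^ 2)⁻¹ * (q⁻¹ * (w₁ i * w₂ j) ^ 2 + q * (w₁' i * w₂' j) ^ 2 - 2) : ℝ) : ℂ) •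
        (Finsupp.single i (1 : ℂ) ⊗ₜ[ℂ] Finsupp.single j (1 : ℂ)) +
      ((w₁ i ^ 2 * (f₂ j * e₂ (t₂ j)) : ℝ) : ℂ) •
        (Finsupp.single i (1 : ℂ) ⊗ₜ[ℂ] Finsupp.single (s₂ (t₂ j)) (1 : ℂ)) +
      ((w₁ i * e₁ i * (f₂ j * w₂' (t₂ j)) : ℝ) : ℂ) •
        (Finsupp.single (s₁ i) (1 : ℂ) ⊗ₜ[ℂ] Finsupp.single (t₂ j) (1 : ℂ)) +
      ((f₁ i * w₁ (t₁ i) * (w₂' j * e₂ j) : ℝ) : ℂ) •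
        (Finsupp.single (t₁ i) (1 : ℂ) ⊗ₜ[ℂ] Finsupp.single (s₂ j) (1 : ℂ)) +
      ((f₁ i * e₁ (t₁ i) * w₂' j ^ 2 : ℝ) : ℂ) •
        (Finsupp.single (s₁ (t₁ i)) (1 : ℂ) ⊗ₜ[ℂ] Finsupp.single j (1 : ℂ)) := by
  have hK := fun v w => (tensorRep_gen hq π₁ π₂ v w).1
  have hK' := fun v w => (tensorRep_gen hq π₁ π₂ v w).2.1
  have hE := fun v w => (tensorRep_gen hq π₁ π₂ v w).2.2.1
  have hF := fun v w => (tensorRep_gen hq π₁ π₂ v w).2.2.2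
  -- The constant is written as a scalar multiple of `1`, so that linearity of the representation
  -- evaluates it.
  have hcas : casimir q = ((((q⁻¹ - q) ^ 2)⁻¹ : ℝ) : ℂ) •
      (((q⁻¹ : ℝ) : ℂ) • (gen q .K * gen q .K) + (q : ℂ) • (gen q .Kinv * gen q .Kinv) +
        (-2 : ℂ) • 1) + gen q .E * gen q .F := by
    have h2 : (-2 : ℂ) • (1 : Uq q) = -2 := by
      rw [← Algebra.algebraMap_eq_smul_one]
      refine (map_neg (algebraMap ℂ (Uq q)) 2).trans ?_
      rw [map_ofNat]
    rw [casimir, h2, pow_two (gen q .K), pow_two (gen q .Kinv), sub_eq_add_neg (_ + _)]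
  rw [hcas]
  simp only [map_add, map_smul, map_mul, map_one, LinearMap.add_apply,
    LinearMap.smul_apply, Module.End.mul_apply, Module.End.one_apply,
    hK, hK', hE, hF, h₁.K_eq, h₁.Kinv_eq, h₁.E_eq, h₁.F_eq, h₂.K_eq, h₂.Kinv_eq, h₂.E_eq,
    h₂.F_eq, wmap_single_smul, ← TensorProduct.smul_tmul', TensorProduct.tmul_smul, smul_smul]
  push_cast
  module

end Casimir

/-! ### The Hilbert basis of the closure of `A_p` -/

section Closure

theorem toHilb_vecMinus (p : ℤ) (n : ℕ) :
    toHilb (vecMinus p n) = lp.single 2 (Sum.inl (n, (n : ℤ) + p)) (1 : ℂ) := by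
  simp [toHilb, vecMinus]

theorem toHilb_vecPlus (l p : ℤ) (n : ℕ) :
    toHilb (vecPlus l p n) = lp.single 2 (Sum.inr (l - (n : ℤ) + p, n)) (1 : ℂ) := by
  simp [toHilb, vecPlus]

/-- The vectors `f⁻_{p,n}` and `f⁺_{p,n}` as one family. -/
def fVec (l p : ℤ) : ℕ ⊕ ℕ → subA l p := Sum.elim (fMinus l p) (fPlus l p)

/-- The index of `f^∓_{p,n}` in the standard basis. -/
def fIdx (l p : ℤ) : ℕ ⊕ ℕ → (ℕ × ℤ) ⊕ (ℤ × ℕ) :=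
  Sum.elim (fun n => Sum.inl (n, (n : ℤ) + p)) fun n => Sum.inr (l - (n : ℤ) + p, n)

theorem fIdx_injective (l p : ℤ) : Function.Injective (fIdx l p) := by
  rintro (m | m) (n | n) h <;> simp_all [fIdx]

theorem coe_inclA (l p : ℤ) (x : subA l p) : (inclA l p x : Hilb) = toHilb (x : Dom) := rfl

theorem coe_inclA_fVec (l p : ℤ) (i : ℕ ⊕ ℕ) :
    (inclA l p (fVec l p i) : Hilb) = lp.single 2 (fIdx l p i) (1 : ℂ) := by
  rcases i with n | n
  · exact toHilb_vecMinus p n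
  · exact toHilb_vecPlus l p n

theorem orthonormal_inclA_fVec (l p : ℤ) : Orthonormal ℂ fun i => inclA l p (fVec l p i) := by
  classical
  rw [orthonormal_iff_ite]
  intro i j
  rw [Submodule.coe_inner, coe_inclA_fVec, coe_inclA_fVec, lp.inner_single_left, lp.single_apply]
  by_cases h : i = j
  · subst h; simp
  · rw [if_neg h, Pi.single_eq_of_ne fun e => h (fIdx_injective l p e)]
    simp

theorem span_range_fVec (l p : ℤ) : Submodule.span ℂ (Set.range (fVec l p)) = ⊤ := by
  have h : (Submodule.span ℂ (Set.range (fVec l p))).map (subA l p).subtype = subA l p := by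
    rw [Submodule.map_span, ← Set.range_comp]
    refine Eq.trans ?_ (Submodule.span_union _ _)
    congr 1
    ext x
    constructor
    · rintro ⟨n | n, rfl⟩
      exacts [Or.inl ⟨n, rfl⟩, Or.inr ⟨n, rfl⟩]
    · rintro (⟨n, rfl⟩ | ⟨n, rfl⟩)
      exacts [⟨Sum.inl n, rfl⟩, ⟨Sum.inr n, rfl⟩]
  apply Submodule.map_injective_of_injective (subA l p).injective_subtype
  rw [h, Submodule.map_top, Submodule.range_subtype]

/-- Orthogonality to the `f^∓_{p,n}` extends to their span and then to its closure, which contains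
`g`; hence `g` is orthogonal to itself. -/
theorem eq_zero_of_inner_inclA_fVec (l p : ℤ) (g : closureA l p)
    (hg : ∀ i, inner ℂ (inclA l p (fVec l p i)) g = 0) : g = 0 := by
  have h1 : (g : Hilb) ∈ ((subA l p).map toHilb)ᗮ := by
    rw [Submodule.mem_orthogonal]
    rintro _ ⟨x, hx, rfl⟩
    have hx' : (⟨x, hx⟩ : subA l p) ∈ Submodule.span ℂ (Set.range (fVec l p)) := by
      rw [span_range_fVec]; trivial
    have key : ∀ y ∈ Submodule.span ℂ (Set.range (fVec l p)),
        inner ℂ (inclA l p y : Hilb) (g : Hilb) = 0 := by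
      intro y hy
      induction hy using Submodule.span_induction with
      | mem y hy =>
        obtain ⟨i, rfl⟩ := hy
        exact hg i
      | zero => simp
      | add y z _ _ hy hz =>
        rw [map_add, Submodule.coe_add, inner_add_left, hy, hz, add_zero]
      | smul r y _ hy =>
        rw [map_smul, Submodule.coe_smul, inner_smul_left, hy, mul_zero]
    rw [← coe_inclA l p ⟨x, hx⟩]
    exact key _ hx'
  rw [← Submodule.orthogonal_closure] at h1
  have h2 : inner ℂ (g : Hilb) (g : Hilb) = 0 :=
    Submodule.inner_right_of_mem_orthogonal g.2 h1
  rw [inner_self_eq_zero] at h2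
  exact Submodule.coe_eq_zero.1 h2

/-- The vectors `f^∓_{p,n}` form a Hilbert basis of the closure of `A_p`. -/
def fBasis (l p : ℤ) : HilbertBasis (ℕ ⊕ ℕ) ℂ (closureA l p) :=
  HilbertBasis.mkOfOrthogonalEqBot (orthonormal_inclA_fVec l p) <| by
    rw [Submodule.eq_bot_iff]
    intro g hg
    exact eq_zero_of_inner_inclA_fVec l p g fun i =>
      (Submodule.mem_orthogonal _ g).1 hg _ (Submodule.subset_span ⟨i, rfl⟩)

theorem fBasis_repr (l p : ℤ) (i : ℕ ⊕ ℕ) :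
    (fBasis l p).repr (inclA l p (fVec l p i)) = lp.single 2 i (1 : ℂ) := by
  have := (fBasis l p).repr_self i
  rwa [fBasis, HilbertBasis.coe_mkOfOrthogonalEqBot] at this

end Closure

/-! ### Abstract matching of a Jacobi matrix with the difference equation -/

section Chain

variable {a b c q : ℝ}

/-- A tridiagonal operator given by the symmetrised difference equation along one half of the
lattice has the functions `r_x(m)` as eigenvectors. -/
theorem Admissible.chain_eigen (h : Admissible a b c q) {σ : ℕ → ℕ ⊕ ℕ}
    (hσ : ∀ n, latticePt a c q (σ (n + 1)) = q * latticePt a c q (σ n))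
    (h0 : lowerCoeff a c q (latticePt a c q (σ 0)) = 0) {κ G τ : ℝ} (hκ : 0 ≤ κ)
    {A A' D F : ℕ → ℝ} (hA : ∀ n, 0 ≤ A n)
    (hA2 : ∀ n, A n ^ 2 = κ ^ 2 * (raiseCoeff a b c q (latticePt a c q (σ n)) *
      lowerCoeff a c q (latticePt a c q (σ (n + 1)))))
    (hA0 : A' 0 = 0) (hA' : ∀ n, A' (n + 1) = A n)
    (hD : ∀ n, D n = -κ * (raiseCoeff a b c q (latticePt a c q (σ n)) +
      lowerCoeff a c q (latticePt a c q (σ n)) + 1 + a * b * q) - 2 * G)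
    (hτ : τ * τ = 1) {m : ℕ} (hF : ∀ n, F n = τ ^ n * rFun (latticePt a c q (σ n)) m a b c q)
    (n : ℕ) :
    τ * A n * F (n + 1) + D n * F n + τ * A' n * F (n - 1) =
      (-κ * ((q ^ m)⁻¹ * (1 - q ^ m) * (1 - a * b * q ^ (m + 1)) + 1 + a * b * q) - 2 * G) *
        F n := by
  -- At `n = 0` the truncated `n - 1` makes `F (n - 1)` equal to `F 0`, but its coefficient `A' 0`
  -- is zero. In both cases `τ² = 1` lets the factor `τ^n` absorb the sign of the off-diagonal
  -- elements.
  rcases n with _ | n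
  · have h1 := h.rFun_recurrence_end h0 (hσ 0) hκ (hA 0) (hA2 0) m
    rw [hD, hF, hF, hA0, h0]
    linear_combination (τ * τ) * h1 + κ * (raiseCoeff a b c q (latticePt a c q (σ 0)) -
      (q ^ m)⁻¹ * (1 - q ^ m) * (1 - a * b * q ^ (m + 1))) *
      rFun (latticePt a c q (σ 0)) m a b c q * hτ
  · have h1 := h.rFun_recurrence (hσ n) (hσ (n + 1)) hκ (hA n) (hA (n + 1)) (hA2 n)
      (hA2 (n + 1)) m
    rw [hD, hF, hF, hA', Nat.add_sub_cancel, hF]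
    linear_combination (τ ^ (n + 1)) * h1 + (A (n + 1) * τ ^ (n + 1) *
      rFun (latticePt a c q (σ (n + 1 + 1))) m a b c q) * hτ

end Chain

/-! ### Matrix elements of the discrete and strange series -/

section Parameters

variable {q : ℝ}

/-- Raising and lowering operators are minus adjoint to each other. Together with the analogue for
the strange series this makes the Casimir matrix symmetric. -/
theorem discDown_succ (q k : ℝ) (n : ℕ) : discDown q k (n + 1) = -discUp q k n := by
  unfold discDown discUp
  rw [show 1 / 2 - k - ((n + 1 : ℕ) : ℝ) = -(1 / 2) - k - n by push_cast; ring,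
    show 2 * ((n + 1 : ℕ) : ℝ) = 2 * n + 2 by push_cast; ring,
    show 4 * k + (2 * (n : ℝ) + 2) - 2 = 4 * k + 2 * n by ring]

theorem strangeDown_succ (q σ ε : ℝ) (n : ℤ) :
    strangeDown q σ ε (n + 1) = -strangeUp q σ ε n := by
  unfold strangeDown strangeUp
  rw [show 1 / 2 - ((n + 1 : ℤ) : ℝ) - ε = -(1 / 2) - n - ε by push_cast; ring,
    show 2 * ((n + 1 : ℤ) : ℝ) + 2 * ε + 2 * σ - 1 = 2 * n + 2 * ε + 2 * σ + 1 by
      push_cast; ring,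
    show 2 * ((n + 1 : ℤ) : ℝ) + 2 * ε - 2 * σ - 1 = 2 * n + 2 * ε - 2 * σ + 1 by
      push_cast; ring]

theorem discDown_zero (q k : ℝ) : discDown q k 0 = 0 := by simp [discDown]

theorem discUp_nonneg (hq : 0 < q) (hq1 : q < 1) (k : ℝ) (n : ℕ) : 0 ≤ discUp q k n := by
  have : 0 < q⁻¹ - q := by have := (one_lt_inv₀ hq).2 hq1; linarith
  unfold discUp; positivity

theorem strangeUp_nonneg (hq : 0 < q) (hq1 : q < 1) (σ ε : ℝ) (n : ℤ) :
    0 ≤ strangeUp q σ ε n := by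
  have : 0 < q⁻¹ - q := by have := (one_lt_inv₀ hq).2 hq1; linarith
  unfold strangeUp; positivity

theorem rpow_two_mul_sub_one (hq : 0 < q) (k : ℝ) :
    q ^ (2 * k - 1) = (q ^ k) ^ 2 / q ∧ q ^ (1 - 2 * k) = q / (q ^ k) ^ 2 := by
  rw [Real.rpow_sub hq, Real.rpow_sub hq, mul_comm 2 k, Real.rpow_mul hq.le, Real.rpow_two,
    Real.rpow_one]
  exact ⟨rfl, rfl⟩

theorem discWeight_eq (hq : 0 < q) (k : ℝ) (n : ℕ) : discWeight q k n = q ^ k * q ^ n := by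
  rw [discWeight, Real.rpow_add hq, Real.rpow_natCast]

theorem discUp_sq (hq : 0 < q) (hq1 : q < 1) {k : ℝ} (hk : 0 < k) (n : ℕ) :
    discUp q k n ^ 2 = ((q⁻¹ - q) ^ 2)⁻¹ * (q * (q ^ k * q ^ n) ^ 2 +
      q⁻¹ * ((q ^ k * q ^ n) ^ 2)⁻¹ - ((q ^ k) ^ 2 / q + q / (q ^ k) ^ 2)) := by
  have h := disc_up_down hq hq1 hk n
  rw [discDown_succ, discWeight_eq hq, (rpow_two_mul_sub_one hq k).1,
    (rpow_two_mul_sub_one hq k).2] at h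
  linear_combination -h

theorem strangeUp_sq (hq : 0 < q) (k ε : ℝ) (n : ℤ) :
    strangeUp q (k - 1 / 2) ε n ^ 2 = ((q⁻¹ - q) ^ 2)⁻¹ * (q * strangeWeight q ε n ^ 2 +
      q⁻¹ * (strangeWeight q ε n ^ 2)⁻¹ + ((q ^ k) ^ 2 / q + q / (q ^ k) ^ 2)) := by
  have h := strange_up_down hq (k - 1 / 2) ε n
  rw [strangeDown_succ, show 2 * (k - 1 / 2) = 2 * k - 1 by ring,
    show -(2 * k - 1) = 1 - 2 * k by ring, (rpow_two_mul_sub_one hq k).1,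
    (rpow_two_mul_sub_one hq k).2] at h
  linear_combination -h

/-- The diagonal part `EF` of the Casimir element in the discrete series. -/
theorem discDown_mul_discUp (hq : 0 < q) (hq1 : q < 1) {k : ℝ} (hk : 0 < k) (n : ℕ) :
    discDown q k n * discUp q k (n - 1) = -(((q⁻¹ - q) ^ 2)⁻¹ *
      (q⁻¹ * (q ^ k * q ^ n) ^ 2 + q * ((q ^ k * q ^ n) ^ 2)⁻¹ -
        ((q ^ k) ^ 2 / q + q / (q ^ k) ^ 2))) := by
  have hk0 := (Real.rpow_pos_of_pos hq k).ne'
  have hq0 := hq.ne'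
  rcases n with _ | n
  · rw [discDown_zero]
    simp only [pow_zero, mul_one]
    field_simp
    ring
  · have h := discUp_sq hq hq1 hk n
    rw [Nat.add_sub_cancel, discDown_succ, neg_mul, ← sq, h, pow_succ q n]
    congr 2
    have := pow_ne_zero n hq0
    field_simp

theorem strangeWeight_add_one (hq : 0 < q) (ε : ℝ) (n : ℤ) :
    strangeWeight q ε (n + 1) = q * strangeWeight q ε n := by
  rw [strangeWeight, strangeWeight, mul_comm, ← Real.rpow_add_one hq.ne']
  congr 1; push_cast; ring

theorem strangeWeight_pos (hq : 0 < q) (ε : ℝ) (n : ℤ) : 0 < strangeWeight q ε n :=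
  Real.rpow_pos_of_pos hq _

/-- The diagonal part `EF` of the Casimir element in the strange series. -/
theorem strangeDown_mul_strangeUp (hq : 0 < q) (k ε : ℝ) (n : ℤ) :
    strangeDown q (k - 1 / 2) ε n * strangeUp q (k - 1 / 2) ε (n - 1) =
      -(((q⁻¹ - q) ^ 2)⁻¹ * (q⁻¹ * strangeWeight q ε n ^ 2 + q * (strangeWeight q ε n ^ 2)⁻¹ +
        ((q ^ k) ^ 2 / q + q / (q ^ k) ^ 2))) := by
  obtain ⟨j, rfl⟩ : ∃ j, n = j + 1 := ⟨n - 1, by ring⟩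
  have hw := (strangeWeight_pos hq ε j).ne'
  have hq0 := hq.ne'
  rw [add_sub_cancel_right, strangeDown_succ, neg_mul, ← sq, strangeUp_sq hq,
    strangeWeight_add_one hq]
  congr 2
  field_simp

theorem negRep_shift {k : ℝ} (hq : 0 < q) (hq1 : q < 1) (hk : 0 < k) :
    ShiftRep (negRep hq hq1 hk) (fun n => (discWeight q k n)⁻¹) (discWeight q k)
      (fun n => n - 1) (fun n => n + 1) (discDown q k) (discUp q k) :=
  ⟨Uq.lift_gen _ _, Uq.lift_gen _ _, Uq.lift_gen _ _, Uq.lift_gen _ _⟩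

theorem posRep_shift {k : ℝ} (hq : 0 < q) (hq1 : q < 1) (hk : 0 < k) :
    ShiftRep (posRep hq hq1 hk) (discWeight q k) (fun n => (discWeight q k n)⁻¹)
      (fun n => n + 1) (fun n => n - 1) (discUp q k) (discDown q k) :=
  ⟨Uq.lift_gen _ _, Uq.lift_gen _ _, Uq.lift_gen _ _, Uq.lift_gen _ _⟩

theorem strangeRep_shift (hq : 0 < q) (hq1 : q < 1) (σ ε : ℝ) :
    ShiftRep (strangeRep hq hq1 σ ε) (strangeWeight q ε) (fun n => (strangeWeight q ε n)⁻¹)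
      (fun n => n + 1) (fun n => n - 1) (strangeUp q σ ε) (strangeDown q σ ε) :=
  ⟨Uq.lift_gen _ _, Uq.lift_gen _ _, Uq.lift_gen _ _, Uq.lift_gen _ _⟩

end Parameters

/-! ### The tridiagonal action of the Casimir element on `A_p` -/

section Action

variable {q k₁ k₂ ε : ℝ}

/-- The off-diagonal matrix element of the Casimir element between `f⁻_{p,n}` and
`f⁻_{p,n+1}`. -/
def minusOff (q k₁ k₂ ε : ℝ) (p : ℤ) (n : ℕ) : ℝ :=
  discUp q k₁ n * (discWeight q k₁ (n + 1))⁻¹ *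
    ((strangeWeight q (ε + k₂) (n + p))⁻¹ * strangeUp q (k₂ - 1 / 2) (ε + k₂) (n + p))

/-- The diagonal matrix element of the Casimir element at `f⁻_{p,n}`. -/
def minusDiag (q k₁ k₂ ε : ℝ) (p : ℤ) (n : ℕ) : ℝ :=
  ((q⁻¹ - q) ^ 2)⁻¹ * (q⁻¹ * ((discWeight q k₁ n)⁻¹ * strangeWeight q (ε + k₂) (n + p)) ^ 2 +
      q * (discWeight q k₁ n * (strangeWeight q (ε + k₂) (n + p))⁻¹) ^ 2 - 2) +
    (discWeight q k₁ n)⁻¹ ^ 2 * (strangeDown q (k₂ - 1 / 2) (ε + k₂) (n + p) *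
      strangeUp q (k₂ - 1 / 2) (ε + k₂) (n + p - 1)) +
    discUp q k₁ n * discDown q k₁ (n + 1) * (strangeWeight q (ε + k₂) (n + p))⁻¹ ^ 2

/-- Minus the off-diagonal matrix element of the Casimir element between `f⁺_{p,n}` and
`f⁺_{p,n+1}`. -/
def plusOff (q k₁ k₂ ε : ℝ) (l p : ℤ) (n : ℕ) : ℝ :=
  strangeUp q (k₁ - 1 / 2) (-ε - k₁) (l - n + p - 1) *
    strangeWeight q (-ε - k₁) (l - n + p - 1) * ((discWeight q k₂ n)⁻¹ * discUp q k₂ n)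

/-- The diagonal matrix element of the Casimir element at `f⁺_{p,n}`. -/
def plusDiag (q k₁ k₂ ε : ℝ) (l p : ℤ) (n : ℕ) : ℝ :=
  ((q⁻¹ - q) ^ 2)⁻¹ * (q⁻¹ * (strangeWeight q (-ε - k₁) (l - n + p) * discWeight q k₂ n) ^ 2 +
      q * ((strangeWeight q (-ε - k₁) (l - n + p))⁻¹ * (discWeight q k₂ n)⁻¹) ^ 2 - 2) +
    strangeWeight q (-ε - k₁) (l - n + p) ^ 2 * (discDown q k₂ n * discUp q k₂ (n - 1)) +
    strangeDown q (k₁ - 1 / 2) (-ε - k₁) (l - n + p) *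
      strangeUp q (k₁ - 1 / 2) (-ε - k₁) (l - n + p - 1) * (discWeight q k₂ n)⁻¹ ^ 2

/-- The predecessor of a sequence, vanishing at `0`. -/
def shiftSeq (A : ℕ → ℝ) : ℕ → ℝ
  | 0 => 0
  | n + 1 => A n

/-- The mixed terms of `Δ(E)Δ(F)` move both indices in the same direction, since `E` lowers in `π⁻`
and raises in `π^S`; the difference `p` of the indices is preserved. Signs cancel, so the
off-diagonal elements are nonnegative. -/
theorem repT'_vecMinus (hq : 0 < q) (hq1 : q < 1) (hk₁ : 0 < k₁) (hk₂ : 0 < k₂) (p : ℤ)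
    (n : ℕ) :
    repT' hq hq1 hk₁ hk₂ ε (casimir q) (vecMinus p n) =
      ((1 * minusOff q k₁ k₂ ε p n : ℝ) : ℂ) • vecMinus p (n + 1) +
        ((minusDiag q k₁ k₂ ε p n : ℝ) : ℂ) • vecMinus p n +
        ((1 * shiftSeq (minusOff q k₁ k₂ ε p) n : ℝ) : ℂ) • vecMinus p (n - 1) := by
  have h := tensorRep_casimir_single hq.ne' (negRep_shift hq hq1 hk₁)
    (strangeRep_shift hq hq1 (k₂ - 1 / 2) (ε + k₂)) n ((n : ℤ) + p)
  have h1 : repT' hq hq1 hk₁ hk₂ ε (casimir q) (vecMinus p n) =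
      (tensorRep hq.ne' (negRep hq hq1 hk₁) (strangeRep hq hq1 (k₂ - 1 / 2) (ε + k₂))
        (casimir q) (Finsupp.single n 1 ⊗ₜ Finsupp.single ((n : ℤ) + p) 1), 0) :=
    Prod.ext rfl (LinearMap.map_zero (tensorRep hq.ne' (strangeRep hq hq1 (k₁ - 1 / 2) (-ε - k₁))
      (posRep hq hq1 hk₂) (casimir q)))
  rw [h1, h]
  simp only [vecMinus, Prod.smul_mk, Prod.mk_add_mk, smul_zero, add_zero, one_mul,
    Nat.add_sub_cancel, sub_add_cancel, minusDiag]
  congr 1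
  have e1 : ((n + 1 : ℕ) : ℤ) + p = n + p + 1 := by push_cast; ring
  rw [e1]
  -- For `n = 0` the term at the truncated index `n - 1` carries `discDown q k₁ 0 = 0`.
  rcases n with _ | n
  · simp only [discDown_zero, shiftSeq, minusOff]
    push_cast
    module
  · have e3 : ((n + 1 : ℕ) : ℤ) + p = n + p + 1 := by push_cast; ring
    simp only [shiftSeq, minusOff, Nat.add_sub_cancel, e3, discDown_succ,
      strangeDown_succ, add_sub_cancel_right]
    push_cast
    module

/-- Here `E` raises in both factors, so the mixed terms preserve the sum of the indices. Exactly one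
lowering coefficient enters each mixed term, hence the negative sign. -/
theorem repT'_vecPlus (hq : 0 < q) (hq1 : q < 1) (hk₁ : 0 < k₁) (hk₂ : 0 < k₂) (l p : ℤ)
    (n : ℕ) :
    repT' hq hq1 hk₁ hk₂ ε (casimir q) (vecPlus l p n) =
      ((-1 * plusOff q k₁ k₂ ε l p n : ℝ) : ℂ) • vecPlus l p (n + 1) +
        ((plusDiag q k₁ k₂ ε l p n : ℝ) : ℂ) • vecPlus l p n +
        ((-1 * shiftSeq (plusOff q k₁ k₂ ε l p) n : ℝ) : ℂ) • vecPlus l p (n - 1) := by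
  have h := tensorRep_casimir_single hq.ne' (strangeRep_shift hq hq1 (k₁ - 1 / 2) (-ε - k₁))
    (posRep_shift hq hq1 hk₂) (l - (n : ℤ) + p) n
  have h1 : repT' hq hq1 hk₁ hk₂ ε (casimir q) (vecPlus l p n) =
      (0, tensorRep hq.ne' (strangeRep hq hq1 (k₁ - 1 / 2) (-ε - k₁)) (posRep hq hq1 hk₂)
        (casimir q) (Finsupp.single (l - (n : ℤ) + p) 1 ⊗ₜ Finsupp.single n 1)) :=
    Prod.ext (LinearMap.map_zero (tensorRep hq.ne' (negRep hq hq1 hk₁)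
      (strangeRep hq hq1 (k₂ - 1 / 2) (ε + k₂)) (casimir q))) rfl
  rw [h1, h]
  simp only [vecPlus, Prod.smul_mk, Prod.mk_add_mk, smul_zero, add_zero,
    sub_add_cancel, plusDiag]
  congr 1
  have e1 : l - ((n + 1 : ℕ) : ℤ) + p = l - n + p - 1 := by push_cast; ring
  have e4 : strangeDown q (k₁ - 1 / 2) (-ε - k₁) (l - n + p) =
      -strangeUp q (k₁ - 1 / 2) (-ε - k₁) (l - n + p - 1) := by
    rw [← strangeDown_succ, sub_add_cancel]
  rw [e1]
  rcases n with _ | n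
  · simp only [discDown_zero, shiftSeq, plusOff, e4]
    push_cast
    module
  · have e3 : l - (n : ℤ) + p = l - ((n + 1 : ℕ) : ℤ) + p + 1 := by push_cast; ring
    simp only [shiftSeq, plusOff, Nat.add_sub_cancel, e3, e4, discDown_succ, add_sub_cancel_right]
    push_cast
    module

end Action

/-! ### Agreement of the matrix elements with the coefficients of the difference equation -/

section Identities

variable {q k₁ k₂ ε : ℝ}

theorem strangeWeight_minus (hq : 0 < q) (k ε : ℝ) (p : ℤ) (n : ℕ) :
    strangeWeight q (ε + k) (n + p) = q ^ n * q ^ (ε + p) * q ^ k := by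
  rw [strangeWeight, ← Real.rpow_natCast q n, ← Real.rpow_add hq, ← Real.rpow_add hq]
  congr 1; push_cast; ring

/-- Since `l = 2ε`, the exponent `l - n + p - ε - k` equals `ε + p - n - k`, so the same quantity
`q^(ε+p)` governs both summands. -/
theorem strangeWeight_plus (hq : 0 < q) (k : ℝ) {l : ℤ} (hε : 2 * ε = l) (p : ℤ) (n : ℕ) :
    strangeWeight q (-ε - k) (l - n + p) = q ^ (ε + p) / (q ^ n * q ^ k) := by
  rw [strangeWeight, ← Real.rpow_natCast q n, ← Real.rpow_add hq, ← Real.rpow_sub hq]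
  congr 1; push_cast; rw [← hε]; ring

theorem strangeWeight_plus_sub_one (hq : 0 < q) (k : ℝ) {l : ℤ} (hε : 2 * ε = l) (p : ℤ)
    (n : ℕ) : strangeWeight q (-ε - k) (l - n + p - 1) =
      q⁻¹ * (q ^ (ε + p) / (q ^ n * q ^ k)) := by
  rw [← strangeWeight_plus hq k hε p n]
  have := strangeWeight_add_one hq (-ε - k) (l - n + p - 1)
  rw [sub_add_cancel] at this
  rw [this, inv_mul_cancel_left₀ hq.ne']

/-- The factor between the Casimir element and the `q`-difference operator. -/
def casimirScale (q k₁ k₂ : ℝ) : ℝ :=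
  ((q⁻¹ - q) ^ 2)⁻¹ * (q / ((q ^ k₁) ^ 2 * (q ^ k₂) ^ 2))

/-- Comparing squares removes the roots. In `K = q^k₁`, `L = q^k₂`, `R = q^(ε+p)`, `X = q^n` this is
an identity of rational functions, evaluated at the positive lattice point `K⁴X²`. The diagonal
elements and the negative points `-K⁴X²/R²` are treated in the same way. -/
theorem minusOff_sq (hq : 0 < q) (hq1 : q < 1) (hk₁ : 0 < k₁) (p : ℤ) (n : ℕ) :
    minusOff q k₁ k₂ ε p n ^ 2 = casimirScale q k₁ k₂ ^ 2 *
      (raiseCoeff ((q ^ k₁) ^ 4 / q ^ 2) ((q ^ k₂) ^ 4 / q ^ 2)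
          (-((q ^ k₁) ^ 4 / ((q ^ (ε + p)) ^ 2 * q ^ 2))) (q ^ 2) ((q ^ k₁) ^ 4 * (q ^ n) ^ 2) *
        lowerCoeff ((q ^ k₁) ^ 4 / q ^ 2) (-((q ^ k₁) ^ 4 / ((q ^ (ε + p)) ^ 2 * q ^ 2))) (q ^ 2)
          ((q ^ k₁) ^ 4 * (q ^ (n + 1)) ^ 2)) := by
  have h1 := discUp_sq hq hq1 hk₁ n
  have h2 := strangeUp_sq hq k₂ (ε + k₂) (n + p)
  rw [strangeWeight_minus hq] at h2
  have e : minusOff q k₁ k₂ ε p n ^ 2 = discUp q k₁ n ^ 2 * ((discWeight q k₁ (n + 1))⁻¹) ^ 2 *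
      (((strangeWeight q (ε + k₂) (n + p))⁻¹) ^ 2 *
        strangeUp q (k₂ - 1 / 2) (ε + k₂) (n + p) ^ 2) := by
    rw [minusOff]; ring
  rw [e, h1, h2, strangeWeight_minus hq, discWeight_eq hq, casimirScale, raiseCoeff, lowerCoeff,
    pow_succ q n]
  have hK := Real.rpow_pos_of_pos hq k₁
  have hL := Real.rpow_pos_of_pos hq k₂
  have hR := Real.rpow_pos_of_pos hq (ε + p)
  have hX := pow_pos hq n
  generalize q ^ k₁ = K at *
  generalize q ^ k₂ = L at *
  generalize q ^ (ε + p) = R at *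
  generalize q ^ n = X at *
  generalize ((q⁻¹ - q) ^ 2)⁻¹ = G
  field_simp
  ring

theorem minusDiag_eq (hq : 0 < q) (hq1 : q < 1) (hk₁ : 0 < k₁) (p : ℤ) (n : ℕ) :
    minusDiag q k₁ k₂ ε p n = -casimirScale q k₁ k₂ *
      (raiseCoeff ((q ^ k₁) ^ 4 / q ^ 2) ((q ^ k₂) ^ 4 / q ^ 2)
          (-((q ^ k₁) ^ 4 / ((q ^ (ε + p)) ^ 2 * q ^ 2))) (q ^ 2) ((q ^ k₁) ^ 4 * (q ^ n) ^ 2) +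
        lowerCoeff ((q ^ k₁) ^ 4 / q ^ 2) (-((q ^ k₁) ^ 4 / ((q ^ (ε + p)) ^ 2 * q ^ 2))) (q ^ 2)
          ((q ^ k₁) ^ 4 * (q ^ n) ^ 2) + 1 +
        (q ^ k₁) ^ 4 / q ^ 2 * ((q ^ k₂) ^ 4 / q ^ 2) * q ^ 2) - 2 * ((q⁻¹ - q) ^ 2)⁻¹ := by
  have h1 := discUp_sq hq hq1 hk₁ n
  rw [minusDiag, strangeDown_mul_strangeUp hq, discDown_succ, mul_neg (discUp q k₁ n), ← sq, h1,
    strangeWeight_minus hq, discWeight_eq hq, casimirScale, raiseCoeff, lowerCoeff]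
  have hK := Real.rpow_pos_of_pos hq k₁
  have hL := Real.rpow_pos_of_pos hq k₂
  have hR := Real.rpow_pos_of_pos hq (ε + p)
  have hX := pow_pos hq n
  generalize q ^ k₁ = K at *
  generalize q ^ k₂ = L at *
  generalize q ^ (ε + p) = R at *
  generalize q ^ n = X at *
  generalize ((q⁻¹ - q) ^ 2)⁻¹ = G
  field_simp
  ring

theorem plusOff_sq (hq : 0 < q) (hq1 : q < 1) (hk₂ : 0 < k₂) {l : ℤ} (hε : 2 * ε = l) (p : ℤ)
    (n : ℕ) :
    plusOff q k₁ k₂ ε l p n ^ 2 = casimirScale q k₁ k₂ ^ 2 *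
      (raiseCoeff ((q ^ k₁) ^ 4 / q ^ 2) ((q ^ k₂) ^ 4 / q ^ 2)
          (-((q ^ k₁) ^ 4 / ((q ^ (ε + p)) ^ 2 * q ^ 2))) (q ^ 2)
          (-((q ^ k₁) ^ 4 * (q ^ n) ^ 2 / (q ^ (ε + p)) ^ 2)) *
        lowerCoeff ((q ^ k₁) ^ 4 / q ^ 2) (-((q ^ k₁) ^ 4 / ((q ^ (ε + p)) ^ 2 * q ^ 2))) (q ^ 2)
          (-((q ^ k₁) ^ 4 * (q ^ (n + 1)) ^ 2 / (q ^ (ε + p)) ^ 2))) := by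
  have h1 := discUp_sq hq hq1 hk₂ n
  have h2 := strangeUp_sq hq k₁ (-ε - k₁) (l - n + p - 1)
  rw [strangeWeight_plus_sub_one hq k₁ hε] at h2
  have e : plusOff q k₁ k₂ ε l p n ^ 2 =
      strangeUp q (k₁ - 1 / 2) (-ε - k₁) (l - n + p - 1) ^ 2 *
        strangeWeight q (-ε - k₁) (l - n + p - 1) ^ 2 *
        (((discWeight q k₂ n)⁻¹) ^ 2 * discUp q k₂ n ^ 2) := by
    rw [plusOff]; ring
  rw [e, h1, h2, strangeWeight_plus_sub_one hq k₁ hε, discWeight_eq hq, casimirScale, raiseCoeff,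
    lowerCoeff, pow_succ q n]
  have hK := Real.rpow_pos_of_pos hq k₁
  have hL := Real.rpow_pos_of_pos hq k₂
  have hR := Real.rpow_pos_of_pos hq (ε + p)
  have hX := pow_pos hq n
  generalize q ^ k₁ = K at *
  generalize q ^ k₂ = L at *
  generalize q ^ (ε + p) = R at *
  generalize q ^ n = X at *
  generalize ((q⁻¹ - q) ^ 2)⁻¹ = G
  field_simp
  ring

theorem plusDiag_eq (hq : 0 < q) (hq1 : q < 1) (hk₂ : 0 < k₂) {l : ℤ} (hε : 2 * ε = l) (p : ℤ)
    (n : ℕ) :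
    plusDiag q k₁ k₂ ε l p n = -casimirScale q k₁ k₂ *
      (raiseCoeff ((q ^ k₁) ^ 4 / q ^ 2) ((q ^ k₂) ^ 4 / q ^ 2)
          (-((q ^ k₁) ^ 4 / ((q ^ (ε + p)) ^ 2 * q ^ 2))) (q ^ 2)
          (-((q ^ k₁) ^ 4 * (q ^ n) ^ 2 / (q ^ (ε + p)) ^ 2)) +
        lowerCoeff ((q ^ k₁) ^ 4 / q ^ 2) (-((q ^ k₁) ^ 4 / ((q ^ (ε + p)) ^ 2 * q ^ 2))) (q ^ 2)
          (-((q ^ k₁) ^ 4 * (q ^ n) ^ 2 / (q ^ (ε + p)) ^ 2)) + 1 +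
        (q ^ k₁) ^ 4 / q ^ 2 * ((q ^ k₂) ^ 4 / q ^ 2) * q ^ 2) - 2 * ((q⁻¹ - q) ^ 2)⁻¹ := by
  rw [plusDiag, strangeDown_mul_strangeUp hq, discDown_mul_discUp hq hq1 hk₂,
    strangeWeight_plus hq k₁ hε, discWeight_eq hq, casimirScale, raiseCoeff, lowerCoeff]
  have hK := Real.rpow_pos_of_pos hq k₁
  have hL := Real.rpow_pos_of_pos hq k₂
  have hR := Real.rpow_pos_of_pos hq (ε + p)
  have hX := pow_pos hq n
  generalize q ^ k₁ = K at *
  generalize q ^ k₂ = L at *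
  generalize q ^ (ε + p) = R at *
  generalize q ^ n = X at *
  generalize ((q⁻¹ - q) ^ 2)⁻¹ = G
  field_simp
  ring

/-- With `Q = q²` the inner bracket collapses to `Q^(-m) + abQ^(m+1)`; `casimirScale` balances the
two terms into `q^(±(2k₁+2k₂-1+2m))`. -/
theorem casimir_eigenvalue (hq : 0 < q) (k₁ k₂ : ℝ) (m : ℕ) :
    -casimirScale q k₁ k₂ * (((q ^ 2) ^ m)⁻¹ * (1 - (q ^ 2) ^ m) *
      (1 - (q ^ k₁) ^ 4 / q ^ 2 * ((q ^ k₂) ^ 4 / q ^ 2) * (q ^ 2) ^ (m + 1)) + 1 +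
        (q ^ k₁) ^ 4 / q ^ 2 * ((q ^ k₂) ^ 4 / q ^ 2) * q ^ 2) - 2 * ((q⁻¹ - q) ^ 2)⁻¹ =
    -((q⁻¹ - q) ^ 2)⁻¹ * (q ^ (2 * k₁ + 2 * k₂ - 1 + 2 * m) +
      q ^ (-(2 * k₁ + 2 * k₂ - 1 + 2 * m)) + 2) := by
  have e : q ^ (2 * k₁ + 2 * k₂ - 1 + 2 * m) =
      (q ^ k₁) ^ 2 * (q ^ k₂) ^ 2 / q * (q ^ 2) ^ m := by
    rw [Real.rpow_add hq, Real.rpow_sub hq, Real.rpow_add hq, mul_comm 2 k₁, mul_comm 2 k₂,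
      Real.rpow_mul hq.le, Real.rpow_mul hq.le, Real.rpow_one, Real.rpow_mul hq.le 2,
      Real.rpow_natCast]
    simp only [Real.rpow_two]
  rw [Real.rpow_neg hq.le, e, casimirScale, pow_succ (q ^ 2) m]
  have hK := Real.rpow_pos_of_pos hq k₁
  have hL := Real.rpow_pos_of_pos hq k₂
  have hX := pow_pos (pow_pos hq 2) m
  generalize q ^ k₁ = K at *
  generalize q ^ k₂ = L at *
  generalize (q ^ 2) ^ m = X at *
  generalize ((q⁻¹ - q) ^ 2)⁻¹ = G
  field_simp
  ring

end Identities

/-! ### The parameters and lattice points in base `q²` -/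

section Parameters

variable {q k₁ k₂ ε : ℝ}

theorem rpow_four_mul (hq : 0 < q) (k : ℝ) : q ^ (4 * k) = (q ^ k) ^ 4 := by
  rw [mul_comm, Real.rpow_mul hq.le]; norm_cast

theorem rpow_four_mul_sub_two (hq : 0 < q) (k : ℝ) : q ^ (4 * k - 2) = (q ^ k) ^ 4 / q ^ 2 := by
  rw [Real.rpow_sub hq, rpow_four_mul hq, Real.rpow_two]

theorem rpow_quotient (hq : 0 < q) (k ε : ℝ) (p : ℤ) :
    q ^ (4 * k - 2 * p - 2 * ε) = (q ^ k) ^ 4 / (q ^ (ε + p)) ^ 2 := by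
  rw [show 4 * k - 2 * p - 2 * ε = 4 * k - (ε + p) * 2 by ring, Real.rpow_sub hq,
    rpow_four_mul hq, Real.rpow_mul hq.le, Real.rpow_two]

theorem rpow_quotient_sub_two (hq : 0 < q) (k ε : ℝ) (p : ℤ) :
    q ^ (4 * k - 2 * p - 2 * ε - 2) = (q ^ k) ^ 4 / ((q ^ (ε + p)) ^ 2 * q ^ 2) := by
  rw [Real.rpow_sub hq, rpow_quotient hq, Real.rpow_two, div_div]

theorem rpow_two_mul_add (hq : 0 < q) (n : ℕ) (s : ℝ) : q ^ (2 * n + s) = (q ^ n) ^ 2 * q ^ s := by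
  rw [Real.rpow_add hq, mul_comm 2 (n : ℝ), Real.rpow_mul hq.le, Real.rpow_natCast, Real.rpow_two]

theorem admissible_params (hq : 0 < q) (hq1 : q < 1) (hk₁ : 0 < k₁) (hk₂ : 0 < k₂) (ε : ℝ)
    (p : ℤ) : Admissible ((q ^ k₁) ^ 4 / q ^ 2) ((q ^ k₂) ^ 4 / q ^ 2)
      (-((q ^ k₁) ^ 4 / ((q ^ (ε + p)) ^ 2 * q ^ 2))) (q ^ 2) := by
  have hq2 : q ^ 2 ≠ 0 := (pow_pos hq 2).ne'
  have hlt : ∀ k : ℝ, 0 < k → (q ^ k) ^ 4 / q ^ 2 * q ^ 2 < 1 := by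
    intro k hk
    rw [div_mul_cancel₀ _ hq2]
    exact pow_lt_one₀ (Real.rpow_pos_of_pos hq k).le (Real.rpow_lt_one hq.le hq1 hk) (by norm_num)
  have h1 := Real.rpow_pos_of_pos hq k₁
  have h2 := Real.rpow_pos_of_pos hq k₂
  have h3 := Real.rpow_pos_of_pos hq (ε + p)
  exact ⟨by positivity, pow_lt_one₀ hq.le hq1 (by norm_num), by positivity, hlt _ hk₁,
    by positivity, hlt _ hk₂, neg_neg_of_pos (by positivity)⟩

theorem latticePt_inl_params (hq : 0 < q) (k₁ c : ℝ) (n : ℕ) :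
    latticePt ((q ^ k₁) ^ 4 / q ^ 2) c (q ^ 2) (Sum.inl n) = (q ^ k₁) ^ 4 * (q ^ n) ^ 2 := by
  have := hq.ne'
  simp only [latticePt, Sum.elim_inl]
  rw [← pow_mul, ← pow_mul]
  field_simp
  ring

theorem latticePt_inr_params (hq : 0 < q) (k₁ a R : ℝ) (n : ℕ) :
    latticePt a (-((q ^ k₁) ^ 4 / (R ^ 2 * q ^ 2))) (q ^ 2) (Sum.inr n) =
      -((q ^ k₁) ^ 4 * (q ^ n) ^ 2 / R ^ 2) := by
  have h := hq.ne'
  simp only [latticePt, Sum.elim_inr]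
  rw [show (q ^ 2) ^ (n + 1) = q ^ 2 * (q ^ n) ^ 2 by ring, neg_mul, div_mul_eq_mul_div,
    mul_comm (R ^ 2), mul_left_comm, mul_div_mul_left _ _ (pow_ne_zero 2 h)]

end Parameters

/-! ### The unitary map and its restriction to `A_p` -/

section Intertwiner

variable {a b c q : ℝ}

/-- The unitary map sending `f^∓_{p,n}` to the functions `r_x`. -/
def intertwiner (h : Admissible a b c q) (l p : ℤ) : closureA l p ≃ₗᵢ[ℂ] L2N :=
  (fBasis l p).repr.trans h.colBasis.repr

theorem intertwiner_fVec (h : Admissible a b c q) (l p : ℤ) (i : ℕ ⊕ ℕ) (m : ℕ) :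
    intertwiner h l p (inclA l p (fVec l p i)) m = ((jacobiCol a b c q m i : ℝ) : ℂ) := by
  rw [intertwiner, LinearIsometryEquiv.trans_apply, fBasis_repr, h.colBasis_repr_single]

/-- The restriction of the unitary map to `A_p`. -/
def theta (h : Admissible a b c q) (l p : ℤ) : subA l p →ₗ[ℂ] L2N :=
  (intertwiner h l p).toLinearEquiv.toLinearMap ∘ₗ inclA l p

theorem theta_apply (h : Admissible a b c q) (l p : ℤ) (x : subA l p) :
    theta h l p x = intertwiner h l p (inclA l p x) := rfl

theorem theta_fVec (h : Admissible a b c q) (l p : ℤ) (i : ℕ ⊕ ℕ) (m : ℕ) :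
    theta h l p (fVec l p i) m = ((jacobiCol a b c q m i : ℝ) : ℂ) := by
  rw [theta_apply, intertwiner_fVec]

end Intertwiner

/-! ### The eigenvalue equation on `A_p` -/

section Eigen

/-- An endomorphism preserving a subspace that acts on spanning vectors by prescribed elements of
the subspace. -/
theorem mapsTo_subA {l p : ℤ} {T : Module.End ℂ Dom} {g : ℕ ⊕ ℕ → subA l p}
    (hT : ∀ i, T (fVec l p i : Dom) = g i) : ∀ x ∈ subA l p, T x ∈ subA l p := by
  intro x hx
  have hx' : (⟨x, hx⟩ : subA l p) ∈ Submodule.span ℂ (Set.range (fVec l p)) := by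
    rw [span_range_fVec]; trivial
  have key : ∀ y ∈ Submodule.span ℂ (Set.range (fVec l p)), T (y : Dom) ∈ subA l p := by
    intro y hy
    induction hy using Submodule.span_induction with
    | mem y hy =>
      obtain ⟨i, rfl⟩ := hy
      rw [hT]; exact (g i).2
    | zero => rw [Submodule.coe_zero, map_zero]; exact Submodule.zero_mem _
    | add y z _ _ hy hz => rw [Submodule.coe_add, map_add]; exact Submodule.add_mem _ hy hz
    | smul r y _ hy => rw [Submodule.coe_smul, map_smul]; exact Submodule.smul_mem _ r hy
  exact key _ hx'

theorem eigen_of_fVec {l p : ℤ} {T : Module.End ℂ Dom} {g : ℕ ⊕ ℕ → subA l p}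
    (hT : ∀ i, T (fVec l p i : Dom) = g i) (hA : ∀ x ∈ subA l p, T x ∈ subA l p)
    (Θ : subA l p →ₗ[ℂ] L2N) {m : ℕ} {r : ℂ} (hg : ∀ i, Θ (g i) m = r * Θ (fVec l p i) m)
    (x : subA l p) : Θ (T.restrict hA x) m = r * Θ x m := by
  have hx : x ∈ Submodule.span ℂ (Set.range (fVec l p)) := by
    rw [span_range_fVec]; trivial
  induction hx using Submodule.span_induction with
  | mem y hy =>
    obtain ⟨i, rfl⟩ := hy
    have : T.restrict hA (fVec l p i) = g i := Subtype.ext (hT i)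
    rw [this, hg]
  | zero => simp
  | add y z _ _ hy hz =>
    rw [map_add, map_add, map_add, lp.coeFn_add, lp.coeFn_add, Pi.add_apply, Pi.add_apply, hy, hz,
      mul_add]
  | smul s y _ hy =>
    rw [map_smul, map_smul, map_smul, lp.coeFn_smul, lp.coeFn_smul, Pi.smul_apply, Pi.smul_apply,
      hy, smul_eq_mul, smul_eq_mul, mul_left_comm]

theorem shiftSeq_succ (A : ℕ → ℝ) (n : ℕ) : shiftSeq A (n + 1) = A n := rfl

theorem minusOff_nonneg {q : ℝ} (hq : 0 < q) (hq1 : q < 1) (k₁ k₂ ε : ℝ) (p : ℤ) (n : ℕ) :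
    0 ≤ minusOff q k₁ k₂ ε p n :=
  mul_nonneg (mul_nonneg (discUp_nonneg hq hq1 _ _)
    (inv_nonneg.2 (Real.rpow_pos_of_pos hq _).le))
    (mul_nonneg (inv_nonneg.2 (strangeWeight_pos hq _ _).le) (strangeUp_nonneg hq hq1 _ _ _))

theorem plusOff_nonneg {q : ℝ} (hq : 0 < q) (hq1 : q < 1) (k₁ k₂ ε : ℝ) (l p : ℤ) (n : ℕ) :
    0 ≤ plusOff q k₁ k₂ ε l p n :=
  mul_nonneg (mul_nonneg (strangeUp_nonneg hq hq1 _ _ _) (strangeWeight_pos hq _ _).le)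
    (mul_nonneg (inv_nonneg.2 (Real.rpow_pos_of_pos hq _).le) (discUp_nonneg hq hq1 _ _))

/-- The images of `f^∓_{p,n}` under the Casimir element. -/
def casimirImage (q k₁ k₂ ε : ℝ) (l p : ℤ) : ℕ ⊕ ℕ → subA l p :=
  Sum.elim
    (fun n => ((1 * minusOff q k₁ k₂ ε p n : ℝ) : ℂ) • fVec l p (Sum.inl (n + 1)) +
      ((minusDiag q k₁ k₂ ε p n : ℝ) : ℂ) • fVec l p (Sum.inl n) +
      ((1 * shiftSeq (minusOff q k₁ k₂ ε p) n : ℝ) : ℂ) • fVec l p (Sum.inl (n - 1)))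
    fun n => ((-1 * plusOff q k₁ k₂ ε l p n : ℝ) : ℂ) • fVec l p (Sum.inr (n + 1)) +
      ((plusDiag q k₁ k₂ ε l p n : ℝ) : ℂ) • fVec l p (Sum.inr n) +
      ((-1 * shiftSeq (plusOff q k₁ k₂ ε l p) n : ℝ) : ℂ) • fVec l p (Sum.inr (n - 1))

theorem repT'_fVec {q k₁ k₂ ε : ℝ} (hq : 0 < q) (hq1 : q < 1) (hk₁ : 0 < k₁) (hk₂ : 0 < k₂)
    (l p : ℤ) (i : ℕ ⊕ ℕ) :
    repT' hq hq1 hk₁ hk₂ ε (casimir q) (fVec l p i : Dom) = casimirImage q k₁ k₂ ε l p i := by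
  rcases i with n | n
  · exact repT'_vecMinus hq hq1 hk₁ hk₂ p n
  · exact repT'_vecPlus hq hq1 hk₁ hk₂ l p n

theorem coe_smul_add_three (Θx Θy Θz : L2N) (r s t : ℝ) (x y z e : ℝ) (m : ℕ) (u : ℝ)
    (hx : Θx m = (x : ℂ)) (hy : Θy m = (y : ℂ)) (hz : Θz m = (z : ℂ))
    (h : r * x + s * y + t * z = e * u) :
    ((r : ℂ) • Θx + (s : ℂ) • Θy + (t : ℂ) • Θz) m = (e : ℂ) * (u : ℂ) := by
  rw [lp.coeFn_add, lp.coeFn_add, lp.coeFn_smul, lp.coeFn_smul, lp.coeFn_smul]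
  simp only [Pi.add_apply, Pi.smul_apply, smul_eq_mul, hx, hy, hz]
  exact_mod_cast h

/-- Each half of the lattice is one chain for `chain_eigen`, starting at `aq` or `cq`. The signs are
`τ = 1` on the positive half and `τ = -1` on the negative half; scale and eigenvalue are common to
both. -/
theorem theta_casimirImage {q k₁ k₂ ε : ℝ} (hq : 0 < q) (hq1 : q < 1) (hk₁ : 0 < k₁)
    (hk₂ : 0 < k₂) {l : ℤ} (hε : 2 * ε = l) (p : ℤ) (i : ℕ ⊕ ℕ) (m : ℕ) :
    theta (admissible_params hq hq1 hk₁ hk₂ ε p) l p (casimirImage q k₁ k₂ ε l p i) m =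
      ((-((q⁻¹ - q) ^ 2)⁻¹ * (q ^ (2 * k₁ + 2 * k₂ - 1 + 2 * m) +
        q ^ (-(2 * k₁ + 2 * k₂ - 1 + 2 * m)) + 2) : ℝ) : ℂ) *
        theta (admissible_params hq hq1 hk₁ hk₂ ε p) l p (fVec l p i) m := by
  have h := admissible_params hq hq1 hk₁ hk₂ ε p
  have hκ : 0 ≤ casimirScale q k₁ k₂ := by
    have := Real.rpow_pos_of_pos hq k₁
    have := Real.rpow_pos_of_pos hq k₂
    unfold casimirScale; positivity
  rw [← casimir_eigenvalue hq k₁ k₂ m]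
  rcases i with n | n
  · simp only [casimirImage, Sum.elim_inl, map_add, map_smul]
    rw [theta_fVec]
    refine coe_smul_add_three _ _ _ _ _ _ _ _ _ _ _ _ (theta_fVec h l p _ m)
      (theta_fVec h l p _ m) (theta_fVec h l p _ m) ?_
    refine h.chain_eigen (σ := Sum.inl) ?_ ?_ (A := minusOff q k₁ k₂ ε p)
      (A' := shiftSeq (minusOff q k₁ k₂ ε p)) (D := minusDiag q k₁ k₂ ε p)
      (F := fun n => jacobiCol _ _ _ _ m (Sum.inl n)) hκ
      (minusOff_nonneg hq hq1 k₁ k₂ ε p) ?_ rfl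
      (shiftSeq_succ _) ?_ (one_mul 1) ?_ n
    · intro n
      rw [latticePt_inl_params hq, latticePt_inl_params hq]; ring
    · simp [latticePt, lowerCoeff]
    · intro n
      rw [latticePt_inl_params hq, latticePt_inl_params hq, minusOff_sq hq hq1 hk₁]
    · intro n
      rw [latticePt_inl_params hq, minusDiag_eq hq hq1 hk₁]
    · intro n
      simp [jacobiCol, latticeSign]
  · simp only [casimirImage, Sum.elim_inr, map_add, map_smul]
    rw [theta_fVec]
    refine coe_smul_add_three _ _ _ _ _ _ _ _ _ _ _ _ (theta_fVec h l p _ m)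
      (theta_fVec h l p _ m) (theta_fVec h l p _ m) ?_
    refine h.chain_eigen (σ := Sum.inr) ?_ ?_ (A := plusOff q k₁ k₂ ε l p)
      (A' := shiftSeq (plusOff q k₁ k₂ ε l p)) (D := plusDiag q k₁ k₂ ε l p)
      (F := fun n => jacobiCol _ _ _ _ m (Sum.inr n)) hκ
      (plusOff_nonneg hq hq1 k₁ k₂ ε l p) ?_ rfl
      (shiftSeq_succ _) ?_ (by norm_num) ?_ n
    · intro n
      rw [latticePt_inr_params hq, latticePt_inr_params hq]; ring
    · simp [latticePt, lowerCoeff]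
    · intro n
      rw [latticePt_inr_params hq, latticePt_inr_params hq, plusOff_sq hq hq1 hk₂ hε]
    · intro n
      rw [latticePt_inr_params hq, plusDiag_eq hq hq1 hk₂ hε]
    · intro n
      simp [jacobiCol, latticeSign]

end Eigen

end QSU

end

theorem proposition3p4 (q k₁ k₂ ε : ℝ) (hq : 0 < q) (hq1 : q < 1) (hk₁ : 0 < k₁) (hk₂ : 0 < k₂)
    (l : ℤ) (hε : 2 * ε = l) (p : ℤ) :
    ∃ Θ : QSU.subA l p →ₗ[ℂ] QSU.L2N,
      (∀ n m : ℕ, Θ (QSU.fMinus l p n) m =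
        ((QSU.rFun (q ^ (2 * n + 4 * k₁)) m (q ^ (4 * k₁ - 2)) (q ^ (4 * k₂ - 2))
          (-q ^ (4 * k₁ - 2 * p - 2 * ε - 2)) (q ^ 2) : ℝ) : ℂ)) ∧
      (∀ n m : ℕ, Θ (QSU.fPlus l p n) m =
        (((-1) ^ n * QSU.rFun (-q ^ (2 * n + 4 * k₁ - 2 * p - 2 * ε)) m (q ^ (4 * k₁ - 2))
          (q ^ (4 * k₂ - 2)) (-q ^ (4 * k₁ - 2 * p - 2 * ε - 2)) (q ^ 2) : ℝ) : ℂ)) ∧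
      (∃ U : QSU.closureA l p ≃ₗᵢ[ℂ] QSU.L2N, ∀ x, U (QSU.inclA l p x) = Θ x) ∧
      ∃ hA : ∀ x ∈ QSU.subA l p,
          QSU.repT' hq hq1 hk₁ hk₂ ε (QSU.casimir q) x ∈ QSU.subA l p,
        ∀ (x : QSU.subA l p) (m : ℕ),
          Θ ((QSU.repT' hq hq1 hk₁ hk₂ ε (QSU.casimir q)).restrict hA x) m =
            ((-((q⁻¹ - q) ^ 2)⁻¹ * (q ^ (2 * k₁ + 2 * k₂ - 1 + 2 * m) +
              q ^ (-(2 * k₁ + 2 * k₂ - 1 + 2 * m)) + 2) : ℝ) : ℂ) * Θ x m := by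
  have h := QSU.admissible_params hq hq1 hk₁ hk₂ ε p
  -- The map is defined as the restriction of a unitary operator, so its values lie in `ℓ²(ℕ)` and
  -- the extension property holds by definition. The two goals left only rewrite real powers of `q`
  -- into the parameters used above.
  refine ⟨QSU.theta h l p, fun n m => ?_, fun n m => ?_,
    ⟨QSU.intertwiner h l p, fun x => rfl⟩,
    QSU.mapsTo_subA (QSU.repT'_fVec hq hq1 hk₁ hk₂ l p), fun x m =>
      QSU.eigen_of_fVec (QSU.repT'_fVec hq hq1 hk₁ hk₂ l p) _ _
        (fun i => QSU.theta_casimirImage hq hq1 hk₁ hk₂ hε p i m) x⟩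
  · refine (QSU.theta_fVec h l p (Sum.inl n) m).trans ?_
    rw [QSU.jacobiCol, QSU.latticePt_inl_params hq, QSU.rpow_two_mul_add hq,
      QSU.rpow_four_mul hq, QSU.rpow_four_mul_sub_two hq, QSU.rpow_four_mul_sub_two hq,
      QSU.rpow_quotient_sub_two hq, mul_comm ((q ^ n) ^ 2)]
    simp [QSU.latticeSign]
  · refine (QSU.theta_fVec h l p (Sum.inr n) m).trans ?_
    rw [QSU.jacobiCol, QSU.latticePt_inr_params hq,
      show 2 * (n : ℝ) + 4 * k₁ - 2 * p - 2 * ε = 2 * n + (4 * k₁ - 2 * p - 2 * ε) by ring,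
      QSU.rpow_two_mul_add hq, QSU.rpow_quotient hq, QSU.rpow_four_mul_sub_two hq,
      QSU.rpow_four_mul_sub_two hq, QSU.rpow_quotient_sub_two hq, ← mul_div_assoc,
      mul_comm ((q ^ n) ^ 2)]
    simp [QSU.latticeSign]
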